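/- **Setting.** Let $\pi:\mathcal C\to S$ be a separated smooth morphism of relative dimension $1$ of schemes over a field of characteristic $0$ (for example a family of smooth curves of genus $\ge 2$ over a complex base), and let $E$ be a locally free $\mathcal O_{\mathcal C}$-module of rank $r$. Let $p_1,p_2:\mathcal C\times_S\mathcal C\to\mathcal C$ be the projections, $\Delta:\mathcal C\to\mathcal C\times_S\mathcal C$ the diagonal, $\mathcal I$ the ideal sheaf of the diagonal, $T=T_{\mathcal C/S}$ the sheaf of $S$-derivations of $\mathcal O_{\mathcal C}$, and $\mathfrak g=\mathfrak{sl}(E)\subset\mathfrak{gl}(E)=\mathcal End(E)$ the sheaf of traceless endomorphisms, with its bracket $[\,,]:\mathfrak g\otimes\mathfrak g\to\mathfrak g$. A map $F\to G[1]$ is an element of $\mathrm{Ext}^1(F,G)$; all Ext groups below are those of $\mathcal O$-modules on $\mathcal C\times_S\mathcal C$, where a sheaf on $\mathcal C$ is regarded as a sheaf on $\mathcal C\times_S\mathcal C$ by $\Delta_*$. *Hitchin symbol.* Let $A\boxtimes B=p_1^*A\otimes p_2^*B$ and $N(\Delta)=\mathcal Hom(\mathcal I,N)$. With $df$ the class of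 $p_2^*f-p_1^*f$ in $\mathcal I/\mathcal I^2=\Omega_{\mathcal C/S}$, evaluation on the diagonal, $\varphi\mapsto\bigl(f\mapsto\varphi(p_2^*f-p_1^*f)|_\Delta\bigr)$, gives the sequence $$0\to \mathfrak g\boxtimes \mathfrak g\to(\mathfrak g\boxtimes \mathfrak g)(\Delta)\to\Delta_*(\mathfrak g\otimes \mathfrak g\otimes T)\to0 .\tag{1}$$ Here $\mathfrak g\otimes\mathfrak g\otimes T$ is identified with the sheaf of $S$-derivations $\mathcal O_{\mathcal C}\to\mathfrak g\otimes\mathfrak g$. Call a global section $\Omega$ of $\mathfrak g\otimes\mathfrak g$ *dual to the trace pairing* $t(a,b)=\mathrm{tr}(ab)$ if the contraction $a\otimes b\mapsto(x\mapsto t(a,x)\,b)$ carries it to $\mathrm{id}_{\mathfrak g}$. If (1) is exact, the Hitchin symbol $\mathrm{Hi}_E\in\mathrm{Ext}^1(\Delta_*T,\mathfrak g\boxtimes\mathfrak g)$ is the composite of $v\mapsto\Omega\otimes v$ with the class (coboundary) of (1). *Atiyah–Chern class.* Let $\mathfrak D(E)$ be the sheaf of pairs $(v,a)$ with $v$ a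 section of $T$ and $a$ an additive endomorphism of $E$ such that $a(fe)=f\,a(e)+v(f)\,e$. The class $AC(E)$ is the class in $\mathrm{Ext}^1(\Delta_*T,\Delta_*\mathfrak{gl}(E))$ of the direct image under $\Delta$ of $$0\to\mathfrak{gl}(E)\to\mathfrak D(E)\to T\to0 .\tag{2}$$ A class $\ell\in\mathrm{Ext}^1(\Delta_*T,\Delta_*\mathfrak g)$ is the *traceless part* of $AC(E)$ if $AC(E)$ is the sum of the image of $\ell$ and the image of a class in $\mathrm{Ext}^1(\Delta_*T,\Delta_*\mathcal O_{\mathcal C})$ under the inclusions $\mathfrak g\to\mathfrak{gl}(E)$ and $\mathcal O_{\mathcal C}\to\mathfrak{gl}(E)$ (scalars). **Proposition 4.8.** The sequences (1) and $\Delta_*$(2) are exact, there is exactly one $\Omega$ dual to the trace pairing, and $AC(E)$ has exactly one traceless part $\ell$. The composite $$T\xrightarrow{\ \mathrm{Hi}_E\ }\mathfrak g\boxtimes\mathfrak g[1]\to\mathfrak g\otimes\mathfrak g[1]\xrightarrow{[\,,]}\mathfrak g[1]$$ of the Hitchin symbol with restriction to the diagonal and the bracket is $$2\,\mathrm{rk}(E)\,\ell=2r\,\ell\quad\text{in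 }\mathrm{Ext}^1(\Delta_*T,\Delta_*\mathfrak g).$$ -/

import Mathlib

open CategoryTheory AlgebraicGeometry TopologicalSpace Opposite

universe u w

noncomputable section

namespace HitchinSymbol

/-! ## Sheaves of modules given by explicit sections -/

section Basics

variable {X : Scheme.{u}}

/-- Restriction of sections of an `𝒪_X`-module. -/
def res (M : X.Modules) {U V : X.Opens} (h : V ≤ U) : Γ(M, U) →+ Γ(M, V) :=
  (M.presheaf.map (homOfLE h).op).hom

/-- Restriction of regular functions. -/
def resO {U V : X.Opens} (h : V ≤ U) : Γ(X, U) →+* Γ(X, V) :=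
  (X.presheaf.map (homOfLE h).op).hom

theorem res_self (M : X.Modules) {U : X.Opens} (h : U ≤ U) (s : Γ(M, U)) : res M h s = s :=
  ConcreteCategory.congr_hom (M.presheaf.map_id (op U)) s

theorem res_res (M : X.Modules) {U V W : X.Opens} (h : V ≤ U) (k : W ≤ V) (s : Γ(M, U)) :
    res M k (res M h s) = res M (k.trans h) s :=
  (ConcreteCategory.congr_hom (M.presheaf.map_comp (homOfLE h).op (homOfLE k).op) s).symm

theorem resO_self {U : X.Opens} (h : U ≤ U) (s : Γ(X, U)) : resO h s = s :=
  ConcreteCategory.congr_hom (X.presheaf.map_id (op U)) s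

theorem resO_resO {U V W : X.Opens} (h : V ≤ U) (k : W ≤ V) (s : Γ(X, U)) :
    resO k (resO h s) = resO (k.trans h) s :=
  (ConcreteCategory.congr_hom (X.presheaf.map_comp (homOfLE h).op (homOfLE k).op) s).symm

theorem res_smul (M : X.Modules) {U V : X.Opens} (h : V ≤ U) (f : Γ(X, U)) (s : Γ(M, U)) :
    res M h (f • s) = resO h f • res M h s :=
  Scheme.Modules.map_smul M (homOfLE h) f s

/-- Two sections that agree locally are equal. -/
theorem eq_of_local (M : X.Modules) {U : X.Opens} (s t : Γ(M, U))
    (H : ∀ x ∈ U, ∃ V : X.Opens, x ∈ V ∧ ∃ h : V ≤ U, res M h s = res M h t) : s = t := by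
  choose! V hV hle heq using H
  refine TopCat.Sheaf.eq_of_locally_eq' ⟨M.presheaf, M.isSheaf⟩ (fun x : U ↦ V x.1) U
    (fun x ↦ homOfLE (hle x.1 x.2)) ?_ s t (fun x ↦ heq x.1 x.2)
  intro x hx
  exact Opens.mem_iSup.2 ⟨⟨x, hx⟩, hV x hx⟩

/-- Compatible sections glue. -/
theorem glue (M : X.Modules) {ι : Type u} {U : X.Opens} (V : ι → X.Opens) (hV : ∀ i, V i ≤ U)
    (hc : U ≤ iSup V) (s : ∀ i, Γ(M, V i))
    (H : ∀ i j, res M (inf_le_left : V i ⊓ V j ≤ V i) (s i) = res M inf_le_right (s j)) :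
    ∃! t : Γ(M, U), ∀ i, res M (hV i) t = s i :=
  TopCat.Sheaf.existsUnique_gluing' ⟨M.presheaf, M.isSheaf⟩ V U (fun i ↦ homOfLE (hV i)) hc s H

/-- The data of an `𝒪_X`-module: sections, restrictions, and the gluing property. -/
structure SheafData (X : Scheme.{u}) where
  sec : X.Opens → Type u
  grp : ∀ U, AddCommGroup (sec U)
  mod : ∀ U, Module Γ(X, U) (sec U)
  res : ∀ {U V : X.Opens}, V ≤ U → (sec U →+ sec V)
  res_self : ∀ {U : X.Opens} (h : U ≤ U) (s : sec U), res h s = s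
  res_res : ∀ {U V W : X.Opens} (h : V ≤ U) (k : W ≤ V) (s : sec U),
    res k (res h s) = res (k.trans h) s
  res_smul : ∀ {U V : X.Opens} (h : V ≤ U) (f : Γ(X, U)) (s : sec U),
    res h (f • s) = resO h f • res h s
  glue : ∀ {ι : Type u} (V : ι → X.Opens) (s : ∀ i, sec (V i)),
    (∀ i j, res (inf_le_left : V i ⊓ V j ≤ V i) (s i) = res inf_le_right (s j)) →
    ∃! t : sec (iSup V), ∀ i, res (le_iSup V i) t = s i

attribute [instance] SheafData.grp SheafData.mod

/-- The underlying presheaf of abelian groups. -/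
def SheafData.toAb (D : SheafData X) : (X.Opens)ᵒᵖ ⥤ Ab.{u} where
  obj U := AddCommGrpCat.of (D.sec U.unop)
  map i := AddCommGrpCat.ofHom (D.res i.unop.le)
  map_id U := by ext s; exact D.res_self _ s
  map_comp i j := by ext s; exact (D.res_res _ _ s).symm

instance (D : SheafData X) (U : (X.Opens)ᵒᵖ) :
    Module (X.ringCatSheaf.obj.obj U) (D.toAb.obj U) := D.mod U.unop

/-- The `𝒪_X`-module with the given sections. -/
def SheafData.toModules (D : SheafData X) : X.Modules :=
  show SheafOfModules X.ringCatSheaf from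
  { val := PresheafOfModules.ofPresheaf D.toAb (fun _ _ f r m ↦ D.res_smul f.unop.le r m)
    isSheaf := (TopCat.Presheaf.isSheaf_iff_isSheafUniqueGluing (C := Ab) D.toAb).2
      (fun _ V s H ↦ D.glue V s H) }

/-- A morphism of `𝒪_X`-modules given by its effect on sections. -/
def mkHom {M N : X.Modules} (f : ∀ U : X.Opens, Γ(M, U) →+ Γ(N, U))
    (hs : ∀ U (r : Γ(X, U)) (s : Γ(M, U)), f U (r • s) = r • f U s)
    (hr : ∀ {U V : X.Opens} (h : V ≤ U) (s : Γ(M, U)), f V (res M h s) = res N h (f U s)) :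
    M ⟶ N :=
  show SheafOfModules.Hom M N from
  ⟨PresheafOfModules.homMk (M₁ := M.val) (M₂ := N.val)
    { app := fun U ↦ AddCommGrpCat.ofHom (f U.unop)
      naturality := fun _ _ i ↦ by ext s; exact hr i.unop.le s }
    (fun U r s ↦ hs U.unop r s)⟩

theorem mkHom_app {M N : X.Modules} (f : ∀ U : X.Opens, Γ(M, U) →+ Γ(N, U)) (hs) (hr)
    (U : X.Opens) (s : Γ(M, U)) :
    (mkHom (M := M) (N := N) f hs hr).app U s = f U s := rfl

theorem app_res {M N : X.Modules} (φ : M ⟶ N) {U V : X.Opens} (h : V ≤ U) (s : Γ(M, U)) :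
    φ.app V (res M h s) = res N h (φ.app U s) :=
  ConcreteCategory.congr_hom (φ.mapPresheaf.naturality (homOfLE h).op) s

end Basics

/-! ## Subsheaves, products, sheaves of homomorphisms -/

section Constructions

variable {X : Scheme.{u}}

/-- A family of submodules of the modules of sections which is stable under restriction and
defined by a local condition. -/
structure LocalSub (M : X.Modules) where
  carrier : ∀ U : X.Opens, Submodule Γ(X, U) Γ(M, U)
  res_mem : ∀ {U V : X.Opens} (h : V ≤ U) {s : Γ(M, U)}, s ∈ carrier U → res M h s ∈ carrier V
  of_local : ∀ {U : X.Opens} (s : Γ(M, U)),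
    (∀ x ∈ U, ∃ V : X.Opens, x ∈ V ∧ ∃ h : V ≤ U, res M h s ∈ carrier V) → s ∈ carrier U

/-- The sheaf data of a subsheaf. -/
def LocalSub.data {M : X.Modules} (P : LocalSub M) : SheafData X where
  sec U := P.carrier U
  grp U := inferInstance
  mod U := inferInstance
  res h := AddMonoidHom.mk' (fun s ↦ ⟨res M h s.1, P.res_mem h s.2⟩)
    (fun s t ↦ Subtype.ext (map_add (res M h) s.1 t.1))
  res_self h s := Subtype.ext (HitchinSymbol.res_self M h s.1)
  res_res h k s := Subtype.ext (HitchinSymbol.res_res M h k s.1)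
  res_smul h f s := Subtype.ext (HitchinSymbol.res_smul M h f s.1)
  glue V s H := by
    obtain ⟨t, ht, hu⟩ := HitchinSymbol.glue M V (fun i ↦ le_iSup V i) le_rfl (fun i ↦ (s i).1)
      (fun i j ↦ congrArg Subtype.val (H i j))
    refine ⟨⟨t, P.of_local t ?_⟩, fun i ↦ Subtype.ext (ht i), ?_⟩
    · intro x hx
      obtain ⟨i, hi⟩ := Opens.mem_iSup.1 hx
      refine ⟨V i, hi, le_iSup V i, ?_⟩
      rw [ht i]
      exact (s i).2
    · intro t' ht'
      exact Subtype.ext (hu t'.1 (fun i ↦ congrArg Subtype.val (ht' i)))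

/-- The subsheaf as an `𝒪_X`-module. -/
def LocalSub.toModules {M : X.Modules} (P : LocalSub M) : X.Modules := P.data.toModules

/-- The inclusion of a subsheaf. -/
def LocalSub.incl {M : X.Modules} (P : LocalSub M) : P.toModules ⟶ M :=
  mkHom (M := P.toModules) (fun U ↦ (P.carrier U).subtype.toAddMonoidHom) (fun _ _ _ ↦ rfl)
    (fun _ _ ↦ rfl)

/-- The product of two `𝒪_X`-modules. -/
def prodData (M N : X.Modules) : SheafData X where
  sec U := Γ(M, U) × Γ(N, U)
  grp U := inferInstance
  mod U := inferInstance
  res h := (res M h).prodMap (res N h)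
  res_self h s := Prod.ext (res_self M h s.1) (res_self N h s.2)
  res_res h k s := Prod.ext (res_res M h k s.1) (res_res N h k s.2)
  res_smul h f s := Prod.ext (res_smul M h f s.1) (res_smul N h f s.2)
  glue V s H := by
    obtain ⟨t, ht, hu⟩ := glue M V (fun i ↦ le_iSup V i) le_rfl (fun i ↦ (s i).1)
      (fun i j ↦ congrArg Prod.fst (H i j))
    obtain ⟨t', ht', hu'⟩ := glue N V (fun i ↦ le_iSup V i) le_rfl (fun i ↦ (s i).2)
      (fun i j ↦ congrArg Prod.snd (H i j))
    exact ⟨(t, t'), fun i ↦ Prod.ext (ht i) (ht' i), fun p hp ↦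
      Prod.ext (hu p.1 fun i ↦ congrArg Prod.fst (hp i))
        (hu' p.2 fun i ↦ congrArg Prod.snd (hp i))⟩

/-- The product of two `𝒪_X`-modules: `Γ(prodMod M N, U) = Γ(M, U) × Γ(N, U)`. -/
def prodMod (M N : X.Modules) : X.Modules := (prodData M N).toModules

/-- A homomorphism of sheaves of abelian groups `M|_U → N|_U`. -/
@[ext]
structure AbHom (M N : X.Modules) (U : X.Opens) where
  app : ∀ V : X.Opens, V ≤ U → (Γ(M, V) →+ Γ(N, V))
  nat : ∀ {V W : X.Opens} (h : V ≤ U) (k : W ≤ V) (s : Γ(M, V)),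
    app W (k.trans h) (res M k s) = res N k (app V h s)

namespace AbHom

variable {M N : X.Modules} {U : X.Opens}

theorem ext_apply {φ ψ : AbHom M N U}
    (h : ∀ V (hV : V ≤ U) (s : Γ(M, V)), φ.app V hV s = ψ.app V hV s) : φ = ψ := by
  ext V hV s
  exact h V hV s

instance : Zero (AbHom M N U) := ⟨⟨fun _ _ ↦ 0, fun _ _ _ ↦ by simp⟩⟩

instance : Add (AbHom M N U) :=
  ⟨fun φ ψ ↦ ⟨fun V h ↦ φ.app V h + ψ.app V h, fun h k s ↦ by simp [φ.nat h k, ψ.nat h k]⟩⟩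

instance : Neg (AbHom M N U) :=
  ⟨fun φ ↦ ⟨fun V h ↦ -φ.app V h, fun h k s ↦ by simp [φ.nat h k]⟩⟩

instance : AddCommGroup (AbHom M N U) where
  add_assoc _ _ _ := ext_apply fun _ _ _ ↦ add_assoc _ _ _
  zero_add _ := ext_apply fun _ _ _ ↦ zero_add _
  add_zero _ := ext_apply fun _ _ _ ↦ add_zero _
  add_comm _ _ := ext_apply fun _ _ _ ↦ add_comm _ _
  neg_add_cancel _ := ext_apply fun _ _ _ ↦ neg_add_cancel _
  nsmul := nsmulRec
  zsmul := zsmulRec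

instance : SMul Γ(X, U) (AbHom M N U) :=
  ⟨fun f φ ↦ ⟨fun V h ↦ (DistribSMul.toAddMonoidHom Γ(N, V) (resO h f)).comp (φ.app V h),
    fun h k s ↦ by
      simp only [AddMonoidHom.comp_apply, DistribSMul.toAddMonoidHom_apply, φ.nat h k, res_smul,
        resO_resO]⟩⟩

theorem zero_app (V : X.Opens) (h : V ≤ U) (s : Γ(M, V)) : (0 : AbHom M N U).app V h s = 0 := rfl

theorem add_app (φ ψ : AbHom M N U) (V : X.Opens) (h : V ≤ U) (s : Γ(M, V)) :
    (φ + ψ).app V h s = φ.app V h s + ψ.app V h s := rfl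

theorem neg_app (φ : AbHom M N U) (V : X.Opens) (h : V ≤ U) (s : Γ(M, V)) :
    (-φ).app V h s = -φ.app V h s := rfl

theorem sub_app (φ ψ : AbHom M N U) (V : X.Opens) (h : V ≤ U) (s : Γ(M, V)) :
    (φ - ψ).app V h s = φ.app V h s - ψ.app V h s := by
  rw [sub_eq_add_neg, add_app, neg_app, sub_eq_add_neg]

theorem smul_app (f : Γ(X, U)) (φ : AbHom M N U) (V : X.Opens) (h : V ≤ U) (s : Γ(M, V)) :
    (f • φ).app V h s = resO h f • φ.app V h s := rfl

instance : Module Γ(X, U) (AbHom M N U) where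
  one_smul φ := ext_apply fun V h s ↦ by rw [smul_app, map_one, one_smul]
  mul_smul f g φ := ext_apply fun V h s ↦ by simp only [smul_app, map_mul, mul_smul]
  smul_zero f := ext_apply fun V h s ↦ by rw [smul_app, zero_app, smul_zero]
  smul_add f φ ψ := ext_apply fun V h s ↦ by simp only [smul_app, add_app, smul_add]
  add_smul f g φ := ext_apply fun V h s ↦ by simp only [smul_app, add_app, map_add, add_smul]
  zero_smul φ := ext_apply fun V h s ↦ by rw [smul_app, map_zero, zero_smul, zero_app]

/-- Restriction to a smaller open set. -/
def restrict {V : X.Opens} (hV : V ≤ U) : AbHom M N U →+ AbHom M N V where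
  toFun φ := ⟨fun W h ↦ φ.app W (h.trans hV), fun h k s ↦ φ.nat (h.trans hV) k s⟩
  map_zero' := rfl
  map_add' _ _ := rfl

theorem restrict_app {V : X.Opens} (hV : V ≤ U) (φ : AbHom M N U) (W : X.Opens) (h : W ≤ V)
    (s : Γ(M, W)) : (restrict hV φ).app W h s = φ.app W (h.trans hV) s := rfl

end AbHom

/-- The sheaf of homomorphisms of sheaves of abelian groups from `M` to `N`. -/
def abHomData (M N : X.Modules) : SheafData X where
  sec U := AbHom M N U
  grp U := inferInstance
  mod U := inferInstance
  res h := AbHom.restrict h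
  res_self h s := rfl
  res_res h k s := rfl
  res_smul h f φ := AbHom.ext_apply fun W hW s ↦ by
    simp only [AbHom.restrict_app, AbHom.smul_app, resO_resO]
  glue {ι} V φ H := by
    have hcov : ∀ W : X.Opens, W ≤ iSup V → W ≤ ⨆ i, W ⊓ V i := fun W hW ↦ by
      rw [← inf_iSup_eq]
      exact le_inf le_rfl hW
    have hcomp : ∀ (i j : ι) (W : X.Opens) (hi : W ≤ V i) (hj : W ≤ V j) (s : Γ(M, W)),
        (φ i).app W hi s = (φ j).app W hj s := fun i j W hi hj s ↦
      congrArg (fun ψ : AbHom M N (V i ⊓ V j) ↦ ψ.app W (le_inf hi hj) s) (H i j)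
    have key : ∀ (W : X.Opens) (hW : W ≤ iSup V) (s : Γ(M, W)),
        ∃! t : Γ(N, W), ∀ i, res N (inf_le_left : W ⊓ V i ≤ W) t =
          (φ i).app (W ⊓ V i) inf_le_right (res M inf_le_left s) := by
      intro W hW s
      refine glue N (fun i ↦ W ⊓ V i) (fun i ↦ inf_le_left) (hcov W hW) _ ?_
      intro i j
      rw [← (φ i).nat, ← (φ j).nat, res_res, res_res]
      exact hcomp i j _ _ _ _
    choose g hg hu using key
    have hg' : ∀ (W : X.Opens) (hW : W ≤ iSup V) (s : Γ(M, W)) (i : ι) (W' : X.Opens)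
        (h : W' ≤ W) (h' : W' ≤ V i),
        res N h (g W hW s) = (φ i).app W' h' (res M h s) := by
      intro W hW s i W' h h'
      have := congrArg (res N (le_inf h h' : W' ≤ W ⊓ V i)) (hg W hW s i)
      rw [res_res, ← (φ i).nat, res_res] at this
      exact this
    let Φ : AbHom M N (iSup V) :=
      { app := fun W hW ↦ AddMonoidHom.mk' (g W hW) (fun s t ↦ by
          symm
          apply hu
          intro i
          rw [map_add, hg, hg, map_add, map_add])
        nat := by
          intro W W' hW h s
          change g W' _ (res M h s) = res N h (g W hW s)
          symm
          apply hu
          intro i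
          rw [res_res, hg' W hW s i _ _ inf_le_right, res_res] }
    refine ⟨Φ, ?_, ?_⟩
    · intro i
      refine AbHom.ext_apply fun W hW s ↦ ?_
      change g W _ s = _
      have := hg' W (hW.trans (le_iSup V i)) s i W le_rfl hW
      rwa [res_self, res_self] at this
    · intro Ψ hΨ
      refine AbHom.ext_apply fun W hW s ↦ ?_
      change Ψ.app W hW s = g W hW s
      apply hu
      intro i
      rw [← hΨ i, AbHom.restrict_app]
      exact (Ψ.nat hW inf_le_left s).symm

/-- The sheaf of homomorphisms of sheaves of abelian groups, an `𝒪_X`-module via the target. -/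
def abHom (M N : X.Modules) : X.Modules := (abHomData M N).toModules

/-- The condition of being `𝒪_X`-linear. -/
def linearSub (M N : X.Modules) : LocalSub (abHom M N) where
  carrier U :=
    { carrier := {φ : AbHom M N U | ∀ (V : X.Opens) (h : V ≤ U) (f : Γ(X, V)) (s : Γ(M, V)),
        φ.app V h (f • s) = f • φ.app V h s}
      zero_mem' := fun V h f s ↦ by
        change (0 : Γ(N, V)) = f • (0 : Γ(N, V))
        rw [smul_zero]
      add_mem' := fun {φ ψ} hφ hψ V h f s ↦ by
        change φ.app V h (f • s) + ψ.app V h (f • s) = f • (φ.app V h s + ψ.app V h s)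
        rw [hφ V h, hψ V h, smul_add]
      smul_mem' := fun g φ hφ V h f s ↦ by
        change resO h g • φ.app V h (f • s) = f • (resO h g • φ.app V h s)
        rw [hφ V h, smul_comm] }
  res_mem h _ hφ V hV f s := hφ V (hV.trans h) f s
  of_local {U} φ hφ V h f s := by
    refine eq_of_local N _ _ fun x hx ↦ ?_
    obtain ⟨W, hxW, hW, hm⟩ := hφ x (h hx)
    refine ⟨V ⊓ W, ⟨hx, hxW⟩, inf_le_left, ?_⟩
    have := hm (V ⊓ W) inf_le_right (resO inf_le_left f) (res M inf_le_left s)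
    change AbHom.app φ _ _ _ = _ • AbHom.app φ _ _ _ at this
    rw [← res_smul, AbHom.nat φ h, AbHom.nat φ h, ← res_smul] at this
    exact this

/-- The sheaf `ℋom(M, N)` of `𝒪_X`-linear homomorphisms. -/
def sheafHom (M N : X.Modules) : X.Modules := (linearSub M N).toModules

/-- A section of `ℋom(M, N)` over `U`, applied to a section of `M` over `V ≤ U`. -/
def ev {M N : X.Modules} {U : X.Opens} (φ : Γ(sheafHom M N, U)) {V : X.Opens} (h : V ≤ U) :
    Γ(M, V) →ₗ[Γ(X, V)] Γ(N, V) :=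
  { AbHom.app (Subtype.val (p := (· ∈ (linearSub M N).carrier U)) φ) V h with
    map_smul' := fun f s ↦
      (Subtype.prop (p := (· ∈ (linearSub M N).carrier U)) φ) V h f s }

/-- A section of `ℋom(M, N)` from a compatible family of linear maps. -/
def mkLin {M N : X.Modules} {U : X.Opens} (F : ∀ V : X.Opens, V ≤ U → (Γ(M, V) →ₗ[Γ(X, V)] Γ(N, V)))
    (hF : ∀ {V W : X.Opens} (h : V ≤ U) (k : W ≤ V) (s : Γ(M, V)),
      F W (k.trans h) (res M k s) = res N k (F V h s)) : Γ(sheafHom M N, U) :=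
  Subtype.mk (p := (· ∈ (linearSub M N).carrier U))
    (AbHom.mk (fun V h ↦ (F V h).toAddMonoidHom) (fun h k s ↦ hF h k s) : AbHom M N U)
    (fun V h f s ↦ (F V h).map_smul f s)

section Lin

variable {M N : X.Modules} {U : X.Opens}

theorem lin_ext {φ ψ : Γ(sheafHom M N, U)}
    (H : ∀ (V : X.Opens) (h : V ≤ U) (s : Γ(M, V)), ev φ h s = ev ψ h s) : φ = ψ :=
  Subtype.ext (p := (· ∈ (linearSub M N).carrier U)) (AbHom.ext_apply H)

theorem ev_mkLin (F : ∀ V : X.Opens, V ≤ U → (Γ(M, V) →ₗ[Γ(X, V)] Γ(N, V))) (hF)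
    {V : X.Opens} (h : V ≤ U) (s : Γ(M, V)) :
    ev (mkLin (M := M) (N := N) F hF) h s = F V h s := rfl

theorem ev_nat (φ : Γ(sheafHom M N, U)) {V W : X.Opens} (h : V ≤ U) (k : W ≤ V) (s : Γ(M, V)) :
    ev φ (k.trans h) (res M k s) = res N k (ev φ h s) :=
  AbHom.nat (Subtype.val (p := (· ∈ (linearSub M N).carrier U)) φ) h k s

theorem ev_add (φ ψ : Γ(sheafHom M N, U)) {V : X.Opens} (h : V ≤ U) (s : Γ(M, V)) :
    ev (φ + ψ) h s = ev φ h s + ev ψ h s := rfl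

theorem ev_smul (f : Γ(X, U)) (φ : Γ(sheafHom M N, U)) {V : X.Opens} (h : V ≤ U) (s : Γ(M, V)) :
    ev (f • φ) h s = resO h f • ev φ h s := rfl

theorem ev_res (φ : Γ(sheafHom M N, U)) {V W : X.Opens} (k : V ≤ U) (h : W ≤ V) (s : Γ(M, W)) :
    ev (res (sheafHom M N) k φ) h s = ev φ (h.trans k) s := rfl

end Lin

end Constructions

/-! ## Derivations, locally free sheaves, the trace, `𝔤𝔩(E)` and `𝔰𝔩(E)` -/

section Derivations

/-- The structure sheaf as a module over itself. -/
def unitMod (X : Scheme.{u}) : X.Modules := SheafOfModules.unit X.ringCatSheaf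

variable {C S : Scheme.{u}} (π : C ⟶ S)

/-- A homomorphism of abelian sheaves `𝒪_C → N` over `U`, applied to a function on `V ≤ U`. -/
def funApp {N : C.Modules} {U : C.Opens} (D : Γ(abHom (unitMod C) N, U)) {V : C.Opens}
    (h : V ≤ U) : Γ(C, V) →+ Γ(N, V) := AbHom.app D V h

theorem funApp_nat {N : C.Modules} {U : C.Opens} (D : Γ(abHom (unitMod C) N, U)) {V W : C.Opens}
    (h : V ≤ U) (k : W ≤ V) (f : Γ(C, V)) :
    funApp D (k.trans h) (resO k f) = res N k (funApp D h f) := AbHom.nat D h k f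

theorem funApp_add {N : C.Modules} {U : C.Opens} (D D' : Γ(abHom (unitMod C) N, U)) {V : C.Opens}
    (h : V ≤ U) (f : Γ(C, V)) : funApp (D + D') h f = funApp D h f + funApp D' h f := rfl

theorem funApp_smul {N : C.Modules} {U : C.Opens} (c : Γ(C, U)) (D : Γ(abHom (unitMod C) N, U))
    {V : C.Opens} (h : V ≤ U) (f : Γ(C, V)) : funApp (c • D) h f = resO h c • funApp D h f := rfl

theorem funApp_zero {N : C.Modules} {U V : C.Opens} (h : V ≤ U) (f : Γ(C, V)) :
    funApp (0 : Γ(abHom (unitMod C) N, U)) h f = 0 := rfl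

theorem funApp_res {N : C.Modules} {U : C.Opens} (D : Γ(abHom (unitMod C) N, U)) {V W : C.Opens}
    (k : V ≤ U) (h : W ≤ V) (f : Γ(C, W)) :
    funApp (res (abHom (unitMod C) N) k D) h f = funApp D (h.trans k) f := rfl

/-- The conditions for a homomorphism of abelian sheaves `𝒪_C → N` to be a derivation relative
to `S`: the Leibniz rule, and the vanishing on functions pulled back from `S`. -/
def derSub (N : C.Modules) : LocalSub (abHom (unitMod C) N) where
  carrier U :=
    { carrier := {D | ∀ (V : C.Opens) (h : V ≤ U),
        (∀ f g : Γ(C, V), funApp D h (f * g) = f • funApp D h g + g • funApp D h f) ∧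
        ∀ (W : S.Opens) (k : V ≤ π ⁻¹ᵁ W) (s : Γ(S, W)), funApp D h (π.appLE W V k s) = 0}
      zero_mem' := fun V h ↦ ⟨fun f g ↦ by
        rw [funApp_zero, funApp_zero, funApp_zero, smul_zero, smul_zero, add_zero],
        fun _ _ _ ↦ rfl⟩
      add_mem' := fun {D D'} hD hD' V h ↦ ⟨fun f g ↦ by
        rw [funApp_add, funApp_add, funApp_add, (hD V h).1, (hD' V h).1, smul_add, smul_add]
        abel, fun W k s ↦ by rw [funApp_add, (hD V h).2 W k, (hD' V h).2 W k, add_zero]⟩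
      smul_mem' := fun c D hD V h ↦ ⟨fun f g ↦ by
        rw [funApp_smul, funApp_smul, funApp_smul, (hD V h).1, smul_add, smul_comm,
          smul_comm (resO h c) g], fun W k s ↦ by
        rw [funApp_smul, (hD V h).2 W k, smul_zero]⟩ }
  res_mem h _ hD V hV := hD V (hV.trans h)
  of_local {U} D hD V h := by
    constructor
    · intro f g
      refine eq_of_local N _ _ fun x hx ↦ ?_
      obtain ⟨W, hxW, hW, hm⟩ := hD x (h hx)
      refine ⟨V ⊓ W, ⟨hx, hxW⟩, inf_le_left, ?_⟩
      have := (hm (V ⊓ W) inf_le_right).1 (resO inf_le_left f) (resO inf_le_left g)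
      rw [← map_mul, funApp_res, funApp_res, funApp_res] at this
      rw [map_add, res_smul, res_smul, ← funApp_nat, ← funApp_nat, ← funApp_nat]
      exact this
    · intro W' k s
      refine eq_of_local N _ _ fun x hx ↦ ?_
      obtain ⟨W, hxW, hW, hm⟩ := hD x (h hx)
      refine ⟨V ⊓ W, ⟨hx, hxW⟩, inf_le_left, ?_⟩
      have := (hm (V ⊓ W) inf_le_right).2 W' (inf_le_left.trans k) s
      rw [map_zero, ← funApp_nat]
      refine Eq.trans ?_ this
      rw [funApp_res]
      refine congrArg (funApp D (inf_le_left.trans h)) ?_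
      exact ConcreteCategory.congr_hom (π.appLE_map k (homOfLE inf_le_left).op) s

/-- The sheaf of `S`-derivations `𝒪_C → N`, that is `ℋom(Ω_{C/S}, N)`. If `π` is smooth this is
`N ⊗ T_{C/S}`. -/
def derSheaf (N : C.Modules) : C.Modules := (derSub π N).toModules

/-- The relative tangent sheaf `T_{C/S}`. -/
abbrev tangent : C.Modules := derSheaf π (unitMod C)

variable {π}

/-- A section over `U` of the sheaf of derivations, applied to a function on `V ≤ U`. -/
def derApp {N : C.Modules} {U : C.Opens} (D : Γ(derSheaf π N, U)) {V : C.Opens} (h : V ≤ U) :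
    Γ(C, V) →+ Γ(N, V) :=
  AbHom.app (Subtype.val (p := (· ∈ (derSub π N).carrier U)) D) V h

/-- A section of the sheaf of derivations from a compatible family of derivations. -/
def mkDer {N : C.Modules} {U : C.Opens} (F : ∀ V : C.Opens, V ≤ U → (Γ(C, V) →+ Γ(N, V)))
    (hF : ∀ {V W : C.Opens} (h : V ≤ U) (k : W ≤ V) (f : Γ(C, V)),
      F W (k.trans h) (resO k f) = res N k (F V h f))
    (hl : ∀ (V : C.Opens) (h : V ≤ U) (f g : Γ(C, V)), F V h (f * g) = f • F V h g + g • F V h f)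
    (hS : ∀ (V : C.Opens) (h : V ≤ U) (W : S.Opens) (k : V ≤ π ⁻¹ᵁ W) (s : Γ(S, W)),
      F V h (π.appLE W V k s) = 0) : Γ(derSheaf π N, U) :=
  Subtype.mk (p := (· ∈ (derSub π N).carrier U))
    (AbHom.mk (fun V h ↦ F V h) (fun h k s ↦ hF h k s) : AbHom (unitMod C) N U)
    (fun V h ↦ ⟨hl V h, hS V h⟩)

section

variable {N : C.Modules} {U : C.Opens}

theorem der_ext {D D' : Γ(derSheaf π N, U)}
    (H : ∀ (V : C.Opens) (h : V ≤ U) (f : Γ(C, V)), derApp D h f = derApp D' h f) : D = D' :=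
  Subtype.ext (p := (· ∈ (derSub π N).carrier U)) (AbHom.ext_apply H)

theorem derApp_nat (D : Γ(derSheaf π N, U)) {V W : C.Opens} (h : V ≤ U) (k : W ≤ V)
    (f : Γ(C, V)) : derApp D (k.trans h) (resO k f) = res N k (derApp D h f) :=
  AbHom.nat (Subtype.val (p := (· ∈ (derSub π N).carrier U)) D) h k f

theorem derApp_mul (D : Γ(derSheaf π N, U)) {V : C.Opens} (h : V ≤ U) (f g : Γ(C, V)) :
    derApp D h (f * g) = f • derApp D h g + g • derApp D h f :=
  ((Subtype.prop (p := (· ∈ (derSub π N).carrier U)) D) V h).1 f g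

theorem derApp_base (D : Γ(derSheaf π N, U)) {V : C.Opens} (h : V ≤ U) (W : S.Opens)
    (k : V ≤ π ⁻¹ᵁ W) (s : Γ(S, W)) : derApp D h (π.appLE W V k s) = 0 :=
  ((Subtype.prop (p := (· ∈ (derSub π N).carrier U)) D) V h).2 W k s

theorem derApp_res (D : Γ(derSheaf π N, U)) {V W : C.Opens} (k : V ≤ U) (h : W ≤ V)
    (f : Γ(C, W)) : derApp (res (derSheaf π N) k D) h f = derApp D (h.trans k) f := rfl

theorem derApp_add (D D' : Γ(derSheaf π N, U)) {V : C.Opens} (h : V ≤ U) (f : Γ(C, V)) :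
    derApp (D + D') h f = derApp D h f + derApp D' h f := rfl

theorem derApp_smul (c : Γ(C, U)) (D : Γ(derSheaf π N, U)) {V : C.Opens} (h : V ≤ U)
    (f : Γ(C, V)) : derApp (c • D) h f = resO h c • derApp D h f := rfl

end

end Derivations

section Trace

variable {X : Scheme.{u}}

/-- Sections `b i` of `E` over `V` form a frame if they define an isomorphism of the free module
with `E` over `V`. -/
def IsFrame (E : X.Modules) {r : ℕ} {V : X.Opens} (b : Fin r → Γ(E, V)) : Prop :=
  ∀ (W : X.Opens) (h : W ≤ V),
    Function.Bijective (fun c : Fin r → Γ(X, W) ↦ ∑ i, c i • res E h (b i))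

/-- `E` is locally free of rank `r`. -/
class IsLocallyFreeOfRank (E : X.Modules) (r : ℕ) : Prop where
  exists_frame : ∀ x : X, ∃ V : X.Opens, x ∈ V ∧ ∃ b : Fin r → Γ(E, V), IsFrame E b

/-- The basis of `Γ(E, W)` given by a frame over `V ≥ W`. -/
def IsFrame.basis {E : X.Modules} {r : ℕ} {V : X.Opens} {b : Fin r → Γ(E, V)} (hb : IsFrame E b)
    {W : X.Opens} (h : W ≤ V) : Module.Basis (Fin r) Γ(X, W) Γ(E, W) :=
  Module.Basis.ofEquivFun (LinearEquiv.symm (LinearEquiv.ofBijective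
    (Fintype.linearCombination Γ(X, W) (fun i ↦ res E h (b i))) (hb W h)))

theorem IsFrame.basis_apply {E : X.Modules} {r : ℕ} {V : X.Opens} {b : Fin r → Γ(E, V)}
    (hb : IsFrame E b) {W : X.Opens} (h : W ≤ V) (i : Fin r) : hb.basis h i = res E h (b i) := by
  classical
  rw [IsFrame.basis, Module.Basis.coe_ofEquivFun]
  change Fintype.linearCombination Γ(X, W) (fun i ↦ res E h (b i)) (Pi.single i 1) = _
  rw [Fintype.linearCombination_apply_single, one_smul]

theorem IsFrame.restrict {E : X.Modules} {r : ℕ} {V W : X.Opens} {b : Fin r → Γ(E, V)}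
    (hb : IsFrame E b) (h : W ≤ V) : IsFrame E (fun i ↦ res E h (b i)) := by
  intro W' h'
  simpa only [res_res] using hb W' (h'.trans h)

/-- The sheaf `𝔤𝔩(E)` of endomorphisms of `E`. -/
abbrev gl (E : X.Modules) : X.Modules := sheafHom E E

theorem trace_res {E : X.Modules} {r : ℕ} {U V W : X.Opens} {b : Fin r → Γ(E, V)}
    (hb : IsFrame E b) (φ : Γ(gl E, U)) (h : V ≤ U) (k : W ≤ V) :
    resO k (LinearMap.trace Γ(X, V) Γ(E, V) (ev φ h)) =
      LinearMap.trace Γ(X, W) Γ(E, W) (ev φ (k.trans h)) := by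
  rw [LinearMap.trace_eq_matrix_trace _ (hb.basis le_rfl),
    LinearMap.trace_eq_matrix_trace _ (hb.basis k), Matrix.trace, Matrix.trace, map_sum]
  refine Finset.sum_congr rfl fun i _ ↦ ?_
  rw [Matrix.diag_apply, Matrix.diag_apply, LinearMap.toMatrix_apply, LinearMap.toMatrix_apply,
    hb.basis_apply, hb.basis_apply, res_self, ev_nat φ h k]
  generalize ev φ h (b i) = s
  have hs := congrArg (res E k) ((hb.basis le_rfl).sum_repr s)
  rw [map_sum] at hs
  simp only [res_smul, hb.basis_apply, res_res] at hs
  rw [← hs]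
  have := (hb.basis k).repr_sum_self (fun j ↦ resO k ((hb.basis le_rfl).repr s j))
  simp only [hb.basis_apply] at this
  exact (congrFun this i).symm

/-- The frames of `E` over `V`. -/
def HasFrame (E : X.Modules) (r : ℕ) (V : X.Opens) : Prop :=
  ∃ b : Fin r → Γ(E, V), IsFrame E b

theorem exists_frame_le (E : X.Modules) (r : ℕ) [IsLocallyFreeOfRank E r] {U : X.Opens} {x : X}
    (hx : x ∈ U) : ∃ V : X.Opens, x ∈ V ∧ V ≤ U ∧ HasFrame E r V := by
  obtain ⟨V, hxV, b, hb⟩ := IsLocallyFreeOfRank.exists_frame (E := E) (r := r) x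
  exact ⟨V ⊓ U, ⟨hxV, hx⟩, inf_le_right, _, hb.restrict inf_le_left⟩

theorem exists_trace (E : X.Modules) (r : ℕ) [IsLocallyFreeOfRank E r] {U : X.Opens}
    (φ : Γ(gl E, U)) : ∃ t : Γ(X, U), ∀ (V : X.Opens) (h : V ≤ U), HasFrame E r V →
      resO h t = LinearMap.trace Γ(X, V) Γ(E, V) (ev φ h) := by
  have hc : U ≤ ⨆ V : {V : X.Opens // V ≤ U ∧ HasFrame E r V}, V.1 := fun x hx ↦ by
    obtain ⟨V, hxV, hVU, hV⟩ := exists_frame_le E r hx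
    exact Opens.mem_iSup.2 ⟨⟨V, hVU, hV⟩, hxV⟩
  obtain ⟨t, ht, -⟩ := glue (unitMod X)
    (fun V : {V : X.Opens // V ≤ U ∧ HasFrame E r V} ↦ V.1) (fun V ↦ V.2.1) hc
    (fun V ↦ LinearMap.trace Γ(X, V.1) Γ(E, V.1) (ev φ V.2.1)) (by
      rintro ⟨V, hV, b, hb⟩ ⟨V', hV', b', hb'⟩
      exact (trace_res hb φ hV inf_le_left).trans (trace_res hb' φ hV' inf_le_right).symm)
  exact ⟨t, fun V h hV ↦ ht ⟨V, h, hV⟩⟩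

/-- The trace of a section of `𝔤𝔩(E)`: over each open set with a frame it is the trace of the
endomorphism of the free module of sections. -/
def tr (E : X.Modules) (r : ℕ) [IsLocallyFreeOfRank E r] {U : X.Opens} (φ : Γ(gl E, U)) : Γ(X, U) :=
  (exists_trace E r φ).choose

variable (E : X.Modules) (r : ℕ) [IsLocallyFreeOfRank E r]

theorem tr_spec {U : X.Opens} (φ : Γ(gl E, U)) {V : X.Opens} (h : V ≤ U) (hV : HasFrame E r V) :
    resO h (tr E r φ) = LinearMap.trace Γ(X, V) Γ(E, V) (ev φ h) :=
  (exists_trace E r φ).choose_spec V h hV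

theorem tr_unique {U : X.Opens} (φ : Γ(gl E, U)) (t : Γ(X, U))
    (H : ∀ (V : X.Opens) (h : V ≤ U), HasFrame E r V →
      resO h t = LinearMap.trace Γ(X, V) Γ(E, V) (ev φ h)) : tr E r φ = t := by
  refine eq_of_local (unitMod X) _ _ fun x hx ↦ ?_
  obtain ⟨V, hxV, hVU, hV⟩ := exists_frame_le E r hx
  exact ⟨V, hxV, hVU, (tr_spec E r φ hVU hV).trans (H V hVU hV).symm⟩

theorem tr_add {U : X.Opens} (φ ψ : Γ(gl E, U)) : tr E r (φ + ψ) = tr E r φ + tr E r ψ :=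
  tr_unique E r _ _ fun V h hV ↦ by
    rw [map_add, tr_spec E r φ h hV, tr_spec E r ψ h hV, ← map_add]
    rfl

theorem tr_smul {U : X.Opens} (f : Γ(X, U)) (φ : Γ(gl E, U)) :
    tr E r (f • φ) = f * tr E r φ :=
  tr_unique E r _ _ fun V h hV ↦ by
    rw [map_mul, tr_spec E r φ h hV, ← smul_eq_mul, ← map_smul]
    rfl

theorem tr_res {U V : X.Opens} (h : V ≤ U) (φ : Γ(gl E, U)) :
    tr E r (res (gl E) h φ) = resO h (tr E r φ) :=
  tr_unique E r _ _ fun W k hW ↦ by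
    rw [resO_resO, tr_spec E r φ _ hW]
    rfl

theorem tr_zero {U : X.Opens} : tr E r (0 : Γ(gl E, U)) = 0 := by
  have := tr_add E r (0 : Γ(gl E, U)) 0
  rwa [add_zero, left_eq_add] at this

/-- The composition of endomorphisms. -/
def glMul {E : X.Modules} {U : X.Opens} (φ ψ : Γ(gl E, U)) : Γ(gl E, U) :=
  mkLin (fun _ h ↦ (ev φ h).comp (ev ψ h))
    (fun h k s ↦ by rw [LinearMap.comp_apply, ev_nat, ev_nat, LinearMap.comp_apply])

theorem tr_mul_comm {U : X.Opens} (φ ψ : Γ(gl E, U)) :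
    tr E r (glMul φ ψ) = tr E r (glMul ψ φ) :=
  tr_unique E r _ _ fun V h hV ↦ by
    rw [tr_spec E r _ h hV]
    exact LinearMap.trace_mul_comm Γ(X, V) (ev ψ h) (ev φ h)

/-- The condition of having trace zero. -/
def slSub : LocalSub (gl E) where
  carrier U :=
    { carrier := {φ : Γ(gl E, U) | tr E r φ = 0}
      zero_mem' := tr_zero E r
      add_mem' := fun {φ ψ} hφ hψ ↦ by
        change tr E r (φ + ψ) = 0
        rw [tr_add, hφ, hψ, add_zero]
      smul_mem' := fun f φ hφ ↦ by
        change tr E r (f • φ) = 0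
        rw [tr_smul, hφ, mul_zero] }
  res_mem h φ hφ := by
    change tr E r (res (gl E) h φ) = 0
    rw [tr_res, show tr E r φ = 0 from hφ, map_zero]
  of_local {U} φ H := by
    refine eq_of_local (unitMod X) (U := U) (tr E r φ) 0 fun x hx ↦ ?_
    obtain ⟨V, hxV, h, hV⟩ := H x hx
    refine ⟨V, hxV, h, ?_⟩
    rw [map_zero]
    exact (tr_res E r h φ).symm.trans hV

/-- The sheaf of Lie algebras `𝔰𝔩(E)` of traceless endomorphisms of `E`. -/
def sl : X.Modules := (slSub E r).toModules

/-- The inclusion `𝔰𝔩(E) → 𝔤𝔩(E)`. -/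
def slIncl : sl E r ⟶ gl E := (slSub E r).incl

/-- The scalar endomorphism given by a function. -/
def scalarEnd {E : X.Modules} {U : X.Opens} (f : Γ(X, U)) : Γ(gl E, U) :=
  mkLin (fun V h ↦ resO h f • LinearMap.id) (fun h k s ↦ by
    simp only [LinearMap.smul_apply, LinearMap.id_apply, res_smul, resO_resO])

theorem ev_scalarEnd {E : X.Modules} {U : X.Opens} (f : Γ(X, U)) {V : X.Opens} (h : V ≤ U)
    (s : Γ(E, V)) : ev (scalarEnd f) h s = resO h f • s := rfl

theorem scalarEnd_add {E : X.Modules} {U : X.Opens} (f g : Γ(X, U)) :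
    (scalarEnd (f + g) : Γ(gl E, U)) = scalarEnd f + scalarEnd g :=
  lin_ext fun V h s ↦ by
    rw [ev_add, ev_scalarEnd, ev_scalarEnd, ev_scalarEnd, map_add, add_smul]

/-- The inclusion `𝒪_X → 𝔤𝔩(E)` of the scalar endomorphisms. -/
def scalars (E : X.Modules) : unitMod X ⟶ gl E :=
  mkHom (M := unitMod X) (N := gl E)
    (fun U ↦ AddMonoidHom.mk' (fun f ↦ scalarEnd (X := X) f)
      (fun f g ↦ scalarEnd_add (X := X) f g))
    (fun U f g ↦ lin_ext fun V h s ↦ by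
      change resO h _ • s = resO h f • resO h _ • s
      rw [smul_smul]
      exact congrArg (· • s) (map_mul (resO h) f g))
    (fun {U V} k f ↦ lin_ext fun W h s ↦ congrArg (· • s) (resO_resO k h f))

end Trace

/-! ## Tensor products, the trace pairing and the bracket -/

section Tensor

variable {X : Scheme.{u}}

/-- The presheaf tensor product `U ↦ Γ(A, U) ⊗ Γ(B, U)`. -/
def preTensor (A B : X.Modules) : X.PresheafOfModules :=
  PresheafOfModules.Monoidal.tensorObj (R := X.presheaf) A.val B.val

/-- The tensor product of `𝒪_X`-modules. -/
def tensor (A B : X.Modules) : X.Modules :=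
  (PresheafOfModules.sheafification (𝟙 X.ringCatSheaf.obj)).obj (preTensor A B)

/-- The canonical map from the presheaf tensor product. -/
def toTensor (A B : X.Modules) (U : X.Opens) :
    TensorProduct Γ(X, U) Γ(A, U) Γ(B, U) →+ Γ(tensor A B, U) :=
  ((PresheafOfModules.toPresheaf _).map ((PresheafOfModules.sheafificationAdjunction
    (𝟙 X.ringCatSheaf.obj)).unit.app (preTensor A B))).app (op U) |>.hom

/-- The section `a ⊗ b` of `A ⊗ B`. -/
def tmul {A B : X.Modules} {U : X.Opens} (a : Γ(A, U)) (b : Γ(B, U)) : Γ(tensor A B, U) :=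
  toTensor A B U (TensorProduct.tmul _ a b)

theorem tmul_add {A B : X.Modules} {U : X.Opens} (a : Γ(A, U)) (b b' : Γ(B, U)) :
    tmul a (b + b') = tmul a b + tmul a b' := by
  rw [tmul, TensorProduct.tmul_add, map_add]
  rfl

theorem add_tmul {A B : X.Modules} {U : X.Opens} (a a' : Γ(A, U)) (b : Γ(B, U)) :
    tmul (a + a') b = tmul a b + tmul a' b := by
  rw [tmul, TensorProduct.add_tmul, map_add]
  rfl

theorem toTensor_smul {A B : X.Modules} {U : X.Opens} (f : Γ(X, U))
    (x : TensorProduct Γ(X, U) Γ(A, U) Γ(B, U)) :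
    toTensor A B U (f • x) = f • toTensor A B U x :=
  (((PresheafOfModules.sheafificationAdjunction
    (𝟙 X.ringCatSheaf.obj)).unit.app (preTensor A B)).app (op U)).hom.map_smul f x

theorem smul_tmul' {A B : X.Modules} {U : X.Opens} (f : Γ(X, U)) (a : Γ(A, U)) (b : Γ(B, U)) :
    tmul (f • a) b = f • tmul a b := toTensor_smul f (TensorProduct.tmul _ a b)

theorem tmul_smul {A B : X.Modules} {U : X.Opens} (f : Γ(X, U)) (a : Γ(A, U)) (b : Γ(B, U)) :
    tmul a (f • b) = f • tmul a b := by
  rw [tmul, TensorProduct.tmul_smul, toTensor_smul]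
  rfl

theorem res_tmul {A B : X.Modules} {U V : X.Opens} (h : V ≤ U) (a : Γ(A, U)) (b : Γ(B, U)) :
    res (tensor A B) h (tmul a b) = tmul (res A h a) (res B h b) :=
  (ConcreteCategory.congr_hom (((PresheafOfModules.toPresheaf _).map
    ((PresheafOfModules.sheafificationAdjunction
    (𝟙 X.ringCatSheaf.obj)).unit.app (preTensor A B))).naturality (homOfLE h).op)
      (TensorProduct.tmul Γ(X, U) a b)).symm

/-- The map from the presheaf tensor product given by compatible bilinear maps on sections. -/
def preLift {A B N : X.Modules}
    (β : ∀ U : X.Opens, Γ(A, U) →ₗ[Γ(X, U)] Γ(B, U) →ₗ[Γ(X, U)] Γ(N, U))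
    (hβ : ∀ {U V : X.Opens} (h : V ≤ U) (a : Γ(A, U)) (b : Γ(B, U)),
      β V (res A h a) (res B h b) = res N h (β U a b)) :
    preTensor A B ⟶ (PresheafOfModules.restrictScalars (𝟙 X.ringCatSheaf.obj)).obj
      ((SheafOfModules.forget _).obj N) :=
  PresheafOfModules.homMk
    { app := fun U ↦ AddCommGrpCat.ofHom (TensorProduct.lift (β U.unop)).toAddMonoidHom
      naturality := fun U V i ↦ by
        ext x
        induction x using TensorProduct.induction_on with
        | zero => exact (map_zero _).trans (map_zero _).symm
        | tmul a b => exact hβ i.unop.le a b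
        | add x y hx hy =>
          refine Eq.trans (map_add _ x y) (Eq.trans (congrArg₂ (· + ·) hx hy) ?_)
          exact (map_add _ x y).symm }
    (fun U f x ↦ (TensorProduct.lift (β U.unop)).map_smul f x)

/-- The morphism `A ⊗ B → N` given by compatible bilinear maps on sections. -/
def lift {A B N : X.Modules} (β : ∀ U : X.Opens, Γ(A, U) →ₗ[Γ(X, U)] Γ(B, U) →ₗ[Γ(X, U)] Γ(N, U))
    (hβ : ∀ {U V : X.Opens} (h : V ≤ U) (a : Γ(A, U)) (b : Γ(B, U)),
      β V (res A h a) (res B h b) = res N h (β U a b)) : tensor A B ⟶ N :=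
  (PresheafOfModules.sheafificationHomEquiv (𝟙 X.ringCatSheaf.obj)).symm (preLift β hβ)

theorem lift_tmul {A B N : X.Modules}
    (β : ∀ U : X.Opens, Γ(A, U) →ₗ[Γ(X, U)] Γ(B, U) →ₗ[Γ(X, U)] Γ(N, U)) (hβ)
    {U : X.Opens} (a : Γ(A, U)) (b : Γ(B, U)) :
    (lift (A := A) (B := B) (N := N) β hβ).app U (tmul a b) = β U a b := by
  have := (PresheafOfModules.sheafificationHomEquiv (𝟙 X.ringCatSheaf.obj)).apply_symm_apply
    (preLift (N := N) β hβ)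
  exact congrArg (fun φ ↦ PresheafOfModules.Hom.app φ (op U)
    (TensorProduct.tmul Γ(X, U) a b)) this

end Tensor

section LiePart

variable {X : Scheme.{u}} (E : X.Modules) (r : ℕ) [IsLocallyFreeOfRank E r]

variable {E r}

/-- A section of `𝔰𝔩(E)` as a section of `𝔤𝔩(E)`. -/
def slVal {U : X.Opens} : Γ(sl E r, U) →ₗ[Γ(X, U)] Γ(gl E, U) := ((slSub E r).carrier U).subtype

theorem tr_slVal {U : X.Opens} (a : Γ(sl E r, U)) : tr E r (slVal a) = 0 :=
  Subtype.prop (p := (· ∈ (slSub E r).carrier U)) a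

theorem slVal_injective {U : X.Opens} : Function.Injective (slVal (E := E) (r := r) (U := U)) :=
  Subtype.val_injective

theorem slVal_res {U V : X.Opens} (h : V ≤ U) (a : Γ(sl E r, U)) :
    slVal (res (sl E r) h a) = res (gl E) h (slVal a) := rfl

/-- A traceless section of `𝔤𝔩(E)` as a section of `𝔰𝔩(E)`. -/
def mkSl {U : X.Opens} (φ : Γ(gl E, U)) (h : tr E r φ = 0) : Γ(sl E r, U) :=
  Subtype.mk (p := (· ∈ (slSub E r).carrier U)) φ h

theorem slVal_mkSl {U : X.Opens} (φ : Γ(gl E, U)) (h : tr E r φ = 0) :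
    slVal (mkSl φ h) = φ := rfl

theorem tr_sub {U : X.Opens} (φ ψ : Γ(gl E, U)) : tr E r (φ - ψ) = tr E r φ - tr E r ψ := by
  rw [eq_sub_iff_add_eq, ← tr_add, sub_add_cancel]

theorem ev_sub {M N : X.Modules} {U : X.Opens} (φ ψ : Γ(sheafHom M N, U)) {V : X.Opens}
    (h : V ≤ U) (s : Γ(M, V)) : ev (φ - ψ) h s = ev φ h s - ev ψ h s := by
  rw [eq_sub_iff_add_eq, ← ev_add, sub_add_cancel]

theorem glMul_add {U : X.Opens} (φ ψ ψ' : Γ(gl E, U)) :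
    glMul φ (ψ + ψ') = glMul φ ψ + glMul φ ψ' :=
  lin_ext fun _ h _ ↦ (ev φ h).map_add _ _

theorem add_glMul {U : X.Opens} (φ φ' ψ : Γ(gl E, U)) :
    glMul (φ + φ') ψ = glMul φ ψ + glMul φ' ψ := rfl

theorem glMul_smul {U : X.Opens} (f : Γ(X, U)) (φ ψ : Γ(gl E, U)) :
    glMul φ (f • ψ) = f • glMul φ ψ :=
  lin_ext fun _ h _ ↦ (ev φ h).map_smul _ _

theorem smul_glMul {U : X.Opens} (f : Γ(X, U)) (φ ψ : Γ(gl E, U)) :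
    glMul (f • φ) ψ = f • glMul φ ψ := rfl

theorem glMul_res {U V : X.Opens} (h : V ≤ U) (φ ψ : Γ(gl E, U)) :
    res (gl E) h (glMul φ ψ) = glMul (res (gl E) h φ) (res (gl E) h ψ) := rfl

/-- The Lie bracket `[a, b] = ab - ba` on sections of `𝔰𝔩(E)`. -/
def slBracket {U : X.Opens} (a b : Γ(sl E r, U)) : Γ(sl E r, U) :=
  mkSl (glMul (slVal a) (slVal b) - glMul (slVal b) (slVal a))
    (by rw [tr_sub, tr_mul_comm, sub_self])

variable (E r)

/-- The Lie bracket `𝔰𝔩(E) ⊗ 𝔰𝔩(E) → 𝔰𝔩(E)`. -/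
def bracket : tensor (sl E r) (sl E r) ⟶ sl E r :=
  lift (fun U ↦ LinearMap.mk₂ Γ(X, U) slBracket
      (fun a a' b ↦ slVal_injective <| by
        simp only [slBracket, slVal_mkSl, map_add, add_glMul, glMul_add]; abel)
      (fun f a b ↦ slVal_injective <| by
        simp only [slBracket, slVal_mkSl, map_smul, smul_glMul, glMul_smul, smul_sub])
      (fun a b b' ↦ slVal_injective <| by
        simp only [slBracket, slVal_mkSl, map_add, add_glMul, glMul_add]; abel)
      (fun f a b ↦ slVal_injective <| by
        simp only [slBracket, slVal_mkSl, map_smul, smul_glMul, glMul_smul, smul_sub]))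
    (fun h a b ↦ slVal_injective <| by
      simp only [LinearMap.mk₂_apply, slVal_res, slBracket, slVal_mkSl, map_sub, glMul_res])

/-- The trace pairing `t(a, b) = tr(ab)` on sections of `𝔰𝔩(E)`. -/
def tracePairing {U : X.Opens} (a b : Γ(sl E r, U)) : Γ(X, U) := tr E r (glMul (slVal a) (slVal b))

/-- The map `a ⊗ b ↦ (x ↦ t(a, x) b)` from `𝔰𝔩(E) ⊗ 𝔰𝔩(E)` to `ℋom(𝔰𝔩(E), 𝔰𝔩(E))`, where `t`
is the trace pairing. -/
def contraction : tensor (sl E r) (sl E r) ⟶ sheafHom (sl E r) (sl E r) :=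
  lift (fun U ↦ LinearMap.mk₂ Γ(X, U)
      (fun a b ↦ mkLin
        (fun V h ↦
          { toFun := fun x ↦ tracePairing E r (res (sl E r) h a) x • res (sl E r) h b
            map_add' := fun x y ↦ by
              rw [tracePairing, map_add, glMul_add, tr_add, add_smul]
              rfl
            map_smul' := fun f x ↦ by
              rw [tracePairing, map_smul, glMul_smul, tr_smul, mul_smul]
              rfl })
        (fun h k x ↦ by
          change tracePairing E r (res (sl E r) (k.trans h) a) (res (sl E r) k x) •
            res (sl E r) (k.trans h) b =
              res (sl E r) k (tracePairing E r (res (sl E r) h a) x • res (sl E r) h b)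
          rw [res_smul, res_res, tracePairing, tracePairing, ← tr_res, glMul_res, ← slVal_res,
            ← slVal_res, res_res]))
      (fun a a' b ↦ lin_ext fun V h x ↦ by
        change tracePairing E r (res (sl E r) h (a + a')) x • res (sl E r) h b =
          tracePairing E r (res (sl E r) h a) x • res (sl E r) h b +
            tracePairing E r (res (sl E r) h a') x • res (sl E r) h b
        rw [← add_smul, map_add, tracePairing, map_add, add_glMul, tr_add]
        rfl)
      (fun f a b ↦ lin_ext fun V h x ↦ by
        change tracePairing E r (res (sl E r) h (f • a)) x • res (sl E r) h b =
          resO h f • tracePairing E r (res (sl E r) h a) x • res (sl E r) h b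
        rw [smul_smul, res_smul, tracePairing, map_smul, smul_glMul, tr_smul]
        rfl)
      (fun a b b' ↦ lin_ext fun V h x ↦ by
        change tracePairing E r (res (sl E r) h a) x • res (sl E r) h (b + b') =
          tracePairing E r (res (sl E r) h a) x • res (sl E r) h b +
            tracePairing E r (res (sl E r) h a) x • res (sl E r) h b'
        rw [map_add, smul_add])
      (fun f a b ↦ lin_ext fun V h x ↦ by
        change tracePairing E r (res (sl E r) h a) x • res (sl E r) h (f • b) =
          resO h f • tracePairing E r (res (sl E r) h a) x • res (sl E r) h b
        rw [res_smul, smul_comm]))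
    (fun h a b ↦ lin_ext fun V k x ↦ by
      change tracePairing E r (res (sl E r) k (res (sl E r) h a)) x •
        res (sl E r) k (res (sl E r) h b) =
          tracePairing E r (res (sl E r) (k.trans h) a) x • res (sl E r) (k.trans h) b
      rw [res_res, res_res])

/-- The identity of `M` as a section of `ℋom(M, M)`. -/
def idSection (M : X.Modules) (U : X.Opens) : Γ(sheafHom M M, U) :=
  mkLin (fun _ _ ↦ LinearMap.id) (fun _ _ _ ↦ rfl)

/-- A global section `Ω` of `𝔰𝔩(E) ⊗ 𝔰𝔩(E)` is the dual of the trace pairing if contraction of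
its first factor by the trace pairing is the identity of `𝔰𝔩(E)`, in other words if
`Ω = ∑ eᵢ ⊗ eⁱ` for local bases `eᵢ`, `eⁱ` of `𝔰𝔩(E)` that are dual for the trace pairing. -/
def IsTraceDual (Ω : Γ(tensor (sl E r) (sl E r), (⊤ : X.Opens))) : Prop :=
  (contraction E r).app ⊤ Ω = idSection (sl E r) ⊤

end LiePart

/-! ## The Atiyah extension -/

section Atiyah

variable {C S : Scheme.{u}} (π : C ⟶ S) (E : C.Modules)

variable {π} in
/-- A section of the tangent sheaf as a derivation of functions. -/
def vf {U : C.Opens} (v : Γ(tangent π, U)) {V : C.Opens} (h : V ≤ U) : Γ(C, V) →+ Γ(C, V) :=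
  derApp v h

variable {π E} in
/-- The action of the second component of a section of `T_{C/S} × ℋom(E, E)` on sections of `E`. -/
def act {U : C.Opens} (p : Γ(prodMod (tangent π) (abHom E E), U)) {V : C.Opens} (h : V ≤ U) :
    Γ(E, V) →+ Γ(E, V) := AbHom.app (Prod.snd (α := Γ(tangent π, U)) (β := AbHom E E U) p) V h

variable {π E} in
/-- The vector field of a section of `T_{C/S} × ℋom(E, E)`. -/
def anchor {U : C.Opens} (p : Γ(prodMod (tangent π) (abHom E E), U)) : Γ(tangent π, U) :=
  Prod.fst (α := Γ(tangent π, U)) (β := AbHom E E U) p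

section

variable {π E} {U : C.Opens} (p q : Γ(prodMod (tangent π) (abHom E E), U)) {V : C.Opens}
  (h : V ≤ U)

theorem act_add (e : Γ(E, V)) : act (p + q) h e = act p h e + act q h e := rfl

theorem act_zero (e : Γ(E, V)) :
    act (0 : Γ(prodMod (tangent π) (abHom E E), U)) h e = 0 := rfl

theorem act_smul (c : Γ(C, U)) (e : Γ(E, V)) : act (c • p) h e = resO h c • act p h e := rfl

theorem act_nat {W : C.Opens} (k : W ≤ V) (e : Γ(E, V)) :
    act p (k.trans h) (res E k e) = res E k (act p h e) :=
  AbHom.nat (Prod.snd (α := Γ(tangent π, U)) (β := AbHom E E U) p) h k e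

theorem vf_add (f : Γ(C, V)) :
    vf (anchor (p + q)) h f = vf (anchor p) h f + vf (anchor q) h f := rfl

theorem vf_zero (f : Γ(C, V)) :
    vf (anchor (0 : Γ(prodMod (tangent π) (abHom E E), U))) h f = 0 := rfl

theorem vf_smul (c : Γ(C, U)) (f : Γ(C, V)) :
    vf (anchor (c • p)) h f = resO h c * vf (anchor p) h f := rfl

theorem vf_nat {W : C.Opens} (k : W ≤ V) (f : Γ(C, V)) :
    vf (anchor p) (k.trans h) (resO k f) = resO k (vf (anchor p) h f) :=
  derApp_nat (anchor p) h k f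

end

/-- The condition `a(f e) = f a(e) + v(f) e` on pairs `(v, a)`. -/
def atiyahSub : LocalSub (prodMod (tangent π) (abHom E E)) where
  carrier U :=
    { carrier := {p | ∀ (V : C.Opens) (h : V ≤ U) (f : Γ(C, V)) (e : Γ(E, V)),
        act p h (f • e) = f • act p h e + vf (anchor p) h f • e}
      zero_mem' := fun V h f e ↦ by
        rw [act_zero, act_zero, vf_zero, smul_zero, zero_smul, add_zero]
      add_mem' := fun {p q} hp hq V h f e ↦ by
        rw [act_add, act_add, vf_add, hp V h, hq V h, smul_add, add_smul]
        abel
      smul_mem' := fun c p hp V h f e ↦ by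
        rw [act_smul, act_smul, vf_smul, hp V h, smul_add, smul_comm, mul_smul] }
  res_mem h _ hp V hV := hp V (hV.trans h)
  of_local {U} p hp V h f e := by
    refine eq_of_local E _ _ fun x hx ↦ ?_
    obtain ⟨W, hxW, hW, hm⟩ := hp x (h hx)
    refine ⟨V ⊓ W, ⟨hx, hxW⟩, inf_le_left, ?_⟩
    have := hm (V ⊓ W) inf_le_right (resO inf_le_left f) (res E inf_le_left e)
    rw [← res_smul] at this
    rw [map_add, res_smul, res_smul, ← act_nat, ← act_nat, ← vf_nat]
    exact this

/-- The Atiyah algebroid `𝔇(E)`: the sheaf of pairs `(v, a)`, where `v` is a section of `T_{C/S}`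
and `a` is an additive endomorphism of `E` with `a(f e) = f a(e) + v(f) e`. -/
def atiyah : C.Modules := (atiyahSub π E).toModules

/-- The inclusion `𝔤𝔩(E) → 𝔇(E)`, `φ ↦ (0, φ)`. -/
def glToAtiyah : gl E ⟶ atiyah π E :=
  mkHom (M := gl E) (N := atiyah π E)
    (fun U ↦ AddMonoidHom.mk' (fun φ ↦ Subtype.mk (p := (· ∈ (atiyahSub π E).carrier U))
      (Prod.mk (0 : Γ(tangent π, U)) (Subtype.val (p := (· ∈ (linearSub E E).carrier U)) φ))
      (fun V h f e ↦ by
        refine ((ev φ h).map_smul f e).trans ?_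
        refine Eq.symm ((congrArg (fun z : Γ(E, V) ↦ f • ev φ h e + z) ?_).trans (add_zero _))
        exact zero_smul Γ(C, V) e))
      (fun φ ψ ↦ Subtype.ext (Prod.ext (add_zero (0 : Γ(tangent π, U))).symm rfl)))
    (fun U f φ ↦ Subtype.ext (Prod.ext (smul_zero (A := Γ(tangent π, U)) f).symm rfl))
    (fun {U V} h φ ↦ Subtype.ext (Prod.ext (map_zero (res (tangent π) h)).symm rfl))

/-- The projection `𝔇(E) → T_{C/S}`, `(v, a) ↦ v`. -/
def atiyahToTangent : atiyah π E ⟶ tangent π :=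
  mkHom (M := atiyah π E) (N := tangent π)
    (fun U ↦ AddMonoidHom.mk' (fun p ↦ anchor (Subtype.val
      (p := (· ∈ (atiyahSub π E).carrier U)) p)) (fun _ _ ↦ rfl))
    (fun _ _ _ ↦ rfl) (fun _ _ ↦ rfl)

/-- The Atiyah extension `0 → 𝔤𝔩(E) → 𝔇(E) → T_{C/S} → 0`. -/
def atiyahSequence : ShortComplex C.Modules where
  X₁ := gl E
  X₂ := atiyah π E
  X₃ := tangent π
  f := glToAtiyah π E
  g := atiyahToTangent π E
  zero := by
    ext U φ
    rfl

end Atiyah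

/-! ## The diagonal extension -/

section Diagonal

variable {C S : Scheme.{u}} (π : C ⟶ S)

/-- The fibre square `C ×_S C`. -/
abbrev square : Scheme.{u} := Limits.pullback π π

/-- The first projection `C ×_S C → C`. -/
abbrev p₁ : square π ⟶ C := Limits.pullback.fst π π

/-- The second projection `C ×_S C → C`. -/
abbrev p₂ : square π ⟶ C := Limits.pullback.snd π π

/-- The diagonal `C → C ×_S C`. -/
abbrev diag : C ⟶ square π := Limits.pullback.diagonal π

/-- The direct image `Δ_*` of `𝒪_C`-modules. -/
abbrev diagPush : C.Modules ⥤ (square π).Modules := Scheme.Modules.pushforward (diag π)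

/-- The external tensor product `A ⊠ B = p₁^* A ⊗ p₂^* B`. -/
def box (A B : C.Modules) : (square π).Modules :=
  tensor ((Scheme.Modules.pullback (p₁ π)).obj A) ((Scheme.Modules.pullback (p₂ π)).obj B)

/-- The map `p^* A → Δ_* A`, for a retraction `p` of the diagonal, that is adjoint to the
identity `A = p_* Δ_* A`. -/
def pullToDiag {p : square π ⟶ C} (hp : diag π ≫ p = 𝟙 C) (A : C.Modules) :
    (Scheme.Modules.pullback p).obj A ⟶ (diagPush π).obj A :=
  ((Scheme.Modules.pullbackPushforwardAdjunction p).homEquiv _ _).symm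
    ((Scheme.Modules.pushforwardId C).inv.app A ≫
      (Scheme.Modules.pushforwardCongr hp.symm).hom.app A ≫
      (Scheme.Modules.pushforwardComp (diag π) p).inv.app A)

section

variable {π} {A B : C.Modules} {W : (square π).Opens}

/-- The section `a ⊗ b` of `Δ_* (A ⊗ B)`. -/
def diagTmul (a : Γ((diagPush π).obj A, W)) (b : Γ((diagPush π).obj B, W)) :
    Γ((diagPush π).obj (tensor A B), W) :=
  tmul (A := A) (B := B) (U := diag π ⁻¹ᵁ W) a b

theorem diagTmul_add (a : Γ((diagPush π).obj A, W)) (b b' : Γ((diagPush π).obj B, W)) :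
    diagTmul a (b + b') = diagTmul a b + diagTmul a b' :=
  tmul_add (A := A) (B := B) (U := diag π ⁻¹ᵁ W) a b b'

theorem add_diagTmul (a a' : Γ((diagPush π).obj A, W)) (b : Γ((diagPush π).obj B, W)) :
    diagTmul (a + a') b = diagTmul a b + diagTmul a' b :=
  add_tmul (A := A) (B := B) (U := diag π ⁻¹ᵁ W) a a' b

theorem diagTmul_smul (f : Γ(square π, W)) (a : Γ((diagPush π).obj A, W))
    (b : Γ((diagPush π).obj B, W)) : diagTmul a (f • b) = f • diagTmul a b :=
  tmul_smul (A := A) (B := B) (U := diag π ⁻¹ᵁ W) ((diag π).app W f) a b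

theorem smul_diagTmul (f : Γ(square π, W)) (a : Γ((diagPush π).obj A, W))
    (b : Γ((diagPush π).obj B, W)) : diagTmul (f • a) b = f • diagTmul a b :=
  smul_tmul' (A := A) (B := B) (U := diag π ⁻¹ᵁ W) ((diag π).app W f) a b

theorem res_diagTmul {V : (square π).Opens} (h : V ≤ W) (a : Γ((diagPush π).obj A, W))
    (b : Γ((diagPush π).obj B, W)) :
    res _ h (diagTmul a b) = diagTmul (res _ h a) (res _ h b) :=
  res_tmul (A := A) (B := B) (Scheme.Hom.preimage_mono (diag π) h) a b

/-- The restriction of functions to the diagonal. -/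
def diagFun : Γ(square π, W) →+* Γ(C, diag π ⁻¹ᵁ W) := ((diag π).app W).hom

theorem diagFun_res {V : (square π).Opens} (h : V ≤ W) (f : Γ(square π, W)) :
    diagFun (resO h f) = resO (Scheme.Hom.preimage_mono (diag π) h) (diagFun f) :=
  ConcreteCategory.congr_hom ((diag π).naturality (homOfLE h).op) f

end

/-- The restriction to the diagonal `A ⊠ B → Δ_* (A ⊗ B)`. -/
def boxToDiag (A B : C.Modules) : box π A B ⟶ (diagPush π).obj (tensor A B) :=
  lift (fun W ↦ LinearMap.mk₂ Γ(square π, W)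
      (fun a b ↦ diagTmul ((pullToDiag π (Limits.pullback.diagonal_fst π) A).app W a)
        ((pullToDiag π (Limits.pullback.diagonal_snd π) B).app W b))
      (fun a a' b ↦ by rw [map_add, add_diagTmul])
      (fun f a b ↦ by rw [Scheme.Modules.Hom.app_smul, smul_diagTmul])
      (fun a b b' ↦ by rw [map_add, diagTmul_add])
      (fun f a b ↦ by rw [Scheme.Modules.Hom.app_smul, diagTmul_smul]))
    (fun h a b ↦ by
      rw [LinearMap.mk₂_apply, LinearMap.mk₂_apply, app_res, app_res, res_diagTmul])

/-- The condition of vanishing on the diagonal. -/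
def idealSub : LocalSub (unitMod (square π)) where
  carrier W := (RingHom.ker (diagFun (π := π) (W := W)) : Ideal Γ(square π, W))
  res_mem {U V} h f hf := by
    exact (diagFun_res h f).trans ((congrArg _ (show diagFun f = 0 from hf)).trans (map_zero _))
  of_local {U} f H := by
    refine eq_of_local (unitMod C) (U := diag π ⁻¹ᵁ U) (diagFun (π := π) (W := U) f) 0 fun x hx ↦ ?_
    obtain ⟨V, hxV, h, hV⟩ := H (diag π x) hx
    refine ⟨diag π ⁻¹ᵁ V, hxV, Scheme.Hom.preimage_mono (diag π) h, ?_⟩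
    rw [map_zero]
    exact (diagFun_res h f).symm.trans hV

/-- The ideal sheaf `ℐ_Δ` of the diagonal. -/
def ideal : (square π).Modules := (idealSub π).toModules

/-- The twist `N(Δ) = ℋom(ℐ_Δ, N)`. -/
abbrev twist (N : (square π).Modules) : (square π).Modules := sheafHom (ideal π) N

section

variable {π}

/-- A section of the ideal of the diagonal as a function. -/
def idealVal {W : (square π).Opens} : Γ(ideal π, W) →ₗ[Γ(square π, W)] Γ(square π, W) :=
  (RingHom.ker (diagFun (π := π) (W := W)) : Ideal Γ(square π, W)).subtype

theorem diagFun_idealVal {W : (square π).Opens} (i : Γ(ideal π, W)) : diagFun (idealVal i) = 0 :=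
  Subtype.prop (p := (· ∈ (idealSub π).carrier W)) i

theorem idealVal_injective {W : (square π).Opens} :
    Function.Injective (idealVal (π := π) (W := W)) := Subtype.val_injective

theorem idealVal_res {V W : (square π).Opens} (h : V ≤ W) (i : Γ(ideal π, W)) :
    idealVal (res (ideal π) h i) = resO h (idealVal i) := rfl

/-- A function vanishing on the diagonal as a section of the ideal. -/
def mkIdeal {W : (square π).Opens} (f : Γ(square π, W)) (hf : diagFun f = 0) : Γ(ideal π, W) :=
  Subtype.mk (p := (· ∈ (idealSub π).carrier W)) f hf

theorem idealVal_mkIdeal {W : (square π).Opens} (f : Γ(square π, W)) (hf : diagFun f = 0) :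
    idealVal (mkIdeal f hf) = f := rfl

/-- Multiplication `ℐ_Δ → N` by a section of `N`. -/
def mulSection {N : (square π).Modules} {W : (square π).Opens} (n : Γ(N, W)) : Γ(twist π N, W) :=
  mkLin (fun V h ↦ (LinearMap.toSpanSingleton Γ(square π, V) Γ(N, V) (res N h n)).comp idealVal)
    (fun h k i ↦ by
      simp only [LinearMap.comp_apply, LinearMap.toSpanSingleton_apply, idealVal_res, res_smul,
        res_res])

theorem ev_mulSection {N : (square π).Modules} {W : (square π).Opens} (n : Γ(N, W))
    {V : (square π).Opens} (h : V ≤ W) (i : Γ(ideal π, V)) :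
    ev (mulSection n) h i = idealVal i • res N h n := rfl

/-- The open set of pairs in `W` whose two coordinates lie in `V`. -/
def around (W : (square π).Opens) (V : C.Opens) : (square π).Opens :=
  W ⊓ (p₁ π ⁻¹ᵁ V ⊓ p₂ π ⁻¹ᵁ V)

theorem around_le (W : (square π).Opens) (V : C.Opens) : around W V ≤ W := inf_le_left

theorem around_le₁ (W : (square π).Opens) (V : C.Opens) : around W V ≤ p₁ π ⁻¹ᵁ V :=
  inf_le_right.trans inf_le_left

theorem around_le₂ (W : (square π).Opens) (V : C.Opens) : around W V ≤ p₂ π ⁻¹ᵁ V :=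
  inf_le_right.trans inf_le_right

theorem around_mono (W : (square π).Opens) {V V' : C.Opens} (h : V' ≤ V) :
    around W V' ≤ around W V :=
  inf_le_inf le_rfl (inf_le_inf (Scheme.Hom.preimage_mono _ h) (Scheme.Hom.preimage_mono _ h))

theorem le_around {W : (square π).Opens} {V : C.Opens} (h : V ≤ diag π ⁻¹ᵁ W) :
    V ≤ diag π ⁻¹ᵁ around W V := by
  intro x hx
  have h₁ : p₁ π (diag π x) = x := by
    rw [← Scheme.Hom.comp_apply, Limits.pullback.diagonal_fst]
    rfl
  have h₂ : p₂ π (diag π x) = x := by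
    rw [← Scheme.Hom.comp_apply, Limits.pullback.diagonal_snd]
    rfl
  refine ⟨h hx, ?_, ?_⟩
  · change p₁ π (diag π x) ∈ V
    rwa [h₁]
  · change p₂ π (diag π x) ∈ V
    rwa [h₂]

/-- The function `f ∘ p₁` near the diagonal. -/
def pull₁ (W : (square π).Opens) {V : C.Opens} : Γ(C, V) →+* Γ(square π, around W V) :=
  ((p₁ π).appLE V (around W V) (around_le₁ W V)).hom

/-- The function `f ∘ p₂` near the diagonal. -/
def pull₂ (W : (square π).Opens) {V : C.Opens} : Γ(C, V) →+* Γ(square π, around W V) :=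
  ((p₂ π).appLE V (around W V) (around_le₂ W V)).hom

theorem appLE_congr_hom {X Y : Scheme.{u}} {f g : X ⟶ Y} (h : f = g) {U : Y.Opens} {V : X.Opens}
    (e : V ≤ f ⁻¹ᵁ U) (e' : V ≤ g ⁻¹ᵁ U) : f.appLE U V e = g.appLE U V e' := by
  subst h
  rfl

theorem diagFun_pull {p : square π ⟶ C} (hp : diag π ≫ p = 𝟙 C) {W : (square π).Opens}
    {V V' : C.Opens} (e : W ≤ p ⁻¹ᵁ V) (h : V' ≤ diag π ⁻¹ᵁ W) (k : V' ≤ V) (f : Γ(C, V)) :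
    resO h (diagFun ((p.appLE V W e).hom f)) = resO k f := by
  have h₁ : p.appLE V W e ≫ (diag π).appLE W V' h = C.presheaf.map (homOfLE k).op := by
    rw [Scheme.Hom.appLE_comp_appLE,
      appLE_congr_hom hp (g := 𝟙 C) _ k]
    exact Category.id_comp _
  exact ConcreteCategory.congr_hom h₁ f

theorem diag_around_le (W : (square π).Opens) (V : C.Opens) : diag π ⁻¹ᵁ around W V ≤ V := by
  intro x hx
  have h₁ : p₁ π (diag π x) = x := by
    rw [← Scheme.Hom.comp_apply, Limits.pullback.diagonal_fst]
    rfl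
  have h₂ := around_le₁ W V hx
  change p₁ π (diag π x) ∈ V at h₂
  rwa [h₁] at h₂

theorem diagFun_pull₁ (W : (square π).Opens) {V : C.Opens} (f : Γ(C, V)) :
    diagFun (pull₁ W f) = resO (diag_around_le W V) f := by
  have := diagFun_pull (Limits.pullback.diagonal_fst π) (around_le₁ W V) le_rfl
    (diag_around_le W V) f
  rwa [resO_self] at this

theorem diagFun_pull₂ (W : (square π).Opens) {V : C.Opens} (f : Γ(C, V)) :
    diagFun (pull₂ W f) = resO (diag_around_le W V) f := by
  have := diagFun_pull (Limits.pullback.diagonal_snd π) (around_le₂ W V) le_rfl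
    (diag_around_le W V) f
  rwa [resO_self] at this

theorem pull₁_res (W : (square π).Opens) {V V' : C.Opens} (h : V' ≤ V) (f : Γ(C, V)) :
    pull₁ W (resO h f) = resO (around_mono W h) (pull₁ W f) :=
  ConcreteCategory.congr_hom (((p₁ π).map_appLE (around_le₁ W V') (homOfLE h).op).trans
    ((p₁ π).appLE_map (around_le₁ W V) (homOfLE (around_mono W h)).op).symm) f

theorem pull₂_res (W : (square π).Opens) {V V' : C.Opens} (h : V' ≤ V) (f : Γ(C, V)) :
    pull₂ W (resO h f) = resO (around_mono W h) (pull₂ W f) :=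
  ConcreteCategory.congr_hom (((p₂ π).map_appLE (around_le₂ W V') (homOfLE h).op).trans
    ((p₂ π).appLE_map (around_le₂ W V) (homOfLE (around_mono W h)).op).symm) f

theorem pull_base (W : (square π).Opens) {V : C.Opens} {W' : S.Opens} (k : V ≤ π ⁻¹ᵁ W')
    (s : Γ(S, W')) : pull₂ W ((π.appLE W' V k).hom s) = pull₁ W ((π.appLE W' V k).hom s) := by
  refine ConcreteCategory.congr_hom (f := π.appLE W' V k ≫ (p₂ π).appLE _ _ (around_le₂ W V))
    (g := π.appLE W' V k ≫ (p₁ π).appLE _ _ (around_le₁ W V)) ?_ s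
  rw [Scheme.Hom.appLE_comp_appLE, Scheme.Hom.appLE_comp_appLE]
  exact appLE_congr_hom Limits.pullback.condition.symm _ _

/-- The function `p₂^* f - p₁^* f`, a section of the ideal of the diagonal; its class modulo the
square of the ideal is the differential `df`. -/
def diff (W : (square π).Opens) {V : C.Opens} (f : Γ(C, V)) : Γ(ideal π, around W V) :=
  mkIdeal (pull₂ W f - pull₁ W f) (by rw [map_sub, diagFun_pull₁, diagFun_pull₂, sub_self])

theorem idealVal_diff (W : (square π).Opens) {V : C.Opens} (f : Γ(C, V)) :
    idealVal (diff W f) = pull₂ W f - pull₁ W f := rfl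

theorem diff_add (W : (square π).Opens) {V : C.Opens} (f g : Γ(C, V)) :
    diff W (f + g) = diff W f + diff W g :=
  idealVal_injective <| by
    rw [map_add, idealVal_diff, idealVal_diff, idealVal_diff, map_add, map_add]
    ring

theorem diff_mul (W : (square π).Opens) {V : C.Opens} (f g : Γ(C, V)) :
    diff W (f * g) = pull₂ W f • diff W g + pull₁ W g • diff W f :=
  idealVal_injective <| by
    rw [map_add, map_smul, map_smul, idealVal_diff, idealVal_diff, idealVal_diff, map_mul, map_mul,
      smul_eq_mul, smul_eq_mul]
    ring

theorem diff_base (W : (square π).Opens) {V : C.Opens} {W' : S.Opens} (k : V ≤ π ⁻¹ᵁ W')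
    (s : Γ(S, W')) : diff W ((π.appLE W' V k).hom s) = 0 :=
  idealVal_injective <| by rw [idealVal_diff, pull_base, sub_self, map_zero]

theorem diff_res (W : (square π).Opens) {V V' : C.Opens} (h : V' ≤ V) (f : Γ(C, V)) :
    diff W (resO h f) = res (ideal π) (around_mono W h) (diff W f) :=
  idealVal_injective <| by
    rw [idealVal_res, idealVal_diff, idealVal_diff, pull₁_res, pull₂_res, map_sub]

theorem around_mono_left {W W' : (square π).Opens} (h : W' ≤ W) (V : C.Opens) :
    around W' V ≤ around W V := inf_le_inf_right _ h

theorem diff_mono {W W' : (square π).Opens} (h : W' ≤ W) {V : C.Opens} (f : Γ(C, V)) :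
    diff W' f = res (ideal π) (around_mono_left h V) (diff W f) := by
  refine idealVal_injective ?_
  rw [idealVal_res, idealVal_diff, idealVal_diff, map_sub]
  congr 1
  · exact ConcreteCategory.congr_hom
      ((p₂ π).appLE_map (around_le₂ W V) (homOfLE (around_mono_left h V)).op).symm f
  · exact ConcreteCategory.congr_hom
      ((p₁ π).appLE_map (around_le₁ W V) (homOfLE (around_mono_left h V)).op).symm f

/-- A section of `Δ_* M` over `around W V`, restricted to `V`. -/
def toDiag {M : C.Modules} {W : (square π).Opens} {V : C.Opens} (h : V ≤ diag π ⁻¹ᵁ W) :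
    Γ((diagPush π).obj M, around W V) →+ Γ(M, V) := res M (le_around h)

theorem toDiag_smul {M : C.Modules} {W : (square π).Opens} {V : C.Opens} (h : V ≤ diag π ⁻¹ᵁ W)
    (f : Γ(square π, around W V)) (m : Γ((diagPush π).obj M, around W V)) :
    toDiag h (f • m) = resO (le_around h) (diagFun f) • toDiag h m :=
  res_smul M (le_around h) (diagFun f) m

theorem toDiag_pull₁ {M : C.Modules} {W : (square π).Opens} {V : C.Opens} (h : V ≤ diag π ⁻¹ᵁ W)
    (f : Γ(C, V)) (m : Γ((diagPush π).obj M, around W V)) :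
    toDiag h (pull₁ W f • m) = f • toDiag h m := by
  rw [toDiag_smul, diagFun_pull₁, resO_resO, resO_self]

theorem toDiag_pull₂ {M : C.Modules} {W : (square π).Opens} {V : C.Opens} (h : V ≤ diag π ⁻¹ᵁ W)
    (f : Γ(C, V)) (m : Γ((diagPush π).obj M, around W V)) :
    toDiag h (pull₂ W f • m) = f • toDiag h m := by
  rw [toDiag_smul, diagFun_pull₂, resO_resO, resO_self]

theorem toDiag_res {M : C.Modules} {W : (square π).Opens} {V V' : C.Opens}
    (h : V ≤ diag π ⁻¹ᵁ W) (k : V' ≤ V) (m : Γ((diagPush π).obj M, around W V)) :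
    toDiag (k.trans h) (res ((diagPush π).obj M) (around_mono W k) m) = res M k (toDiag h m) :=
  (res_res M _ (le_around (k.trans h)) m).trans (res_res M (le_around h) k m).symm

theorem toDiag_mono {M : C.Modules} {W W' : (square π).Opens} {V : C.Opens} (k : W' ≤ W)
    (h : V ≤ diag π ⁻¹ᵁ W') (m : Γ((diagPush π).obj M, around W V)) :
    toDiag h (res ((diagPush π).obj M) (around_mono_left k V) m) =
      toDiag (h.trans (Scheme.Hom.preimage_mono (diag π) k)) m :=
  res_res M _ (le_around h) m

/-- The derivation `f ↦ ρ(φ(df))|_Δ` given by a section `φ` of `N(Δ)` and `ρ : N → Δ_* M`. -/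
def principalDer {N : (square π).Modules} {M : C.Modules} (ρ : N ⟶ (diagPush π).obj M)
    {W : (square π).Opens} (φ : Γ(twist π N, W)) : Γ(derSheaf π M, diag π ⁻¹ᵁ W) :=
  mkDer (fun V h ↦ AddMonoidHom.mk'
      (fun f ↦ toDiag h (ρ.app (around W V) (ev φ (around_le W V) (diff W f))))
      (fun f g ↦ by rw [diff_add, map_add, map_add, map_add]))
    (fun {V V'} h k f ↦ by
      change toDiag (k.trans h) (ρ.app (around W V')
        (ev φ (around_le W V') (diff W (resO k f)))) =
          res M k (toDiag h (ρ.app (around W V) (ev φ (around_le W V) (diff W f))))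
      rw [diff_res, ← toDiag_res, ← app_res, ← ev_nat φ (around_le W V) (around_mono W k)])
    (fun V h f g ↦ by
      change toDiag h (ρ.app (around W V) (ev φ (around_le W V) (diff W (f * g)))) =
        f • toDiag h (ρ.app (around W V) (ev φ (around_le W V) (diff W g))) +
          g • toDiag h (ρ.app (around W V) (ev φ (around_le W V) (diff W f)))
      rw [diff_mul, map_add, map_add, map_add, LinearMap.map_smul, LinearMap.map_smul, Scheme.Modules.Hom.app_smul,
        Scheme.Modules.Hom.app_smul, toDiag_pull₂, toDiag_pull₁])
    (fun V h W' k s ↦ by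
      change toDiag h (ρ.app (around W V) (ev φ (around_le W V)
        (diff W ((π.appLE W' V k).hom s)))) = 0
      rw [diff_base, map_zero, map_zero, map_zero])

theorem derApp_principalDer {N : (square π).Modules} {M : C.Modules}
    (ρ : N ⟶ (diagPush π).obj M) {W : (square π).Opens} (φ : Γ(twist π N, W)) {V : C.Opens}
    (h : V ≤ diag π ⁻¹ᵁ W) (f : Γ(C, V)) :
    derApp (principalDer ρ φ) h f =
      toDiag h (ρ.app (around W V) (ev φ (around_le W V) (diff W f))) := rfl

/-- The map `N(Δ) → Δ_* 𝒟er(𝒪_C, M)` induced by `ρ : N → Δ_* M`. -/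
def principalPart {N : (square π).Modules} {M : C.Modules} (ρ : N ⟶ (diagPush π).obj M) :
    twist π N ⟶ (diagPush π).obj (derSheaf π M) :=
  mkHom (M := twist π N) (N := (diagPush π).obj (derSheaf π M))
    (fun W ↦ AddMonoidHom.mk' (fun φ ↦ principalDer ρ φ) (fun φ ψ ↦ der_ext fun V h f ↦ by
      refine (derApp_principalDer ρ _ h f).trans ?_
      rw [ev_add, map_add, map_add]
      rfl))
    (fun W c φ ↦ der_ext fun V h f ↦ by
      refine (derApp_principalDer ρ _ h f).trans ?_
      rw [ev_smul, Scheme.Modules.Hom.app_smul, toDiag_smul]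
      refine congrArg (· • _) ?_
      rw [diagFun_res, resO_resO]
      rfl)
    (fun {W W'} h φ ↦ der_ext fun V k f ↦ by
      refine (derApp_principalDer ρ _ k f).trans ?_
      rw [ev_res φ h (around_le W' V), diff_mono h, ev_nat φ (around_le W V) (around_mono_left h V), app_res,
        toDiag_mono h]
      rfl)

/-- The inclusion `N → N(Δ)`. -/
def toTwist (N : (square π).Modules) : N ⟶ twist π N :=
  mkHom (fun W ↦ AddMonoidHom.mk' (fun n ↦ mulSection n) (fun n n' ↦ lin_ext fun V h i ↦ by
      rw [ev_add, ev_mulSection, ev_mulSection, ev_mulSection, map_add, smul_add]))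
    (fun W c n ↦ lin_ext fun V h i ↦ by
      refine (ev_mulSection _ h i).trans ?_
      rw [ev_smul, res_smul, smul_comm]
      rfl)
    (fun h n ↦ lin_ext fun V k i ↦ by
      refine (ev_mulSection _ k i).trans ?_
      rw [res_res]
      rfl)

end

/-- The diagonal sequence `0 → A ⊠ B → (A ⊠ B)(Δ) → Δ_*(A ⊗ B ⊗ T_{C/S}) → 0`. -/
def diagonalSequence (A B : C.Modules) : ShortComplex (square π).Modules where
  X₁ := box π A B
  X₂ := twist π (box π A B)
  X₃ := (diagPush π).obj (derSheaf π (tensor A B))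
  f := toTwist (box π A B)
  g := principalPart (boxToDiag π A B)
  zero := by
    ext W n
    refine der_ext fun V h f ↦ ?_
    refine (derApp_principalDer (boxToDiag π A B) (mulSection n) h f).trans ?_
    rw [ev_mulSection, Scheme.Modules.Hom.app_smul, toDiag_smul, diagFun_idealVal, map_zero,
      zero_smul]
    rfl

end Diagonal

/-! ## The Hitchin symbol and the Atiyah class -/

section Symbol

variable {C S : Scheme.{u}} (π : C ⟶ S)

/-- Multiplication of a global section of `N` by functions. -/
def mulBy {N : C.Modules} (n : Γ(N, (⊤ : C.Opens))) (V : C.Opens) : Γ(C, V) →+ Γ(N, V) :=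
  AddMonoidHom.mk' (fun f ↦ f • res N le_top n) (fun f g ↦ add_smul f g _)

theorem mulBy_smul {N : C.Modules} (n : Γ(N, (⊤ : C.Opens))) {V : C.Opens} (f g : Γ(C, V)) :
    mulBy n V (f * g) = f • mulBy n V g := mul_smul f g (res N le_top n)

theorem mulBy_res {N : C.Modules} (n : Γ(N, (⊤ : C.Opens))) {V W : C.Opens} (h : W ≤ V)
    (f : Γ(C, V)) : res N h (mulBy n V f) = mulBy n W (resO h f) :=
  (res_smul N h f _).trans (congrArg (resO h f • ·) (res_res N le_top h n))

/-- The map `T_{C/S} → N ⊗ T_{C/S} = 𝒟er(𝒪_C, N)`, `v ↦ n ⊗ v`, given by a global section `n`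
of `N`. -/
def tensorSection {N : C.Modules} (n : Γ(N, (⊤ : C.Opens))) : tangent π ⟶ derSheaf π N :=
  mkHom (M := tangent π) (N := derSheaf π N)
    (fun U ↦ AddMonoidHom.mk' (fun v ↦ mkDer
        (fun V h ↦ (mulBy n V).comp (vf v h))
        (fun {V W} h k f ↦ by
          change mulBy n W (vf v (k.trans h) (resO k f)) = res N k (mulBy n V (vf v h f))
          rw [mulBy_res]
          exact congrArg (mulBy n W) (derApp_nat v h k f))
        (fun V h f g ↦ by
          change mulBy n V (vf v h (f * g)) = f • mulBy n V (vf v h g) + g • mulBy n V (vf v h f)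
          rw [← mulBy_smul, ← mulBy_smul, ← map_add]
          exact congrArg (mulBy n V) (derApp_mul v h f g))
        (fun V h W k s ↦ (congrArg (mulBy n V) (derApp_base v h W k s)).trans (map_zero _)))
      (fun v w ↦ der_ext fun V h f ↦ map_add (mulBy n V) (vf v h f) (vf w h f)))
    (fun U c v ↦ der_ext fun V h f ↦ mulBy_smul n (resO h c) (vf v h f))
    (fun {U V} h v ↦ rfl)

theorem derApp_tensorSection {N : C.Modules} (n : Γ(N, (⊤ : C.Opens))) {U V : C.Opens}
    (v : Γ(tangent π, U)) (h : V ≤ U) (f : Γ(C, V)) :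
    derApp ((tensorSection π n).app U v) h f = vf v h f • res N le_top n := rfl

variable {π} {E : C.Modules} {r : ℕ} [IsLocallyFreeOfRank E r] [HasExt.{w} (square π).Modules]

/-- The Hitchin symbol `T_{C/S} → 𝔰𝔩(E) ⊠ 𝔰𝔩(E)[1]`: the composite of `v ↦ Ω ⊗ v`, for the dual
`Ω` of the trace pairing, with the coboundary of the diagonal sequence. -/
def hitchinSymbol (Ω : Γ(tensor (sl E r) (sl E r), (⊤ : C.Opens)))
    (hex : (diagonalSequence π (sl E r) (sl E r)).ShortExact) :
    Abelian.Ext ((diagPush π).obj (tangent π)) (box π (sl E r) (sl E r)) 1 :=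
  (Abelian.Ext.mk₀ ((diagPush π).map (tensorSection π Ω))).comp hex.extClass (zero_add 1)

/-- The composite of the Hitchin symbol with restriction to the diagonal and the bracket. -/
def bracketSymbol (Ω : Γ(tensor (sl E r) (sl E r), (⊤ : C.Opens)))
    (hex : (diagonalSequence π (sl E r) (sl E r)).ShortExact) :
    Abelian.Ext ((diagPush π).obj (tangent π)) ((diagPush π).obj (sl E r)) 1 :=
  (hitchinSymbol Ω hex).comp (Abelian.Ext.mk₀
    (boxToDiag π (sl E r) (sl E r) ≫ (diagPush π).map (bracket E r))) (add_zero 1)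

/-- `ℓ` is the traceless part of the Atiyah class of `E`, the class of the Atiyah extension: the
class is the sum of `ℓ` and a class with values in the scalars, in accordance with the
decomposition `𝔤𝔩(E) = 𝔰𝔩(E) ⊕ 𝒪_C`. -/
def IsTracelessAtiyahClass (hex : ((atiyahSequence π E).map (diagPush π)).ShortExact)
    (ℓ : Abelian.Ext ((diagPush π).obj (tangent π)) ((diagPush π).obj (sl E r)) 1) : Prop :=
  ∃ a : Abelian.Ext ((diagPush π).obj (tangent π)) ((diagPush π).obj (unitMod C)) 1,
    hex.extClass =
      ℓ.comp (Abelian.Ext.mk₀ ((diagPush π).map (slIncl E r))) (add_zero 1) +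
        a.comp (Abelian.Ext.mk₀ ((diagPush π).map (scalars E))) (add_zero 1)

end Symbol

end HitchinSymbol

end

/-! Write 𝔤 for `sl E r`, P for the diagonal extension, Q for the Atiyah extension pushed to the
square, and t for v ↦ Ω ⊗ v. The equality of classes follows from a morphism θ to Δ_*𝔤 on the fibre
product of P and Q over t, whose sections are pairs (φ, D) such that φ has principal part Ω ⊗ v,
with v the vector field of D. This θ has to be n ↦ [n|Δ] on 𝔤 ⊠ 𝔤 and -2r times the traceless
projection on 𝔤𝔩(E): the sum of the two pushed-out classes is then killed, because a class of an
extension dies along a map that extends to the middle term (`extClass_add_eq_zero`,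
`fibre_extClass`).

To construct θ, choose locally families aᵢ, bᵢ of 𝔤 that are dual for the trace pairing, and a
section ψ of 𝒪(Δ) with principal part v. Then φ = ψ ∑ aᵢ ⊠ bᵢ + n with n in 𝔤 ⊠ 𝔤, and the value of
θ is [n|Δ] + ∑ [aᵢ, [D, bᵢ]]. Replacing ψ by ψ + g changes n by -g ∑ aᵢ ⊠ bᵢ, which is harmless
since ∑ [aᵢ, bᵢ] = 0 (`DualSystem.sum_bracket`). Replacing the dual families changes ∑ aᵢ ⊠ bᵢ by
terms with coefficients p₂^*f - p₁^*f; multiplied by ψ these become regular, with value v(f) on the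
diagonal, and they cancel the terms that the Leibniz rule of [D, ·] produces in the second summand
(`DualSystem.exists_transfer`). So the local values define a morphism (`exists_splitting`).

If D is an endomorphism φ, then v = 0 and ψ = 0 is allowed. The identity ∑ eᵢⱼ φ eⱼᵢ = tr(φ) for
matrix units gives ∑ [eᵢⱼ, [φ, eⱼᵢ]] = 2 tr(φ) - 2r φ, which is -2r times the traceless part
(`IsFrame.casimir`). This is where the factor 2r comes from.

Exactness of the diagonal sequence rests on an étale coordinate x: near the diagonal p₂^*x - p₁^*x
is regular, by flatness, and generates the ideal, by unramifiedness and Nakayama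
(`exists_coordinate`). Characteristic 0 enters only through the invertibility of the nonzero
integers. -/

noncomputable section

namespace HitchinSymbol

/-! ### Exactness and morphisms of sheaves of modules, tested on sections. -/

section Toolkit

variable {X : Scheme.{u}}

theorem hom_ext_sections {M N : X.Modules} {f g : M ⟶ N}
    (h : ∀ (U : X.Opens) (s : Γ(M, U)), f.app U s = g.app U s) : f = g :=
  Scheme.Modules.hom_ext _ _ fun U ↦ by ext s; exact h U s

theorem comp_app_apply {M N K : X.Modules} (f : M ⟶ N) (g : N ⟶ K) (U : X.Opens) (s : Γ(M, U)) :
    (f ≫ g).app U s = g.app U (f.app U s) := rfl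

/-- A sequence of `𝒪_X`-modules which is injective on sections, and locally exact and locally
surjective on sections. -/
structure LocallyExact (S : ShortComplex X.Modules) : Prop where
  injective : ∀ (U : X.Opens), Function.Injective (S.f.app U)
  exact : ∀ (U : X.Opens) (s : Γ(S.X₂, U)), S.g.app U s = 0 → ∀ x ∈ U, ∃ V : X.Opens, x ∈ V ∧
    ∃ h : V ≤ U, ∃ t : Γ(S.X₁, V), S.f.app V t = res S.X₂ h s
  surjective : ∀ (U : X.Opens) (s : Γ(S.X₃, U)), ∀ x ∈ U, ∃ V : X.Opens, x ∈ V ∧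
    ∃ h : V ≤ U, ∃ t : Γ(S.X₂, V), S.g.app V t = res S.X₃ h s

/-- Local preimages are unique by injectivity of `S.f`, so they agree on overlaps and glue: the
kernel of `S.g` lifts over every open set, not only locally. -/
theorem LocallyExact.exists_eq {S : ShortComplex X.Modules} (hS : LocallyExact S) (U : X.Opens)
    (s : Γ(S.X₂, U)) (hs : S.g.app U s = 0) : ∃ t, S.f.app U t = s := by
  choose V hV hVU t ht using hS.exact U s hs
  obtain ⟨t', ht', -⟩ := glue S.X₁ (fun x : U ↦ V x.1 x.2) (fun x ↦ hVU x.1 x.2)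
    (fun x hx ↦ Opens.mem_iSup.2 ⟨⟨x, hx⟩, hV x hx⟩) (fun x ↦ t x.1 x.2) (fun x y ↦ by
      apply hS.injective
      rw [app_res, app_res, ht, ht, res_res, res_res])
  refine ⟨t', eq_of_local S.X₂ _ _ fun x hx ↦ ⟨V x hx, hV x hx, hVU x hx, ?_⟩⟩
  rw [← app_res, ht' ⟨x, hx⟩, ht]

theorem LocallyExact.shortExact {S : ShortComplex X.Modules} (hS : LocallyExact S) :
    S.ShortExact := by
  have hinj := hS.injective
  have hex := hS.exists_eq
  have hmono : Mono S.f := ⟨fun {Z} a b hab ↦ hom_ext_sections fun U s ↦ hinj U (by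
    rw [← comp_app_apply, hab, comp_app_apply])⟩
  have hepi : Epi S.g := ⟨fun {Z} a b hab ↦ hom_ext_sections fun U s ↦
    eq_of_local Z _ _ fun x hx ↦ by
      obtain ⟨V, hxV, h, t, ht⟩ := hS.surjective U s x hx
      refine ⟨V, hxV, h, ?_⟩
      rw [← app_res, ← app_res, ← ht, ← comp_app_apply, hab, comp_app_apply]⟩
  -- Preimages chosen section by section are automatically additive, linear and compatible with
  -- restriction, since `S.f` is injective on sections.
  have hker : Limits.IsLimit (Limits.KernelFork.ofι S.f S.zero) := by
    refine Limits.KernelFork.IsLimit.ofι' S.f S.zero fun {A} k hk ↦ ?_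
    have hk' : ∀ U (s : Γ(A, U)), S.g.app U (k.app U s) = 0 := fun U s ↦ by
      rw [← comp_app_apply, hk]; rfl
    choose t ht using fun U s ↦ hex U (k.app U s) (hk' U s)
    refine ⟨mkHom (fun U ↦ AddMonoidHom.mk' (t U) fun a b ↦ hinj U ?_) (fun U r s ↦ hinj U ?_)
      (fun {U V} h s ↦ hinj V ?_), hom_ext_sections fun U s ↦ ht U s⟩
    · rw [map_add, ht, ht, ht, map_add]
    · refine (ht U _).trans ?_
      rw [Scheme.Modules.Hom.app_smul, Scheme.Modules.Hom.app_smul]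
      exact congrArg _ (ht U s).symm
    · refine (ht V _).trans ?_
      rw [app_res, app_res]
      exact congrArg _ (ht U s).symm
  exact { exact := S.exact_of_f_is_kernel hker, mono_f := hmono, epi_g := hepi }

/-- A morphism of `𝒪_X`-modules from a functional relation on sections which is local, linear and
locally solvable. -/
theorem exists_hom_of_local {M N : X.Modules} (R : ∀ U : X.Opens, Γ(M, U) → Γ(N, U) → Prop)
    (hres : ∀ {U V : X.Opens} (h : V ≤ U) (s : Γ(M, U)) (t : Γ(N, U)), R U s t →
      R V (res M h s) (res N h t))
    (huniq : ∀ (U : X.Opens) (s : Γ(M, U)) (t t' : Γ(N, U)), R U s t → R U s t' → t = t')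
    (hexists : ∀ (U : X.Opens) (s : Γ(M, U)), ∀ x ∈ U, ∃ V : X.Opens, x ∈ V ∧ ∃ h : V ≤ U,
      ∃ t, R V (res M h s) t)
    (hadd : ∀ (U : X.Opens) (s s' : Γ(M, U)) (t t' : Γ(N, U)), R U s t → R U s' t' →
      R U (s + s') (t + t'))
    (hsmul : ∀ (U : X.Opens) (r : Γ(X, U)) (s : Γ(M, U)) (t : Γ(N, U)), R U s t →
      R U (r • s) (r • t)) :
    ∃ f : M ⟶ N, ∀ (U : X.Opens) (s : Γ(M, U)) (t : Γ(N, U)), R U s t → f.app U s = t := by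
  -- The glued section is characterised by all its related values over smaller open sets; this makes
  -- it independent of the cover, so that every identity below can be checked locally.
  have key : ∀ (U : X.Opens) (s : Γ(M, U)), ∃ t : Γ(N, U), ∀ (V : X.Opens) (h : V ≤ U)
      (t' : Γ(N, V)), R V (res M h s) t' → res N h t = t' := by
    intro U s
    choose V hV hVU t ht using hexists U s
    obtain ⟨t₀, ht₀, -⟩ := glue N (fun x : U ↦ V x.1 x.2) (fun x ↦ hVU x.1 x.2)
      (fun x hx ↦ Opens.mem_iSup.2 ⟨⟨x, hx⟩, hV x hx⟩) (fun x ↦ t x.1 x.2) (fun x y ↦ by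
        refine huniq _ (res M (inf_le_left.trans (hVU x.1 x.2)) s) _ _ ?_ ?_
        · rw [← res_res M (hVU x.1 x.2)]
          exact hres _ _ _ (ht x.1 x.2)
        · rw [← res_res M (hVU y.1 y.2) inf_le_right]
          exact hres _ _ _ (ht y.1 y.2))
    refine ⟨t₀, fun W h t' ht' ↦ eq_of_local N _ _ fun x hx ↦
      ⟨W ⊓ V x (h hx), ⟨hx, hV x (h hx)⟩, inf_le_left, ?_⟩⟩
    refine huniq _ (res M (inf_le_left.trans h) s) _ _ ?_ ?_
    · rw [res_res, ← res_res N (hVU x (h hx)) inf_le_right, ht₀ ⟨x, h hx⟩,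
        ← res_res M (hVU x (h hx)) inf_le_right]
      exact hres _ _ _ (ht x (h hx))
    · rw [← res_res M h inf_le_left]
      exact hres _ _ _ ht'
  choose t ht using key
  have hloc : ∀ (U : X.Opens) (s : Γ(M, U)) (t₁ t₂ : Γ(N, U)),
      (∀ (V : X.Opens) (h : V ≤ U) (t' : Γ(N, V)), R V (res M h s) t' →
        res N h t₁ = t' ∧ res N h t₂ = t') → t₁ = t₂ := by
    intro U s t₁ t₂ H
    refine eq_of_local N _ _ fun x hx ↦ ?_
    obtain ⟨V, hV, h, t', ht'⟩ := hexists U s x hx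
    exact ⟨V, hV, h, (H V h t' ht').1.trans (H V h t' ht').2.symm⟩
  have hcomm : ∀ (U V : X.Opens) (h : V ≤ U) (s : Γ(M, U)), t V (res M h s) = res N h (t U s) := by
    intro U V h s
    refine hloc V (res M h s) _ _ fun W k t' ht' ↦ ⟨ht V _ W k t' ht', ?_⟩
    rw [res_res]
    rw [res_res] at ht'
    exact ht U s W _ t' ht'
  refine ⟨mkHom (fun U ↦ AddMonoidHom.mk' (t U) fun a b ↦ ?_) (fun U r s ↦ ?_)
    (fun {U V} h s ↦ hcomm U V h s), fun U s t' ht' ↦ ?_⟩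
  · refine eq_of_local N _ _ fun x hx ↦ ?_
    obtain ⟨V, hV, h, a', ha'⟩ := hexists U a x hx
    obtain ⟨V', hV', h', b', hb'⟩ := hexists U b x hx
    refine ⟨V ⊓ V', ⟨hV, hV'⟩, inf_le_left.trans h, ?_⟩
    have h₁ := hres (inf_le_left : V ⊓ V' ≤ V) _ _ ha'
    have h₂ := hres (inf_le_right : V ⊓ V' ≤ V') _ _ hb'
    rw [res_res] at h₁ h₂
    rw [map_add, ht U a _ _ _ h₁, ht U b _ _ _ h₂]
    refine ht U (a + b) _ _ _ ?_
    rw [map_add]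
    exact hadd _ _ _ _ _ h₁ h₂
  · refine eq_of_local N _ _ fun x hx ↦ ?_
    obtain ⟨V, hV, h, a', ha'⟩ := hexists U s x hx
    refine ⟨V, hV, h, ?_⟩
    refine (ht U (r • s) V h (resO h r • a') ?_).trans ?_
    · rw [res_smul]
      exact hsmul _ _ _ _ ha'
    · rw [res_smul]
      exact congrArg _ (ht U s V h a' ha').symm
  · have := ht U s U le_rfl t' (by rwa [res_self])
    rwa [res_self] at this

/-- The module `U ↦ Γ(N, U ⊓ V)`: restriction of `N` to the open set `V`, extended by direct
image. -/
def starResData (V : X.Opens) (N : X.Modules) : SheafData X where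
  sec U := Γ(N, U ⊓ V)
  grp U := inferInstance
  mod U := Module.compHom _ (resO (inf_le_left : U ⊓ V ≤ U))
  res h := HitchinSymbol.res N (inf_le_inf_right V h)
  res_self h s := HitchinSymbol.res_self N _ s
  res_res h k s := HitchinSymbol.res_res N _ _ s
  res_smul h f s := (HitchinSymbol.res_smul N (inf_le_inf_right V h) (resO inf_le_left f) s).trans
    (congrArg (· • HitchinSymbol.res N (inf_le_inf_right V h) s)
      ((resO_resO inf_le_left (inf_le_inf_right V h) f).trans (resO_resO h inf_le_left f).symm))
  glue U s H := by
    have hc : iSup U ⊓ V ≤ ⨆ i, U i ⊓ V := by rw [iSup_inf_eq]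
    refine HitchinSymbol.glue N (fun i ↦ U i ⊓ V) (fun i ↦ inf_le_inf_right V (le_iSup U i)) hc s ?_
    intro i j
    have h₁ : (U i ⊓ V) ⊓ (U j ⊓ V) ≤ (U i ⊓ U j) ⊓ V :=
      le_inf (inf_le_inf inf_le_left inf_le_left) (inf_le_left.trans inf_le_right)
    have := congrArg (HitchinSymbol.res N h₁) (H i j)
    rw [HitchinSymbol.res_res, HitchinSymbol.res_res] at this
    exact this

/-- The module `U ↦ Γ(N, U ⊓ V)`. -/
def starRes (V : X.Opens) (N : X.Modules) : X.Modules := (starResData V N).toModules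

/-- A section of `starRes V N` over `U` as a section of `N` over `U ⊓ V`. -/
def starVal {V : X.Opens} {N : X.Modules} {U : X.Opens} : Γ(starRes V N, U) →+ Γ(N, U ⊓ V) :=
  AddMonoidHom.id Γ(N, U ⊓ V)

/-- A section of `N` over `U ⊓ V` as a section of `starRes V N` over `U`. -/
def mkStar {V : X.Opens} {N : X.Modules} {U : X.Opens} : Γ(N, U ⊓ V) →+ Γ(starRes V N, U) :=
  AddMonoidHom.id Γ(N, U ⊓ V)

section

variable {V : X.Opens} {N : X.Modules} {U : X.Opens}

theorem starVal_injective : Function.Injective (starVal (V := V) (N := N) (U := U)) :=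
  fun _ _ h ↦ h

theorem starVal_smul (f : Γ(X, U)) (s : Γ(starRes V N, U)) :
    starVal (f • s) = resO (inf_le_left : U ⊓ V ≤ U) f • starVal s := rfl

theorem starVal_res {W : X.Opens} (h : W ≤ U) (s : Γ(starRes V N, U)) :
    starVal (res (starRes V N) h s) = res N (inf_le_inf_right V h) (starVal s) := rfl

end

/-- Two morphisms from a tensor product that agree on pure tensors are equal. -/
theorem tensor_hom_ext {A B N : X.Modules} {f g : tensor A B ⟶ N}
    (h : ∀ (U : X.Opens) (a : Γ(A, U)) (b : Γ(B, U)), f.app U (tmul a b) = g.app U (tmul a b)) :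
    f = g := by
  -- Under the adjunction both sides become maps from the presheaf tensor product, whose sections
  -- are sums of pure tensors.
  apply (PresheafOfModules.sheafificationHomEquiv (𝟙 X.ringCatSheaf.obj)).injective
  ext U x
  induction x using TensorProduct.induction_on with
  | zero => exact (map_zero _).trans (map_zero _).symm
  | tmul a b => exact h U.unop a b
  | add x y hx hy =>
    refine Eq.trans (map_add _ x y) (Eq.trans (congrArg₂ (· + ·) hx hy) ?_)
    exact (map_add _ x y).symm

end Toolkit

/-! ### Pullback of sections. -/

section Pullback

variable {X Y : Scheme.{u}} (p : X ⟶ Y)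

/-- The pullback of a section along `p`. -/
def pullSec {A : Y.Modules} {U : Y.Opens} (a : Γ(A, U)) :
    Γ((Scheme.Modules.pullback p).obj A, p ⁻¹ᵁ U) :=
  ((Scheme.Modules.pullbackPushforwardAdjunction p).unit.app A).app U a

variable {p}

theorem pullSec_res {A : Y.Modules} {U V : Y.Opens} (h : V ≤ U) (a : Γ(A, U)) :
    pullSec p (res A h a) = res _ (Scheme.Hom.preimage_mono p h) (pullSec p a) :=
  app_res ((Scheme.Modules.pullbackPushforwardAdjunction p).unit.app A) h a

theorem pullSec_add {A : Y.Modules} {U : Y.Opens} (a b : Γ(A, U)) :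
    pullSec p (a + b) = pullSec p a + pullSec p b := 
  map_add (((Scheme.Modules.pullbackPushforwardAdjunction p).unit.app A).app U).hom a b

theorem pullSec_smul {A : Y.Modules} {U : Y.Opens} (f : Γ(Y, U)) (a : Γ(A, U)) :
    pullSec p (f • a) = (p.app U).hom f • pullSec p a :=
  Scheme.Modules.Hom.app_smul ((Scheme.Modules.pullbackPushforwardAdjunction p).unit.app A) f a

/-- Pulling back a section is the unit of the adjunction, so this computes any morphism defined by
adjunction on the sections that determine it. -/
theorem homEquiv_symm_pullSec {A : Y.Modules} {N : X.Modules}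
    (α : A ⟶ (Scheme.Modules.pushforward p).obj N) {U : Y.Opens} (a : Γ(A, U)) :
    (((Scheme.Modules.pullbackPushforwardAdjunction p).homEquiv _ _).symm α).app (p ⁻¹ᵁ U)
      (pullSec p a) = α.app U a := by
  have := ((Scheme.Modules.pullbackPushforwardAdjunction p).homEquiv _ _).apply_symm_apply α
  rw [Adjunction.homEquiv_unit] at this
  exact congrArg (fun φ : A ⟶ (Scheme.Modules.pushforward p).obj N ↦ φ.app U a) this

/-- Two morphisms from a pullback that agree on pullbacks of sections are equal. -/
theorem pullback_hom_ext {A : Y.Modules} {N : X.Modules}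
    {f g : (Scheme.Modules.pullback p).obj A ⟶ N}
    (h : ∀ (U : Y.Opens) (a : Γ(A, U)), f.app (p ⁻¹ᵁ U) (pullSec p a) =
      g.app (p ⁻¹ᵁ U) (pullSec p a)) : f = g := by
  apply ((Scheme.Modules.pullbackPushforwardAdjunction p).homEquiv _ _).injective
  rw [Adjunction.homEquiv_unit, Adjunction.homEquiv_unit]
  exact hom_ext_sections fun U a ↦ h U a

end Pullback

/-! ### Local generators with coordinates. -/

section LocalGen

variable {X : Scheme.{u}}

/-- A function on `U ⊓ V` as a section over `U` of the structure sheaf of `V`. -/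
def starFun {V U : X.Opens} : Γ(starRes V (unitMod X), U) →+ Γ(X, U ⊓ V) :=
  AddMonoidHom.id Γ(X, U ⊓ V)

/-- A section over `U` of the structure sheaf of `V` as a function on `U ⊓ V`. -/
def mkStarFun {V U : X.Opens} : Γ(X, U ⊓ V) →+ Γ(starRes V (unitMod X), U) :=
  AddMonoidHom.id Γ(X, U ⊓ V)

theorem starFun_mkStarFun {V U : X.Opens} (f : Γ(X, U ⊓ V)) : starFun (mkStarFun f) = f := rfl

theorem starFun_injective {V U : X.Opens} : Function.Injective (starFun (V := V) (U := U)) :=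
  fun _ _ h ↦ h

theorem starFun_smul {V U : X.Opens} (f : Γ(X, U)) (s : Γ(starRes V (unitMod X), U)) :
    starFun (f • s) = resO inf_le_left f * starFun s := rfl

theorem starFun_res {V U W : X.Opens} (h : W ≤ U) (s : Γ(starRes V (unitMod X), U)) :
    starFun (res (starRes V (unitMod X)) h s) = resO (inf_le_inf_right V h) (starFun s) := rfl

/-- Sections `gen i` of `M` over `V` together with coordinate functions `coord i` such that each
section of `M` is the combination of the `gen i` given by its coordinates. -/
structure LocalGen (M : X.Modules) (V : X.Opens) (ι : Type) [Fintype ι] where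
  gen : ι → Γ(M, V)
  -- The generators need not be independent: `M` is only exhibited as a direct summand of a free
  -- module over `V`. The coordinates are morphisms of sheaves on the whole of `X`, so that they can
  -- be carried through tensor products and pullbacks by universal properties.
  coord : ι → (M ⟶ starRes V (unitMod X))
  sum_coord : ∀ (U : X.Opens) (s : Γ(M, U)),
    ∑ i, starFun ((coord i).app U s) • res M (inf_le_right : U ⊓ V ≤ V) (gen i) =
      res M inf_le_left s

variable {M N : X.Modules} {V : X.Opens} {ι κ : Type} [Fintype ι] [Fintype κ]

/-- The coordinates of a section over an open subset of `V`. -/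
def LocalGen.repr (G : LocalGen M V ι) (i : ι) {U : X.Opens} (h : U ≤ V) (s : Γ(M, U)) : Γ(X, U) :=
  resO (le_inf le_rfl h) (starFun ((G.coord i).app U s))

theorem LocalGen.sum_repr (G : LocalGen M V ι) {U : X.Opens} (h : U ≤ V) (s : Γ(M, U)) :
    ∑ i, G.repr i h s • res M h (G.gen i) = s := by
  have := congrArg (res M (le_inf le_rfl h)) (G.sum_coord U s)
  rw [map_sum, res_res, res_self] at this
  refine (Finset.sum_congr rfl fun i _ ↦ ?_).trans this
  rw [res_smul, res_res]
  rfl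

theorem LocalGen.repr_smul (G : LocalGen M V ι) (i : ι) {U : X.Opens} (h : U ≤ V) (f : Γ(X, U))
    (s : Γ(M, U)) : G.repr i h (f • s) = f * G.repr i h s := by
  rw [LocalGen.repr, Scheme.Modules.Hom.app_smul, starFun_smul, map_mul, resO_resO, resO_self]
  rfl

theorem LocalGen.repr_zero (G : LocalGen M V ι) (i : ι) {U : X.Opens} (h : U ≤ V) :
    G.repr i h (0 : Γ(M, U)) = 0 := by
  rw [LocalGen.repr, map_zero, map_zero, map_zero]

/-- The combination `∑ i, κ i • m i` of sections over `V`, as a morphism. -/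
def starComb (κ' : ι → (N ⟶ starRes V (unitMod X))) (m : ι → Γ(M, V)) : N ⟶ starRes V M :=
  mkHom (fun U ↦ AddMonoidHom.mk'
      (fun s ↦ mkStar (∑ i, starFun ((κ' i).app U s) • res M inf_le_right (m i)))
      (fun s t ↦ by
        rw [← map_add, ← Finset.sum_add_distrib]
        refine congrArg mkStar (Finset.sum_congr rfl fun i _ ↦ ?_)
        rw [map_add, map_add, add_smul]))
    (fun U r s ↦ starVal_injective <| by
      rw [starVal_smul]
      change ∑ i, starFun ((κ' i).app U (r • s)) • res M inf_le_right (m i) =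
        resO inf_le_left r • ∑ i, starFun ((κ' i).app U s) • res M inf_le_right (m i)
      rw [Finset.smul_sum]
      refine Finset.sum_congr rfl fun i _ ↦ ?_
      rw [Scheme.Modules.Hom.app_smul, starFun_smul, mul_smul])
    (fun {U W} h s ↦ starVal_injective <| by
      rw [starVal_res]
      change ∑ i, starFun ((κ' i).app W (res N h s)) • res M inf_le_right (m i) =
        res M _ (∑ i, starFun ((κ' i).app U s) • res M inf_le_right (m i))
      rw [map_sum]
      refine Finset.sum_congr rfl fun i _ ↦ ?_
      rw [app_res, starFun_res, res_smul, res_res])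

theorem starVal_starComb (κ' : ι → (N ⟶ starRes V (unitMod X))) (m : ι → Γ(M, V)) (U : X.Opens)
    (s : Γ(N, U)) : starVal ((starComb κ' m).app U s) =
      ∑ i, starFun ((κ' i).app U s) • res M inf_le_right (m i) := rfl

/-- The restriction `M → starRes V M`. -/
def toStar (V : X.Opens) (M : X.Modules) : M ⟶ starRes V M :=
  mkHom (fun U ↦ (mkStar (V := V)).comp (res M inf_le_left))
    (fun U r s ↦ starVal_injective (res_smul M inf_le_left r s))
    (fun {U W} h s ↦ starVal_injective <| by
      rw [starVal_res]
      change res M _ (res M h s) = res M _ (res M _ s)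
      rw [res_res, res_res])

theorem starVal_toStar (U : X.Opens) (s : Γ(M, U)) :
    starVal ((toStar V M).app U s) = res M inf_le_left s := rfl

/-- Local generators from generators and coordinates whose combination is the restriction. -/
def LocalGen.ofComb (gen : ι → Γ(M, V)) (coord : ι → (M ⟶ starRes V (unitMod X)))
    (h : starComb coord gen = toStar V M) : LocalGen M V ι where
  gen := gen
  coord := coord
  sum_coord U s := by
    rw [← starVal_starComb, h, starVal_toStar]

/-- The structure sheaf is generated by `1`. -/
def LocalGen.unit (V : X.Opens) : LocalGen (unitMod X) V Unit where
  gen _ := (1 : Γ(X, V))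
  coord _ := toStar V (unitMod X)
  sum_coord U s := by
    rw [Finset.univ_unique, Finset.sum_singleton]
    exact (congrArg (resO (V := U ⊓ V) inf_le_left (show Γ(X, U) from s) * ·)
      (map_one (resO _))).trans (mul_one _)

/-- The product of two local functions on sections, as a morphism from the tensor product. -/
def tensorCoord {A B : X.Modules} (α : A ⟶ starRes V (unitMod X)) (β : B ⟶ starRes V (unitMod X)) :
    tensor A B ⟶ starRes V (unitMod X) :=
  lift (fun U ↦ LinearMap.mk₂ Γ(X, U)
      (fun a b ↦ mkStarFun (starFun (α.app U a) * starFun (β.app U b)))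
      (fun a a' b ↦ starFun_injective <| by
        rw [map_add, map_add, starFun_mkStarFun, map_add, add_mul]; rfl)
      (fun f a b ↦ starFun_injective <| by
        rw [Scheme.Modules.Hom.app_smul, starFun_smul, starFun_smul, starFun_mkStarFun,
          starFun_mkStarFun, mul_assoc])
      (fun a b b' ↦ starFun_injective <| by
        rw [map_add, map_add, starFun_mkStarFun, map_add, mul_add]; rfl)
      (fun f a b ↦ starFun_injective <| by
        rw [Scheme.Modules.Hom.app_smul, starFun_smul, starFun_smul, starFun_mkStarFun,
          starFun_mkStarFun, mul_left_comm]))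
    (fun h a b ↦ starFun_injective <| by
      rw [LinearMap.mk₂_apply, LinearMap.mk₂_apply, app_res, app_res,
        starFun_mkStarFun, starFun_res, starFun_res, starFun_res, starFun_mkStarFun, map_mul])

theorem starFun_tensorCoord {A B : X.Modules} (α : A ⟶ starRes V (unitMod X))
    (β : B ⟶ starRes V (unitMod X)) (U : X.Opens) (a : Γ(A, U)) (b : Γ(B, U)) :
    starFun ((tensorCoord α β).app U (tmul a b)) = starFun (α.app U a) * starFun (β.app U b) :=
  congrArg starFun (lift_tmul _ _ a b)

theorem sum_tmul {A B : X.Modules} {U : X.Opens} (a : ι → Γ(A, U)) (b : Γ(B, U)) :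
    tmul (∑ i, a i) b = ∑ i, tmul (a i) b :=
  map_sum (AddMonoidHom.mk' (fun a : Γ(A, U) ↦ tmul a b) fun a a' ↦ add_tmul a a' b) a _

theorem tmul_sum {A B : X.Modules} {U : X.Opens} (a : Γ(A, U)) (b : ι → Γ(B, U)) :
    tmul a (∑ i, b i) = ∑ i, tmul a (b i) :=
  map_sum (AddMonoidHom.mk' (fun b : Γ(B, U) ↦ tmul a b) fun b b' ↦ tmul_add a b b') b _

/-- Local generators of a tensor product. -/
def LocalGen.tensor {A B : X.Modules} (G : LocalGen A V ι) (H : LocalGen B V κ) :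
    LocalGen (tensor A B) V (ι × κ) :=
  LocalGen.ofComb (fun k ↦ tmul (G.gen k.1) (H.gen k.2))
    (fun k ↦ tensorCoord (G.coord k.1) (H.coord k.2))
    -- A section of the tensor product need not be a sum of pure tensors, but an equality of
    -- morphisms can be tested on these.
    (tensor_hom_ext fun U a b ↦ starVal_injective <| by
      rw [starVal_toStar, starVal_starComb, res_tmul, ← G.sum_coord, ← H.sum_coord, sum_tmul,
        Fintype.sum_prod_type]
      refine Finset.sum_congr rfl fun i _ ↦ ?_
      rw [tmul_sum]
      refine Finset.sum_congr rfl fun j _ ↦ ?_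
      rw [starFun_tensorCoord, res_tmul, smul_tmul', tmul_smul, mul_smul])

end LocalGen

/-! ### Local generators of a pullback. -/

section PullbackGen

variable {X Y : Scheme.{u}} (p : X ⟶ Y) {V : Y.Opens} {V' : X.Opens}

/-- The pullback of functions `𝒪_V → p_* 𝒪_{V'}` for `V' ≤ p⁻¹ V`. -/
def starPull (hV : V' ≤ p ⁻¹ᵁ V) : starRes V (unitMod Y) ⟶
    (Scheme.Modules.pushforward p).obj (starRes V' (unitMod X)) :=
  mkHom (M := starRes V (unitMod Y))
    (N := (Scheme.Modules.pushforward p).obj (starRes V' (unitMod X)))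
    (fun U ↦ (mkStarFun (V := V') (U := p ⁻¹ᵁ U)).comp
      ((((p.appLE (U ⊓ V) (p ⁻¹ᵁ U ⊓ V') (inf_le_inf_left _ hV)).hom :
        Γ(Y, U ⊓ V) →+ Γ(X, p ⁻¹ᵁ U ⊓ V'))).comp starFun))
    (fun U r s ↦ by
      refine starFun_injective (V := V') (U := p ⁻¹ᵁ U) ?_
      change (p.appLE (U ⊓ V) (p ⁻¹ᵁ U ⊓ V') _).hom (starFun (r • s)) =
        (resO (V := p ⁻¹ᵁ U ⊓ V') inf_le_left ((p.app U).hom r) : Γ(X, p ⁻¹ᵁ U ⊓ V')) *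
          (p.appLE (U ⊓ V) (p ⁻¹ᵁ U ⊓ V') _).hom (starFun s)
      rw [starFun_smul, map_mul]
      refine congrArg (· * _) ?_
      exact ConcreteCategory.congr_hom
        (p.map_appLE (inf_le_inf_left _ hV) (homOfLE inf_le_left).op) r)
    (fun {U W} h s ↦ ConcreteCategory.congr_hom
      ((p.map_appLE (inf_le_inf_left (p ⁻¹ᵁ W) hV) (homOfLE (inf_le_inf_right V h)).op).trans
        (p.appLE_map (inf_le_inf_left (p ⁻¹ᵁ U) hV) (homOfLE (inf_le_inf_right V'
          (Scheme.Hom.preimage_mono p h))).op).symm) (starFun s))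

theorem starFun_starPull (hV : V' ≤ p ⁻¹ᵁ V) {U : Y.Opens} (s : Γ(starRes V (unitMod Y), U)) :
    starFun (V := V') (U := p ⁻¹ᵁ U) ((starPull p hV).app U s) =
      (p.appLE (U ⊓ V) (p ⁻¹ᵁ U ⊓ V') (inf_le_inf_left _ hV)).hom (starFun s) := rfl

/-- The pullback of a local function on sections. -/
def pullCoord (hV : V' ≤ p ⁻¹ᵁ V) {A : Y.Modules} (α : A ⟶ starRes V (unitMod Y)) :
    (Scheme.Modules.pullback p).obj A ⟶ starRes V' (unitMod X) :=
  ((Scheme.Modules.pullbackPushforwardAdjunction p).homEquiv _ _).symm (α ≫ starPull p hV)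

theorem starFun_pullCoord (hV : V' ≤ p ⁻¹ᵁ V) {A : Y.Modules} (α : A ⟶ starRes V (unitMod Y))
    {U : Y.Opens} (a : Γ(A, U)) :
    starFun ((pullCoord p hV α).app (p ⁻¹ᵁ U) (pullSec p a)) =
      (p.appLE (U ⊓ V) (p ⁻¹ᵁ U ⊓ V') (inf_le_inf_left _ hV)).hom (starFun (α.app U a)) :=
  congrArg starFun (homEquiv_symm_pullSec (α ≫ starPull p hV) a)

theorem pullSec_sum {ι : Type} [Fintype ι] {A : Y.Modules} {U : Y.Opens} (a : ι → Γ(A, U)) :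
    pullSec p (∑ i, a i) = ∑ i, pullSec p (a i) :=
  map_sum (AddMonoidHom.mk' (fun a : Γ(A, U) ↦ pullSec p a) fun a b ↦ pullSec_add a b) a _

theorem res_appLE {Z : Scheme.{u}} {q : Z ⟶ Y} {U : Y.Opens} {W W' : Z.Opens} (h : W ≤ q ⁻¹ᵁ U)
    (k : W' ≤ W) (f : Γ(Y, U)) :
    resO k ((q.appLE U W h).hom f) = (q.appLE U W' (k.trans h)).hom f :=
  ConcreteCategory.congr_hom (q.appLE_map h (homOfLE k).op) f

theorem appLE_resO {Z : Scheme.{u}} {q : Z ⟶ Y} {U U' : Y.Opens} {W : Z.Opens} (h : W ≤ q ⁻¹ᵁ U')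
    (k : U' ≤ U) (f : Γ(Y, U)) :
    (q.appLE U' W h).hom (resO k f) = (q.appLE U W (h.trans (q.preimage_mono k))).hom f :=
  ConcreteCategory.congr_hom (q.map_appLE h (homOfLE k).op) f

/-- Local generators of a pullback. -/
def LocalGen.pullback (hV : V' ≤ p ⁻¹ᵁ V) {ι : Type} [Fintype ι] {A : Y.Modules}
    (G : LocalGen A V ι) : LocalGen ((Scheme.Modules.pullback p).obj A) V' ι :=
  LocalGen.ofComb (fun i ↦ res _ hV (pullSec p (G.gen i))) (fun i ↦ pullCoord p hV (G.coord i))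
    (pullback_hom_ext fun U a ↦ starVal_injective <| by
      have h₁ : p ⁻¹ᵁ U ⊓ V' ≤ p ⁻¹ᵁ (U ⊓ V) := inf_le_inf_left _ hV
      rw [starVal_toStar, starVal_starComb]
      have h₂ := congrArg (res _ h₁) (congrArg (pullSec p) (G.sum_coord U a))
      rw [pullSec_res, res_res] at h₂
      refine Eq.trans ?_ h₂
      rw [pullSec_sum, map_sum]
      refine Finset.sum_congr rfl fun i _ ↦ ?_
      rw [starFun_pullCoord, pullSec_smul, pullSec_res, res_smul, res_res, res_res]
      refine congrArg (· • _) ?_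
      rw [← Scheme.Hom.appLE_eq_app, res_appLE])

end PullbackGen

/-! ### The diagonal of an algebra étale over a polynomial ring in one variable. -/

section EtaleCoordinate

open TensorProduct

variable {R B : Type u} [CommRing R] [CommRing B] [Algebra R B]

/-- The difference `1 ⊗ x - x ⊗ 1`. -/
def tensorDiff (R : Type u) {B : Type u} [CommRing R] [CommRing B] [Algebra R B] (x : B) :
    B ⊗[R] B := 1 ⊗ₜ[R] x - x ⊗ₜ[R] 1

/-- With x the image of the variable, the element is the image under `B ⊗ g` of X - x in B[X] = B ⊗
R[X]. A monic polynomial is a nonzerodivisor, and multiplication by it stays injective on the flat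
algebra B ⊗ B. -/
theorem tensorDiff_mem_nonZeroDivisors (g : MvPolynomial (Fin 1) R →ₐ[R] B)
    (hg : g.toRingHom.Flat) : tensorDiff R (g (MvPolynomial.X 0)) ∈ nonZeroDivisors (B ⊗[R] B) := by
  let φ : B ⊗[R] MvPolynomial (Fin 1) R →ₐ[R] B ⊗[R] B :=
    (Algebra.TensorProduct.lTensor (S := R) B g)
  have hφ : φ.toRingHom.Flat := RingHom.Flat.lTensor (S := R) B (f := g) hg
  let z : B ⊗[R] MvPolynomial (Fin 1) R :=
    1 ⊗ₜ MvPolynomial.X 0 - g (MvPolynomial.X 0) ⊗ₜ 1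
  have hz : z ∈ nonZeroDivisors (B ⊗[R] MvPolynomial (Fin 1) R) := by
    let e := (MvPolynomial.algebraTensorAlgEquiv (σ := Fin 1) R B).trans
      (MvPolynomial.uniqueAlgEquiv B (Fin 1))
    have hez : e z = Polynomial.X - Polynomial.C (g (MvPolynomial.X 0)) := by
      have h₁ : e (1 ⊗ₜ MvPolynomial.X 0) = Polynomial.X := by
        simp [e, MvPolynomial.uniqueAlgEquiv]
      have h₂ : e (g (MvPolynomial.X 0) ⊗ₜ 1) = Polynomial.C (g (MvPolynomial.X 0)) := by
        simp only [e, AlgEquiv.trans_apply, MvPolynomial.algebraTensorAlgEquiv_tmul, map_one,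
          map_smul, Polynomial.smul_eq_C_mul, mul_one]
      rw [map_sub, h₁, h₂]
    have hreg : e z ∈ nonZeroDivisors (Polynomial B) := by
      rw [hez]
      exact (Polynomial.monic_X_sub_C _).mem_nonZeroDivisors
    rw [mem_nonZeroDivisors_iff_right] at hreg ⊢
    intro c hc
    exact e.injective ((hreg (e c) (by rw [← map_mul, hc, map_zero])).trans (map_zero e).symm)
  have hφz : φ z = tensorDiff R (g (MvPolynomial.X 0)) := by
    simp [φ, z, tensorDiff]
  let := φ.toRingHom.toAlgebra
  have : Module.Flat (B ⊗[R] MvPolynomial (Fin 1) R) (B ⊗[R] B) := hφ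
  have := Module.Flat.isSMulRegular_of_nonZeroDivisors (M := B ⊗[R] B) hz
  rw [mem_nonZeroDivisors_iff_right]
  intro c hc
  refine this ?_
  change φ z * c = φ z * 0
  rw [hφz, mul_comm, hc, mul_zero]

/-- Let I be the ideal of the diagonal, t the difference of the coordinate and J = (t) + I². The two
maps from B to (B ⊗ B)/J agree on R[X] and modulo the square-zero image of I, hence are equal
because B is unramified over R[X]. So I = (t) + I², and Nakayama for the finitely generated ideal I
gives h in 1 + I with hI ⊆ (t). -/
theorem exists_smul_ideal_le (g : MvPolynomial (Fin 1) R →ₐ[R] B) (hg : g.toRingHom.Etale) :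
    ∃ h : B ⊗[R] B, h - 1 ∈ KaehlerDifferential.ideal R B ∧
      ∀ b ∈ KaehlerDifferential.ideal R B, ∃ c,
        h * b = c * tensorDiff R (g (MvPolynomial.X 0)) := by
  let := g.toRingHom.toAlgebra
  have : IsScalarTower R (MvPolynomial (Fin 1) R) B := .of_algHom g
  have : Algebra.Etale (MvPolynomial (Fin 1) R) B := hg
  have : Algebra.FiniteType R B := .trans (S := MvPolynomial (Fin 1) R) inferInstance inferInstance
  let I := KaehlerDifferential.ideal R B
  let t := tensorDiff R (g (MvPolynomial.X 0))
  let J : Ideal (B ⊗[R] B) := Ideal.span {t} ⊔ I • I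
  have hJI : J ≤ I := by
    refine sup_le ((Ideal.span_singleton_le_iff_mem _).2 ?_) Ideal.mul_le_left
    exact KaehlerDifferential.one_smul_sub_smul_one_mem_ideal R _
  have hIJ : I ≤ J := by
    let q := Ideal.Quotient.mk J
    let i₁ : B →+* (B ⊗[R] B) ⧸ J := q.comp Algebra.TensorProduct.includeLeftRingHom
    let i₂ : B →+* (B ⊗[R] B) ⧸ J := q.comp
      (Algebra.TensorProduct.includeRight (R := R) (A := B) (B := B)).toRingHom
    let := (i₁.comp g.toRingHom).toAlgebra
    -- On constants because the tensor product is over R, on the variable because t lies in J.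
    have hag : i₁.comp g.toRingHom = i₂.comp g.toRingHom := by
      refine MvPolynomial.ringHom_ext (fun r ↦ ?_) (fun j ↦ ?_)
      · change q (g (MvPolynomial.C r) ⊗ₜ[R] 1) = q (1 ⊗ₜ[R] g (MvPolynomial.C r))
        have : g (MvPolynomial.C r) = algebraMap R B r := g.commutes r
        rw [this, Algebra.algebraMap_eq_smul_one, TensorProduct.smul_tmul]
      · rw [Subsingleton.elim j 0]
        refine (Ideal.Quotient.eq.2 ?_).symm
        exact Ideal.mem_sup_left (Ideal.mem_span_singleton_self _)
    let f₁ : B →ₐ[MvPolynomial (Fin 1) R] (B ⊗[R] B) ⧸ J := ⟨i₁, fun _ ↦ rfl⟩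
    let f₂ : B →ₐ[MvPolynomial (Fin 1) R] (B ⊗[R] B) ⧸ J :=
      ⟨i₂, fun p ↦ (RingHom.congr_fun hag p).symm⟩
    have hnil : IsNilpotent (I.map q) := by
      refine ⟨2, ?_⟩
      rw [← Ideal.map_pow, Ideal.zero_eq_bot, Ideal.map_eq_bot_iff_le_ker, Ideal.mk_ker, pow_two]
      exact le_sup_right
    have hff : f₁ = f₂ := Algebra.FormallyUnramified.ext _ hnil fun b ↦ by
      refine (Ideal.Quotient.eq.2 ?_).symm
      change q _ - q _ ∈ _
      rw [← map_sub]
      exact Ideal.mem_map_of_mem q (KaehlerDifferential.one_smul_sub_smul_one_mem_ideal R b)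
    change KaehlerDifferential.ideal R B ≤ J
    rw [← KaehlerDifferential.span_range_eq_ideal, Ideal.span_le]
    rintro _ ⟨b, rfl⟩
    exact Ideal.Quotient.eq.1 (DFunLike.congr_fun hff b).symm
  -- Nakayama's lemma in the form with an element congruent to 1 modulo I.
  obtain ⟨h, hh, hle⟩ := Submodule.exists_sub_one_mem_and_smul_le_of_fg_of_le_sup
    (I := I) (N := Ideal.span {t}) (N' := I) (P := I) (KaehlerDifferential.ideal_fg R B) le_rfl hIJ
  refine ⟨h, hh, fun b hb ↦ ?_⟩
  obtain ⟨c, hc⟩ := Ideal.mem_span_singleton'.1 (hle (Submodule.smul_mem_pointwise_smul b h I hb))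
  exact ⟨c, hc.symm⟩

end EtaleCoordinate

/-! ### Derivations that kill a coordinate. -/

section Derivation

variable {R B : Type u} [CommRing R] [CommRing B]

/-- A derivation killing the constants and a coordinate vanishes. -/
theorem eq_zero_of_leibniz {M : Type u} [AddCommGroup M] [Module B M]
    (g : MvPolynomial (Fin 1) R →+* B) (hg : g.FormallyUnramified) (D : B →+ M)
    (hD : ∀ a b, D (a * b) = a • D b + b • D a) (hC : ∀ r, D (g (MvPolynomial.C r)) = 0)
    (hX : D (g (MvPolynomial.X 0)) = 0) (b : B) : D b = 0 := by
  let := g.toAlgebra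
  have : Algebra.FormallyUnramified (MvPolynomial (Fin 1) R) B := hg
  let : Module (MvPolynomial (Fin 1) R) M := Module.compHom M g
  have : IsScalarTower (MvPolynomial (Fin 1) R) B M := ⟨fun p b m ↦ mul_smul (g p) b m⟩
  -- Vanishing on the constants and on the variable propagates to all polynomials; `D` is then
  -- linear over the polynomial ring, where the module of differentials of B is zero.
  have hg0 : ∀ p, D (g p) = 0 := by
    intro p
    induction p using MvPolynomial.induction_on with
    | C r => exact hC r
    | add p q hp hq => rw [map_add, map_add, hp, hq, add_zero]
    | mul_X p i hp =>
      rw [map_mul, hD, hp, Subsingleton.elim i 0, hX, smul_zero, smul_zero, add_zero]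
  have hlin : ∀ (p : MvPolynomial (Fin 1) R) (b : B), D (g p * b) = g p • D b := fun p b ↦ by
    rw [hD, hg0, smul_zero, add_zero]
  let D' : Derivation (MvPolynomial (Fin 1) R) B M :=
    Derivation.mk' { D with map_smul' := hlin } hD
  have : D' = 0 := by
    rw [← D'.liftKaehlerDifferential_comp, Subsingleton.elim D'.liftKaehlerDifferential 0]
    rfl
  exact DFunLike.congr_fun this b

end Derivation

/-! ### The same facts for an abstract pushout of rings. -/

section PushoutCoordinate

open TensorProduct

variable {R B T : CommRingCat.{u}} {f : R ⟶ B} {i₁ i₂ : B ⟶ T}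

theorem exists_ringEquiv_of_isPushout (H : IsPushout f f i₁ i₂) :
    letI := f.hom.toAlgebra
    ∃ e : B ⊗[R] B ≃+* T, (∀ b, e (b ⊗ₜ 1) = i₁.hom b) ∧ ∀ b, e (1 ⊗ₜ b) = i₂.hom b := by
  let := f.hom.toAlgebra
  have H' : IsPushout f f (CommRingCat.ofHom Algebra.TensorProduct.includeLeftRingHom)
      (CommRingCat.ofHom (Algebra.TensorProduct.includeRight (R := R) (A := B) (B := B)).toRingHom) :=
    CommRingCat.isPushout_tensorProduct R B B
  let e := H'.isoIsPushout _ _ H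
  refine ⟨e.commRingCatIsoToRingEquiv, fun b ↦ ?_, fun b ↦ ?_⟩
  · exact ConcreteCategory.congr_hom (H'.inl_isoIsPushout_hom _ _ H) b
  · exact ConcreteCategory.congr_hom (H'.inr_isoIsPushout_hom _ _ H) b

theorem sub_mem_nonZeroDivisors_of_isPushout (H : IsPushout f f i₁ i₂)
    (g : MvPolynomial (Fin 1) R →+* B) (hC : g.comp MvPolynomial.C = f.hom) (hg : g.Flat) :
    i₂.hom (g (MvPolynomial.X 0)) - i₁.hom (g (MvPolynomial.X 0)) ∈ nonZeroDivisors T := by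
  let := f.hom.toAlgebra
  obtain ⟨e, h₁, h₂⟩ := exists_ringEquiv_of_isPushout H
  let g' : MvPolynomial (Fin 1) R →ₐ[R] B := ⟨g, fun r ↦ RingHom.congr_fun hC r⟩
  have ht := tensorDiff_mem_nonZeroDivisors g' hg
  rw [← h₁, ← h₂, ← map_sub]
  rw [mem_nonZeroDivisors_iff_right] at ht ⊢
  intro c hc
  refine e.symm.injective ((ht _ ?_).trans (map_zero _).symm)
  apply e.injective
  rw [map_mul, e.apply_symm_apply, map_zero]
  exact hc

/-- A map μ that equalises the two inclusions is multiplication B ⊗ B → B followed by `i₁ ≫ μ`. If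
the latter is injective, the kernel of μ is the ideal of the diagonal, and `exists_smul_ideal_le`
applies. The element h does not depend on μ. -/
theorem exists_mul_ker_of_isPushout (H : IsPushout f f i₁ i₂)
    (g : MvPolynomial (Fin 1) R →+* B) (hC : g.comp MvPolynomial.C = f.hom) (hg : g.Etale) :
    ∃ h : T, ∀ {B' : CommRingCat.{u}} (μ : T ⟶ B'), i₁ ≫ μ = i₂ ≫ μ → μ.hom h = 1 ∧
      (Function.Injective (i₁ ≫ μ).hom → ∀ b, μ.hom b = 0 → ∃ c, h * b =
        c * (i₂.hom (g (MvPolynomial.X 0)) - i₁.hom (g (MvPolynomial.X 0)))) := by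
  let := f.hom.toAlgebra
  obtain ⟨e, h₁, h₂⟩ := exists_ringEquiv_of_isPushout H
  let g' : MvPolynomial (Fin 1) R →ₐ[R] B := ⟨g, fun r ↦ RingHom.congr_fun hC r⟩
  obtain ⟨h, hh, hI⟩ := exists_smul_ideal_le g' hg
  refine ⟨e h, fun {B'} μ hμ ↦ ?_⟩
  have hfac : μ.hom.comp e.toRingHom =
      (i₁ ≫ μ).hom.comp (Algebra.TensorProduct.lmul' R (S := B)).toRingHom := by
    refine RingHom.ext fun z ↦ ?_
    induction z using TensorProduct.induction_on with
    | zero => rw [map_zero, map_zero]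
    | tmul a b =>
      have : a ⊗ₜ[R] b = (a ⊗ₜ 1) * (1 ⊗ₜ b) := by
        rw [Algebra.TensorProduct.tmul_mul_tmul, mul_one, one_mul]
      rw [this, map_mul]
      change μ.hom (e (a ⊗ₜ 1)) * μ.hom (e (1 ⊗ₜ b)) =
        μ.hom (i₁.hom (Algebra.TensorProduct.lmul' R (S := B) (a ⊗ₜ 1 * 1 ⊗ₜ b)))
      rw [h₁, h₂, Algebra.TensorProduct.tmul_mul_tmul, mul_one, one_mul,
        Algebra.TensorProduct.lmul'_apply_tmul, map_mul, map_mul]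
      refine congrArg (_ * ·) ?_
      exact (ConcreteCategory.congr_hom hμ b).symm
    | add x y hx hy => rw [map_add, map_add, hx, hy]
  have hfac' : ∀ z, μ.hom (e z) = (i₁ ≫ μ).hom (Algebra.TensorProduct.lmul' R (S := B) z) :=
    fun z ↦ RingHom.congr_fun hfac z
  constructor
  · have : Algebra.TensorProduct.lmul' R (S := B) h = 1 := by
      have h0 : Algebra.TensorProduct.lmul' R (S := B) (h - 1) = 0 := hh
      rwa [map_sub, map_one, sub_eq_zero] at h0
    rw [hfac', this, map_one]
  · intro hinj b hb
    obtain ⟨c, hc⟩ := hI (e.symm b) (by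
      change Algebra.TensorProduct.lmul' R (S := B) (e.symm b) = 0
      apply hinj
      rw [← hfac', e.apply_symm_apply, hb, map_zero])
    refine ⟨e c, ?_⟩
    have := congrArg e hc
    rw [map_mul, map_mul, e.apply_symm_apply] at this
    rw [this, ← h₁, ← h₂, ← map_sub]
    rfl

end PushoutCoordinate

/-! ### Coordinates on the curve and the ideal of the diagonal. -/

section Coordinate

variable {C S : Scheme.{u}} {π : C ⟶ S}

theorem diag_preimage_around (W : (square π).Opens) {V : C.Opens} (h : V ≤ diag π ⁻¹ᵁ W) :
    diag π ⁻¹ᵁ around W V = V :=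
  le_antisymm (diag_around_le W V) (le_around h)

/-- For `V` lying over `U`, the open set `around ⊤ V` is the fibre product of `V` with itself over
`U`. -/
theorem isAffineOpen_around {U : S.Opens} {V : C.Opens} (hU : IsAffineOpen U) (hV : IsAffineOpen V)
    (e : V ≤ π ⁻¹ᵁ U) : IsAffineOpen (around (π := π) ⊤ V) := by
  have : IsAffine _ := hU
  have : IsAffine _ := hV
  exact .of_isIso (Scheme.Hom.isPullback_resLE (IsPullback.of_hasPullback π π) e e
    (UY := around ⊤ V) (top_inf_eq _)).isoPullback.hom

theorem isPushout_around {U : S.Opens} {V : C.Opens} (hU : IsAffineOpen U) (hV : IsAffineOpen V)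
    (e : V ≤ π ⁻¹ᵁ U) : IsPushout (π.appLE U V e) (π.appLE U V e)
      ((p₁ π).appLE V (around ⊤ V) (around_le₁ ⊤ V))
      ((p₂ π).appLE V (around ⊤ V) (around_le₂ ⊤ V)) :=
  (isIso_pushoutSection_iff (IsPullback.of_hasPullback π π) e e
    (UY := around ⊤ V) (top_inf_eq _)).1 (isIso_pushoutSection_of_isAffineOpen _ e e _ hU hV hV)

/-- The function `x` on `V` is a coordinate of `C` over `S`, such that near the diagonal, in `W₀`,
the function `p₂^* x - p₁^* x` is a regular generator of the ideal of the diagonal. -/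
structure IsCoordinate (π : C ⟶ S) {V : C.Opens} (x : Γ(C, V)) (W₀ : (square π).Opens) : Prop where
  le : W₀ ≤ around ⊤ V
  der_eq_zero : ∀ {N : C.Modules} {U : C.Opens} (h : U ≤ V) (D : Γ(derSheaf π N, U)),
    derApp D le_rfl (resO h x) = 0 → D = 0
  exists_eq_mul : ∀ {W : (square π).Opens} (h : W ≤ W₀) (f : Γ(square π, W)), diagFun f = 0 →
    ∃ c, f = c * resO (h.trans le) (idealVal (diff ⊤ x))
  eq_zero_of_mul : ∀ {W : (square π).Opens} (h : W ≤ W₀) (c : Γ(square π, W)),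
    c * resO (h.trans le) (idealVal (diff ⊤ x)) = 0 → c = 0

/-- `N` is an arbitrary module, so vanishing over the affine open `V` does not pass formally to
smaller open sets. On a basic open set of `V`, the derivation composed with restriction from `V`
kills the base and the coordinate, hence all functions on `V`; every other function is a fraction of
these. -/
theorem der_eq_zero_of_coordinate {U : S.Opens} {V : C.Opens} (hV : IsAffineOpen V)
    (e : V ≤ π ⁻¹ᵁ U) (g : MvPolynomial (Fin 1) Γ(S, U) →+* Γ(C, V))
    (hC : g.comp MvPolynomial.C = (π.appLE U V e).hom) (hg : g.FormallyUnramified)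
    {N : C.Modules} {U' : C.Opens} (h : U' ≤ V) (D : Γ(derSheaf π N, U'))
    (hD : derApp D le_rfl (resO h (g (MvPolynomial.X 0))) = 0) : D = 0 := by
  refine der_ext fun V' hV' f ↦ eq_of_local N _ _ fun z hz ↦ ?_
  obtain ⟨b, hb, hzb⟩ := hV.exists_basicOpen_le ⟨z, hz⟩ (h (hV' hz))
  have hbV : C.basicOpen b ≤ V := C.basicOpen_le b
  have hbU : C.basicOpen b ≤ U' := hb.trans hV'
  refine ⟨C.basicOpen b, hzb, hb, ?_⟩
  have key : ∀ a : Γ(C, V), derApp D hbU (resO hbV a) = 0 := by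
    let _ : Module Γ(C, V) Γ(N, C.basicOpen b) := Module.compHom _ (resO hbV)
    refine eq_zero_of_leibniz g hg ((derApp D hbU).comp (resO hbV : Γ(C, V) →+ _)) ?_ ?_ ?_
    · intro a a'
      change derApp D hbU (resO hbV (a * a')) = resO hbV a • _ + resO hbV a' • _
      rw [map_mul, derApp_mul]
      rfl
    · intro r
      change derApp D hbU (resO hbV ((g.comp MvPolynomial.C) r)) = 0
      rw [hC]
      refine Eq.trans ?_ (derApp_base D hbU U (hbV.trans e) r)
      exact congrArg (derApp D hbU) (ConcreteCategory.congr_hom (π.appLE_map e (homOfLE hbV).op) r)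
    · change derApp D hbU (resO hbV (g (MvPolynomial.X 0))) = 0
      have := congrArg (res N hbU) hD
      rw [← derApp_nat D le_rfl hbU, resO_resO, map_zero] at this
      exact this
  rw [← derApp_nat D hV' hb, ← derApp_nat _ hV' hb]
  change derApp D hbU _ = 0
  -- After multiplication by a power of `b` the function extends to `V`; the Leibniz rule kills the
  -- product and the power, and the power is a unit.
  obtain ⟨n, y, hy⟩ := exists_eq_pow_mul_of_isAffineOpen C V hV b (resO hb f)
  change resO hbV y = (resO hbV b) ^ n * resO hb f at hy
  have hunit : IsUnit ((resO hbV b) ^ n) :=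
    IsUnit.pow n (RingedSpace.isUnit_res_basicOpen C.toRingedSpace b)
  have h₁ := key y
  rw [hy, derApp_mul, ← map_pow, key, smul_zero, add_zero, map_pow] at h₁
  exact (IsUnit.smul_eq_zero hunit).1 h₁

/-- A smooth curve is locally étale over the affine line. `W₀` is the locus in V ×_U V where the
Nakayama element `h` is invertible; it contains the diagonal of `V`, since `h` restricts to 1 there.
The algebraic statements on V ×_U V are then spread to all open subsets by localisation. -/
theorem exists_coordinate [SmoothOfRelativeDimension 1 π] (y : C) :
    ∃ (V : C.Opens) (x : Γ(C, V)) (W₀ : (square π).Opens), y ∈ V ∧ diag π y ∈ W₀ ∧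
      IsCoordinate π x W₀ := by
  obtain ⟨U, hU, V, hV, hy, e, hst⟩ :=
    SmoothOfRelativeDimension.exists_isStandardSmoothOfRelativeDimension (n := 1) (f := π) y
  obtain ⟨g, hC, hg⟩ := hst.exists_etale_mvPolynomial
  have hpush := isPushout_around hU hV e
  have haff := isAffineOpen_around hU hV e
  have hflat : g.Flat := (RingHom.Etale.iff_flat_and_formallyUnramified.1 hg).1
  obtain ⟨h, hh⟩ := exists_mul_ker_of_isPushout hpush g hC hg
  let x : Γ(C, V) := g (MvPolynomial.X 0)
  have ht : idealVal (diff (π := π) ⊤ x) ∈ nonZeroDivisors Γ(square π, around ⊤ V) :=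
    sub_mem_nonZeroDivisors_of_isPushout hpush g hC hflat
  let μ : Γ(square π, around ⊤ V) ⟶ Γ(C, diag π ⁻¹ᵁ around ⊤ V) := (diag π).app (around ⊤ V)
  have hμ : (p₁ π).appLE V (around ⊤ V) (around_le₁ ⊤ V) ≫ μ =
      (p₂ π).appLE V (around ⊤ V) (around_le₂ ⊤ V) ≫ μ := by
    ext b
    exact (diagFun_pull₁ ⊤ b).trans (diagFun_pull₂ ⊤ b).symm
  have hVle : V ≤ diag π ⁻¹ᵁ (⊤ : (square π).Opens) := le_top
  -- Pulling back along the first projection and restricting to the diagonal of `V` gives back the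
  -- function.
  have hinj : Function.Injective ((p₁ π).appLE V (around ⊤ V) (around_le₁ ⊤ V) ≫ μ).hom := by
    intro b b' hbb
    have h₁ : resO (diag_around_le ⊤ V) b = resO (diag_around_le ⊤ V) b' :=
      (diagFun_pull₁ ⊤ b).symm.trans (hbb.trans (diagFun_pull₁ ⊤ b'))
    have := congrArg (resO (le_around hVle)) h₁
    rwa [resO_resO, resO_resO, resO_self, resO_self] at this
  have hμh := (hh μ hμ).1
  have hker := (hh μ hμ).2 hinj
  have hfrac : ∀ {W : (square π).Opens} (b : Γ(square π, around ⊤ V))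
      (hb : (square π).basicOpen b ≤ W) (f : Γ(square π, W)), ∃ (n : ℕ) (a : Γ(square π, around ⊤ V)),
        resO ((square π).basicOpen_le b) a =
          (resO ((square π).basicOpen_le b) b) ^ n * resO hb f := fun b hb f ↦
    exists_eq_pow_mul_of_isAffineOpen _ _ haff b (resO hb f)
  have hunit : ∀ (b : Γ(square π, around ⊤ V)) (n : ℕ),
      IsUnit ((resO ((square π).basicOpen_le b) b) ^ n) := fun b n ↦
    IsUnit.pow n (RingedSpace.isUnit_res_basicOpen (square π).toRingedSpace b)
  -- A nonzerodivisor on an affine scheme remains one on basic open sets, hence on every open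
  -- subset.
  have hnzd : ∀ {W : (square π).Opens} (h' : W ≤ around ⊤ V) (c : Γ(square π, W)),
      c * resO h' (idealVal (diff ⊤ x)) = 0 → c = 0 := by
    intro W h' c hc
    refine eq_of_local (unitMod (square π)) (U := W) c 0 fun z hz ↦ ?_
    obtain ⟨b, hb, hzb⟩ := haff.exists_basicOpen_le ⟨z, hz⟩ (h' hz)
    refine ⟨(square π).basicOpen b, hzb, hb, ?_⟩
    change resO hb c = resO hb 0
    obtain ⟨n, a, ha⟩ := hfrac b hb c
    have h₁ : resO ((square π).basicOpen_le b) (a * idealVal (diff ⊤ x)) = 0 := by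
      have := congrArg (resO hb) hc
      rw [map_mul, resO_resO, map_zero] at this
      rw [map_mul, ha, mul_assoc, this, mul_zero]
    obtain ⟨m, hm⟩ := exists_pow_mul_eq_zero_of_res_basicOpen_eq_zero_of_isAffineOpen
      (square π) haff _ _ h₁
    rw [← mul_assoc] at hm
    have h₂ := (mem_nonZeroDivisors_iff_right.1 ht) _ hm
    have h₃ := congrArg (resO ((square π).basicOpen_le b)) h₂
    rw [map_mul, map_pow, map_zero, ha, (hunit b m).mul_right_eq_zero,
      (hunit b n).mul_right_eq_zero] at h₃
    rw [h₃, map_zero]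
  have hW₀ : (square π).basicOpen h ≤ around ⊤ V := (square π).basicOpen_le h
  refine ⟨V, x, (square π).basicOpen h, hy, ?_, hW₀,
    fun h' D hD ↦ der_eq_zero_of_coordinate hV e g hC hg.formallyUnramified h' D hD, ?_,
    fun h' c hc ↦ hnzd (h'.trans hW₀) c hc⟩
  · change y ∈ diag π ⁻¹ᵁ (square π).basicOpen h
    rw [Scheme.preimage_basicOpen]
    have : IsUnit (((diag π).app (around ⊤ V)) h) := by
      have h1 : ((diag π).app (around ⊤ V)) h = 1 := hμh
      rw [h1]
      exact isUnit_one
    rw [Scheme.basicOpen_of_isUnit _ this]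
    exact le_around hVle hy
  · intro W h' f hf
    -- On a basic open set write f = a / bⁿ. A power of `b` times `a` vanishes on the diagonal, so
    -- `h` times it is a multiple of the generator; `h` and `b` are invertible here.
    have hloc : ∀ z ∈ W, ∃ W' : (square π).Opens, z ∈ W' ∧ ∃ k : W' ≤ W, ∃ c, resO k f =
        c * resO ((k.trans h').trans hW₀) (idealVal (diff ⊤ x)) := by
      intro z hz
      obtain ⟨b, hb, hzb⟩ := haff.exists_basicOpen_le ⟨z, hz⟩ (hW₀ (h' hz))
      refine ⟨(square π).basicOpen b, hzb, hb, ?_⟩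
      obtain ⟨n, a, ha⟩ := hfrac b hb f
      have h₁ : resO (Scheme.Hom.preimage_mono (diag π) ((square π).basicOpen_le b))
          (diagFun a) = 0 := by
        have h0 := congrArg (diagFun (π := π)) ha
        rwa [diagFun_res, map_mul, diagFun_res hb, hf, map_zero, mul_zero] at h0
      have hVaff : IsAffineOpen (diag π ⁻¹ᵁ around ⊤ V) := by
        rwa [diag_preimage_around ⊤ hVle]
      have h₂ : resO (C.basicOpen_le (diagFun b)) (diagFun a) = 0 := by
        have hle : C.basicOpen (diagFun (π := π) b) ≤ diag π ⁻¹ᵁ (square π).basicOpen b := by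
          rw [Scheme.preimage_basicOpen]
          exact le_rfl
        have := congrArg (resO hle) h₁
        rwa [resO_resO, map_zero] at this
      obtain ⟨m, hm⟩ := exists_pow_mul_eq_zero_of_res_basicOpen_eq_zero_of_isAffineOpen
        C hVaff _ _ h₂
      obtain ⟨c, hc⟩ := hker (b ^ m * a) (by
        rw [map_mul, map_pow]
        exact hm)
      have h₃ := congrArg (resO ((square π).basicOpen_le b)) hc
      rw [map_mul, map_mul, map_mul, map_pow, ha] at h₃
      have hle : (square π).basicOpen b ≤ (square π).basicOpen h := hb.trans h'
      have hu : IsUnit (resO ((square π).basicOpen_le b) h) := by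
        have := (RingedSpace.isUnit_res_basicOpen (square π).toRingedSpace h).map (resO hle)
        change IsUnit (resO hle (resO hW₀ h)) at this
        rwa [resO_resO] at this
      obtain ⟨u, hu⟩ := (hu.mul (hunit b m)).mul (hunit b n)
      refine ⟨u⁻¹.1 * resO ((square π).basicOpen_le b) c, ?_⟩
      have h₄ : u.1 * resO hb f = resO ((square π).basicOpen_le b) c *
          resO ((square π).basicOpen_le b) (idealVal (diff ⊤ x)) := by
        rw [hu, mul_assoc, mul_assoc]
        exact h₃
      rw [mul_assoc, ← h₄, ← mul_assoc, Units.inv_mul, one_mul]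
    choose W' hzW' hW' c hc using hloc
    -- The local quotients by a regular element are unique, so they glue.
    obtain ⟨c'', hc'', -⟩ := glue (unitMod (square π)) (fun z : W ↦ W' z.1 z.2)
      (fun z ↦ hW' z.1 z.2) (fun z hz ↦ Opens.mem_iSup.2 ⟨⟨z, hz⟩, hzW' z hz⟩)
      (fun z ↦ c z.1 z.2) (fun z z' ↦ by
        have h₁ := congrArg (resO (inf_le_left : W' z.1 z.2 ⊓ W' z'.1 z'.2 ≤ _)) (hc z.1 z.2)
        have h₂ := congrArg (resO (inf_le_right : W' z.1 z.2 ⊓ W' z'.1 z'.2 ≤ _)) (hc z'.1 z'.2)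
        rw [map_mul, resO_resO, resO_resO] at h₁ h₂
        refine sub_eq_zero.1 (hnzd ((inf_le_left.trans (hW' z.1 z.2)).trans (h'.trans hW₀)) _ ?_)
        refine (sub_mul _ _ _).trans (sub_eq_zero.2 (h₁.symm.trans h₂)))
    obtain ⟨c', hc'⟩ : ∃ c' : Γ(square π, W), ∀ z : W, resO (hW' z.1 z.2) c' = c z.1 z.2 :=
      ⟨c'', hc''⟩
    refine ⟨c', eq_of_local (unitMod (square π)) (U := W) f _ fun z hz ↦
      ⟨W' z hz, hzW' z hz, hW' z hz, ?_⟩⟩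
    change resO (hW' z hz) f = resO (hW' z hz) (_ * _)
    rw [map_mul, resO_resO, hc z hz]
    exact congrArg (· * _) (hc' ⟨z, hz⟩).symm

end Coordinate

/-! ### Exactness of the principal part sequence. -/

section PrincipalPart

variable {C S : Scheme.{u}} {π : C ⟶ S}

theorem subsingleton_of_disjoint (M : C.Modules) {W : (square π).Opens}
    (hW : ∀ y : C, diag π y ∉ W) (s t : Γ((diagPush π).obj M, W)) : s = t :=
  eq_of_local M (U := diag π ⁻¹ᵁ W) s t fun y hy ↦ (hW y hy).elim

/-- The diagonal is closed because `π` is separated, so its complement is an open neighbourhood of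
the point. -/
theorem exists_disjoint [IsSeparated π] {z : square π} (hz : ∀ y : C, diag π y ≠ z)
    {U : (square π).Opens} (hU : z ∈ U) :
    ∃ W : (square π).Opens, z ∈ W ∧ W ≤ U ∧ ∀ y : C, diag π y ∉ W := by
  have hcl : IsClosed (Set.range (diag π)) := (Scheme.Hom.isClosedEmbedding (diag π)).isClosed_range
  refine ⟨U ⊓ ⟨(Set.range (diag π))ᶜ, hcl.isOpen_compl⟩, ⟨hU, ?_⟩, inf_le_left, ?_⟩
  · rintro ⟨y, hy⟩
    exact hz y hy
  · rintro y ⟨-, hy⟩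
    exact hy ⟨y, rfl⟩

/-- The unit section of the ideal of the diagonal away from the diagonal. -/
def oneIdeal {W : (square π).Opens} (hW : ∀ y : C, diag π y ∉ W) : Γ(ideal π, W) :=
  mkIdeal 1 (eq_of_local (unitMod C) (U := diag π ⁻¹ᵁ W) (diagFun (π := π) (1 : Γ(square π, W))) 0
    fun y hy ↦ (hW y hy).elim)

theorem idealVal_oneIdeal {W : (square π).Opens} (hW : ∀ y : C, diag π y ∉ W) :
    idealVal (oneIdeal hW) = 1 := rfl

theorem eq_smul_oneIdeal {W V : (square π).Opens} (hW : ∀ y : C, diag π y ∉ W) (h : V ≤ W)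
    (i : Γ(ideal π, V)) : i = idealVal i • res (ideal π) h (oneIdeal hW) :=
  idealVal_injective <| by
    rw [map_smul, idealVal_res, idealVal_oneIdeal, map_one, smul_eq_mul, mul_one]

/-- Compatible local generators of the source and the target of a morphism `N → Δ_* M`. -/
structure DiagGen {N : (square π).Modules} {M : C.Modules} (ρ : N ⟶ (diagPush π).obj M)
    (V : C.Opens) (ι : Type) [Fintype ι] where
  src : LocalGen N (around ⊤ V) ι
  tgt : LocalGen M V ι
  map_gen : ∀ i, toDiag le_top (ρ.app (around ⊤ V) (src.gen i)) = tgt.gen i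
  repr_map : ∀ (i : ι) {W : (square π).Opens} (h : W ≤ around ⊤ V) (s : Γ(N, W)),
    diagFun (src.repr i h s) =
      tgt.repr i ((Scheme.Hom.preimage_mono _ h).trans (diag_around_le ⊤ V)) (ρ.app W s)

variable {N : (square π).Modules} {M : C.Modules} {ρ : N ⟶ (diagPush π).obj M}

namespace IsCoordinate

variable {V : C.Opens} {x : Γ(C, V)} {W₀ : (square π).Opens} (hx : IsCoordinate π x W₀)

/-- The generator of the ideal of the diagonal given by a coordinate. -/
def param {W : (square π).Opens} (h : W ≤ W₀) : Γ(ideal π, W) :=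
  res (ideal π) (h.trans hx.le) (diff ⊤ x)

theorem res_param {W W' : (square π).Opens} (h : W ≤ W₀) (k : W' ≤ W) :
    res (ideal π) k (hx.param h) = hx.param (k.trans h) := res_res _ _ _ _

theorem exists_eq_smul_param {W : (square π).Opens} (h : W ≤ W₀) (i : Γ(ideal π, W)) :
    ∃ c : Γ(square π, W), i = c • hx.param h := by
  obtain ⟨c, hc⟩ := hx.exists_eq_mul h (idealVal i) (diagFun_idealVal i)
  exact ⟨c, idealVal_injective (by rw [hc, map_smul]; rfl)⟩

theorem diff_eq_param {W : (square π).Opens} (h : W ≤ W₀) {V' : C.Opens} (k : V' ≤ V) :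
    diff W (resO k x) = hx.param ((around_le W V').trans h) := by
  rw [diff_mono (le_top : W ≤ ⊤), diff_res, res_res]
  rfl

theorem mul_param_eq_zero {W : (square π).Opens} (h : W ≤ W₀) {c : Γ(square π, W)}
    (hc : c * idealVal (hx.param h) = 0) : c = 0 := hx.eq_zero_of_mul h c hc

/-- The generator of the ideal kills `n`, hence each coordinate of `n`; the generator being regular,
the coordinates vanish. -/
theorem eq_zero_of_mulSection (hx : IsCoordinate π x W₀) {ι : Type} [Fintype ι] {W₁ : (square π).Opens}
    (G : LocalGen N W₁ ι)
    {W : (square π).Opens} (h : W ≤ W₀) (h' : W ≤ W₁) (n : Γ(N, W)) (hn : mulSection n = 0) :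
    n = 0 := by
  have h₁ : idealVal (hx.param h) • n = 0 := by
    have := ev_mulSection n le_rfl (hx.param h)
    rw [hn, res_self] at this
    exact this.symm
  rw [← G.sum_repr h' n]
  refine Finset.sum_eq_zero fun i _ ↦ ?_
  rw [hx.mul_param_eq_zero h (c := G.repr i h' n), zero_smul]
  rw [mul_comm, ← G.repr_smul, h₁, G.repr_zero]

/-- A section of `N(Δ)` given by its value on the generator of the ideal. -/
theorem exists_twist_section {ι : Type} [Fintype ι] {W : (square π).Opens} (h : W ≤ W₀)
    (n : Γ(N, W)) : ∃ φ : Γ(twist π N, W), ∀ {W' : (square π).Opens} (k : W' ≤ W),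
      ev φ k (hx.param (k.trans h)) = res N k n := by
  choose c hc using fun (W' : (square π).Opens) (k : W' ≤ W) (i : Γ(ideal π, W')) ↦
    hx.exists_eq_smul_param (k.trans h) i
  -- The quotient of a section of the ideal by the generator is unique, which makes it linear in the
  -- section and compatible with restriction.
  have huniq : ∀ {W' : (square π).Opens} (k : W' ≤ W) (i : Γ(ideal π, W')) (d : Γ(square π, W')),
      i = d • hx.param (k.trans h) → c W' k i = d := by
    intro W' k i d hd
    refine sub_eq_zero.1 (hx.mul_param_eq_zero (k.trans h) ?_)
    have := congrArg idealVal ((hc W' k i).symm.trans hd)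
    rw [map_smul, map_smul] at this
    exact (sub_mul _ _ _).trans (sub_eq_zero.2 this)
  refine ⟨mkLin (fun W' k ↦
    { toFun := fun i ↦ c W' k i • res N k n
      map_add' := fun i j ↦ by
        rw [← add_smul, huniq k (i + j) (c W' k i + c W' k j) (by rw [add_smul, ← hc, ← hc])]
      map_smul' := fun f i ↦ by
        rw [huniq k (f • i) (f * c W' k i) (by rw [mul_smul, ← hc]), mul_smul]; rfl })
    (fun {W' W''} k l i ↦ ?_), fun {W'} k ↦ ?_⟩
  · change c W'' (l.trans k) (res _ l i) • res N (l.trans k) n = res N l (c W' k i • res N k n)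
    rw [res_smul, res_res]
    refine congrArg (· • _) (huniq _ _ _ ?_)
    rw [← hx.res_param (k.trans h) l, ← res_smul, ← hc]
  · rw [ev_mkLin]
    change c W' k (hx.param (k.trans h)) • res N k n = _
    rw [huniq k _ 1 (one_smul _ _).symm, one_smul]

end IsCoordinate

theorem le_diag_around (W : (square π).Opens) :
    diag π ⁻¹ᵁ W ≤ diag π ⁻¹ᵁ around W (diag π ⁻¹ᵁ W) := le_around le_rfl

/-- The diagonal meets `around W V` exactly in `V`, so the restriction loses nothing. -/
theorem toDiag_injective {W : (square π).Opens} {V : C.Opens} (h : V ≤ diag π ⁻¹ᵁ W) :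
    Function.Injective (toDiag (M := M) h) := by
  have key : ∀ m : Γ(M, diag π ⁻¹ᵁ around W V),
      res M (diag_around_le W V) (res M (le_around h) m) = m := fun m ↦ by
    rw [res_res, res_self]
  intro m m' hm
  exact (key m).symm.trans ((congrArg (res M (diag_around_le W V)) hm).trans (key m'))

theorem DiagGen.toDiag_res_gen {V : C.Opens} {ι : Type} [Fintype ι] (G : DiagGen ρ V ι) (i : ι)
    {W : (square π).Opens} {V' : C.Opens} (k : V' ≤ V) (h : V' ≤ diag π ⁻¹ᵁ W) :
    toDiag h (ρ.app (around W V')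
      (res N ((around_mono_left le_top V').trans (around_mono ⊤ k)) (G.src.gen i))) =
        res M k (G.tgt.gen i) := by
  rw [app_res, ← G.map_gen]
  exact (res_res M _ _ _).trans (res_res M _ _ _).symm

/-- Evaluating the zero derivation at the coordinate shows that φ(generator) restricts to zero on
the diagonal. Its coordinates are then divisible by the generator, so φ(generator) is the generator
times some n, and φ is multiplication by n on the whole ideal. -/
theorem exists_mulSection_of_principalPart_eq_zero {V : C.Opens} {x : Γ(C, V)}
    {W₀ : (square π).Opens} (hx : IsCoordinate π x W₀) {V' : C.Opens} {ι : Type} [Fintype ι]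
    (G : DiagGen ρ V' ι) {W : (square π).Opens} (h : W ≤ W₀) (h' : W ≤ around ⊤ V')
    (φ : Γ(twist π N, W)) (hφ : principalDer ρ φ = 0) :
    ∃ n : Γ(N, around W (diag π ⁻¹ᵁ W)),
      mulSection n = res (twist π N) (around_le W _) φ := by
  have hV : diag π ⁻¹ᵁ W ≤ V :=
    (Scheme.Hom.preimage_mono _ (h.trans hx.le)).trans (diag_around_le ⊤ V)
  have hle := around_le W (diag π ⁻¹ᵁ W)
  have h₁ : ρ.app _ (ev φ hle (hx.param (hle.trans h))) = 0 := by
    refine toDiag_injective le_rfl ?_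
    have := derApp_principalDer ρ φ le_rfl (resO hV x)
    rw [hφ, hx.diff_eq_param h hV] at this
    rw [map_zero]
    exact this.symm
  -- Compatibility of source and target coordinates turns vanishing in `M` into vanishing of
  -- functions on the diagonal.
  have h₂ : ∀ i, ∃ c, G.src.repr i (hle.trans h') (ev φ hle (hx.param (hle.trans h))) =
      c * idealVal (hx.param (hle.trans h)) := by
    intro i
    obtain ⟨c, hc⟩ := hx.exists_eq_mul (hle.trans h)
      (G.src.repr i (hle.trans h') (ev φ hle (hx.param (hle.trans h)))) (by
        rw [G.repr_map, h₁]
        exact G.tgt.repr_zero i _)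
    exact ⟨c, hc⟩
  choose c hc using h₂
  let n := ∑ i, c i • res N (hle.trans h') (G.src.gen i)
  have hn : ev φ hle (hx.param (hle.trans h)) = idealVal (hx.param (hle.trans h)) • n := by
    rw [← G.src.sum_repr (hle.trans h') (ev φ hle _), Finset.smul_sum]
    refine Finset.sum_congr rfl fun i _ ↦ ?_
    rw [hc, smul_smul, mul_comm]
  refine ⟨n, lin_ext fun U k i ↦ ?_⟩
  rw [ev_res, ev_mulSection]
  obtain ⟨d, hd⟩ := hx.exists_eq_smul_param (k.trans (hle.trans h)) i
  rw [hd, map_smul, map_smul, ← hx.res_param (hle.trans h) k, ev_nat φ hle k, hn, res_smul,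
    smul_eq_mul, mul_smul]
  rfl

/-- A derivation is determined by its value on the coordinate. That value is extended off the
diagonal, and φ is the homomorphism sending the generator of the ideal to the extension. -/
theorem exists_principalDer_eq {V : C.Opens} {x : Γ(C, V)}
    {W₀ : (square π).Opens} (hx : IsCoordinate π x W₀) {V' : C.Opens} {ι : Type} [Fintype ι]
    (G : DiagGen ρ V' ι) {W : (square π).Opens} (h : W ≤ W₀) (h' : W ≤ around ⊤ V')
    (D : Γ(derSheaf π M, diag π ⁻¹ᵁ W)) :
    ∃ φ : Γ(twist π N, around W (diag π ⁻¹ᵁ W)), principalDer ρ φ =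
      res (derSheaf π M) (Scheme.Hom.preimage_mono _ (around_le W _)) D := by
  have hV : diag π ⁻¹ᵁ W ≤ V :=
    (Scheme.Hom.preimage_mono _ (h.trans hx.le)).trans (diag_around_le ⊤ V)
  have hV' : diag π ⁻¹ᵁ W ≤ V' :=
    (Scheme.Hom.preimage_mono _ h').trans (diag_around_le ⊤ V')
  have hle := around_le W (diag π ⁻¹ᵁ W)
  let m : Γ(M, diag π ⁻¹ᵁ W) := derApp D le_rfl (resO hV x)
  -- Each coordinate of `m` is extended off the diagonal by pullback along the first projection.
  let n : Γ(N, around W (diag π ⁻¹ᵁ W)) := ∑ i, pull₁ W (G.tgt.repr i hV' m) •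
    res N ((around_mono_left le_top _).trans (around_mono ⊤ hV')) (G.src.gen i)
  have hn : toDiag le_rfl (ρ.app _ n) = m := by
    rw [map_sum, map_sum]
    refine Eq.trans (Finset.sum_congr rfl fun i _ ↦ ?_) (G.tgt.sum_repr hV' m)
    rw [Scheme.Modules.Hom.app_smul, toDiag_pull₁, G.toDiag_res_gen]
  obtain ⟨φ, hφ⟩ := hx.exists_twist_section (ι := ι) (hle.trans h) n
  refine ⟨φ, ?_⟩
  have hV₂ : diag π ⁻¹ᵁ around W (diag π ⁻¹ᵁ W) ≤ V := (Scheme.Hom.preimage_mono _ hle).trans hV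
  refine sub_eq_zero.1 (hx.der_eq_zero hV₂ _ ?_)
  have hsub : ∀ (D₁ D₂ : Γ(derSheaf π M, diag π ⁻¹ᵁ around W (diag π ⁻¹ᵁ W)))
      (f : Γ(C, diag π ⁻¹ᵁ around W (diag π ⁻¹ᵁ W))), derApp (D₁ - D₂) le_rfl f =
        derApp D₁ le_rfl f - derApp D₂ le_rfl f := by
    intro D₁ D₂ f
    rw [eq_sub_iff_add_eq, ← derApp_add, sub_add_cancel]
  rw [hsub, sub_eq_zero, derApp_res, derApp_principalDer, hx.diff_eq_param (hle.trans h) hV₂, hφ,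
    app_res]
  have h₁ := congrArg (res M (Scheme.Hom.preimage_mono (diag π) hle)) hn
  refine Eq.trans ?_ (h₁.trans ?_)
  · exact (res_res M _ _ _).trans (res_res M _ _ _).symm
  · rw [← derApp_nat D le_rfl, resO_resO]

/-- The sequence `N → N(Δ) → Δ_* 𝒟er(𝒪_C, M)` given by `ρ : N → Δ_* M`. -/
def principalSequence (ρ : N ⟶ (diagPush π).obj M) : ShortComplex (square π).Modules where
  X₁ := N
  X₂ := twist π N
  X₃ := (diagPush π).obj (derSheaf π M)
  f := toTwist N
  g := principalPart ρ
  zero := by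
    ext W n
    refine der_ext fun V h f ↦ ?_
    refine (derApp_principalDer ρ (mulSection n) h f).trans ?_
    rw [ev_mulSection, Scheme.Modules.Hom.app_smul, toDiag_smul, diagFun_idealVal, map_zero,
      zero_smul]
    rfl

variable [IsSeparated π] [SmoothOfRelativeDimension 1 π]

/-- Near the diagonal the ideal has a regular generator; away from it the ideal contains 1, so
multiplication by `n` recovers `n`. -/
theorem mulSection_injective (hG : ∀ y : C, ∃ (V : C.Opens) (ι : Type) (_ : Fintype ι), y ∈ V ∧
    Nonempty (DiagGen ρ V ι)) {U : (square π).Opens} (n : Γ(N, U)) (hn : mulSection n = 0) :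
    n = 0 := by
  have hres : ∀ {W : (square π).Opens} (h : W ≤ U), mulSection (res N h n) = 0 := fun h ↦ by
    have := app_res (toTwist N) h n
    refine this.trans ?_
    change res (twist π N) h (mulSection n) = 0
    rw [hn, map_zero]
  refine eq_of_local N _ _ fun z hz ↦ ?_
  by_cases hd : ∃ y : C, diag π y = z
  · obtain ⟨y, rfl⟩ := hd
    obtain ⟨V, x, W₀, hy, hyW, hx⟩ := exists_coordinate (π := π) y
    obtain ⟨V', ι, _, hyV', ⟨G⟩⟩ := hG y
    have hyV'' : diag π y ∈ around ⊤ V' := le_around (W := ⊤) (V := V') le_top hyV'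
    refine ⟨U ⊓ (W₀ ⊓ around ⊤ V'), ⟨hz, hyW, hyV''⟩, inf_le_left, ?_⟩
    rw [map_zero]
    exact hx.eq_zero_of_mulSection G.src (inf_le_right.trans inf_le_left)
      (inf_le_right.trans inf_le_right) _ (hres _)
  · obtain ⟨W, hzW, hWU, hW⟩ := exists_disjoint (fun y hy ↦ hd ⟨y, hy⟩) hz
    refine ⟨W, hzW, hWU, ?_⟩
    have := ev_mulSection (res N hWU n) le_rfl (oneIdeal hW)
    rw [hres, idealVal_oneIdeal, one_smul, res_self] at this
    rw [map_zero]
    exact this.symm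

theorem exists_local_mulSection (hG : ∀ y : C, ∃ (V : C.Opens) (ι : Type) (_ : Fintype ι), y ∈ V ∧
    Nonempty (DiagGen ρ V ι)) {U : (square π).Opens} (φ : Γ(twist π N, U))
    (hφ : principalDer ρ φ = 0) {z : square π} (hz : z ∈ U) :
    ∃ W : (square π).Opens, z ∈ W ∧ ∃ (h : W ≤ U) (n : Γ(N, W)),
      mulSection n = res (twist π N) h φ := by
  have hres : ∀ {W : (square π).Opens} (h : W ≤ U), principalDer ρ (res (twist π N) h φ) = 0 :=
    fun h ↦ by
      refine (app_res (principalPart ρ) h φ).trans ?_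
      exact (congrArg (res ((diagPush π).obj (derSheaf π M)) h) hφ).trans
        (map_zero (res ((diagPush π).obj (derSheaf π M)) h))
  by_cases hd : ∃ y : C, diag π y = z
  · obtain ⟨y, rfl⟩ := hd
    obtain ⟨V, x, W₀, hy, hyW, hx⟩ := exists_coordinate (π := π) y
    obtain ⟨V', ι, _, hyV', ⟨G⟩⟩ := hG y
    have hyV'' : diag π y ∈ around ⊤ V' := le_around (W := ⊤) (V := V') le_top hyV'
    have hle : U ⊓ (W₀ ⊓ around ⊤ V') ≤ U := inf_le_left
    obtain ⟨n, hn⟩ := exists_mulSection_of_principalPart_eq_zero hx G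
      (inf_le_right.trans inf_le_left) (inf_le_right.trans inf_le_right)
      (res (twist π N) hle φ) (hres hle)
    refine ⟨_, le_diag_around (π := π) (U ⊓ (W₀ ⊓ around ⊤ V'))
      (show y ∈ diag π ⁻¹ᵁ (U ⊓ (W₀ ⊓ around ⊤ V')) from ⟨hz, hyW, hyV''⟩),
      (around_le _ _).trans hle, n, hn.trans ?_⟩
    rw [res_res]
  · obtain ⟨W, hzW, hWU, hW⟩ := exists_disjoint (fun y hy ↦ hd ⟨y, hy⟩) hz
    -- Away from the diagonal φ is multiplication by its value at the section 1 of the ideal.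
    refine ⟨W, hzW, hWU, ev φ hWU (oneIdeal hW), lin_ext fun V h i ↦ ?_⟩
    rw [ev_mulSection, ev_res, ← ev_nat φ hWU h, ← map_smul, ← eq_smul_oneIdeal hW h]

theorem exists_local_principalDer (hG : ∀ y : C, ∃ (V : C.Opens) (ι : Type) (_ : Fintype ι),
    y ∈ V ∧ Nonempty (DiagGen ρ V ι)) {U : (square π).Opens}
    (D : Γ((diagPush π).obj (derSheaf π M), U)) {z : square π} (hz : z ∈ U) :
    ∃ W : (square π).Opens, z ∈ W ∧ ∃ (h : W ≤ U) (φ : Γ(twist π N, W)),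
      principalDer ρ φ = res ((diagPush π).obj (derSheaf π M)) h D := by
  by_cases hd : ∃ y : C, diag π y = z
  · obtain ⟨y, rfl⟩ := hd
    obtain ⟨V, x, W₀, hy, hyW, hx⟩ := exists_coordinate (π := π) y
    obtain ⟨V', ι, _, hyV', ⟨G⟩⟩ := hG y
    have hyV'' : diag π y ∈ around ⊤ V' := le_around (W := ⊤) (V := V') le_top hyV'
    have hle : U ⊓ (W₀ ⊓ around ⊤ V') ≤ U := inf_le_left
    obtain ⟨φ, hφ⟩ := exists_principalDer_eq (ρ := ρ) hx G (W := U ⊓ (W₀ ⊓ around ⊤ V'))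
      (inf_le_right.trans inf_le_left) (inf_le_right.trans inf_le_right)
      (res (derSheaf π M) (Scheme.Hom.preimage_mono (diag π) hle) (show Γ(derSheaf π M, diag π ⁻¹ᵁ U) from D))
    refine ⟨around (U ⊓ (W₀ ⊓ around ⊤ V')) (diag π ⁻¹ᵁ (U ⊓ (W₀ ⊓ around ⊤ V'))),
      le_diag_around (π := π) (U ⊓ (W₀ ⊓ around ⊤ V'))
      (show y ∈ diag π ⁻¹ᵁ (U ⊓ (W₀ ⊓ around ⊤ V')) from ⟨hz, hyW, hyV''⟩),
      (around_le _ _).trans hle, φ, hφ.trans ?_⟩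
    exact res_res (derSheaf π M) (Scheme.Hom.preimage_mono (diag π) hle)
      (Scheme.Hom.preimage_mono (diag π) (around_le _ _)) _
  · obtain ⟨W, hzW, hWU, hW⟩ := exists_disjoint (fun y hy ↦ hd ⟨y, hy⟩) hz
    -- Away from the diagonal the target has only the zero section.
    exact ⟨W, hzW, hWU, 0, subsingleton_of_disjoint (derSheaf π M) hW
      (principalDer ρ (0 : Γ(twist π N, W))) (res ((diagPush π).obj (derSheaf π M)) hWU D)⟩

theorem principalSequence_locallyExact (hG : ∀ y : C, ∃ (V : C.Opens) (ι : Type) (_ : Fintype ι),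
    y ∈ V ∧ Nonempty (DiagGen ρ V ι)) : LocallyExact (principalSequence ρ) where
  injective _ := (injective_iff_map_eq_zero _).2 fun n hn ↦ mulSection_injective hG n hn
  exact _ φ hφ _ hz := exists_local_mulSection hG φ hφ hz
  surjective _ D _ hz := exists_local_principalDer hG D hz

end PrincipalPart

/-! ### Compatible generators for restriction to the diagonal. -/

section DiagonalGenerators

variable {C S : Scheme.{u}} {π : C ⟶ S} {V : C.Opens}

theorem preimage_inf_le {X Y : Scheme.{u}} {q : X ⟶ Y} {U V : Y.Opens} {V' : X.Opens}
    (h : V' ≤ q ⁻¹ᵁ V) : q ⁻¹ᵁ U ⊓ V' ≤ q ⁻¹ᵁ (U ⊓ V) := inf_le_inf_left _ h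

/-- Compatible generators from the compatibility of the coordinates as morphisms. -/
def DiagGen.ofCoord {N : (square π).Modules} {M : C.Modules} {ρ : N ⟶ (diagPush π).obj M}
    {ι : Type} [Fintype ι] (src : LocalGen N (around ⊤ V) ι) (tgt : LocalGen M V ι)
    (map_gen : ∀ i, toDiag le_top (ρ.app (around ⊤ V) (src.gen i)) = tgt.gen i)
    (h : ∀ i, src.coord i ≫ starPull (diag π) (le_around le_top) =
      ρ ≫ (diagPush π).map (tgt.coord i)) : DiagGen ρ V ι where
  src := src
  tgt := tgt
  map_gen := map_gen
  repr_map i {W} hW s := by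
    have hV : diag π ⁻¹ᵁ W ≤ V := (Scheme.Hom.preimage_mono _ hW).trans (diag_around_le ⊤ V)
    have h₁ : starFun (V := V) (U := diag π ⁻¹ᵁ W) ((starPull (diag π) (le_around le_top)).app W
        ((src.coord i).app W s)) =
          starFun (V := V) (U := diag π ⁻¹ᵁ W) ((tgt.coord i).app (diag π ⁻¹ᵁ W) (ρ.app W s)) :=
      congrArg (fun f ↦ starFun (V := V) (U := diag π ⁻¹ᵁ W) (f.app W s)) (h i)
    rw [starFun_starPull] at h₁
    have h₂ := congrArg (resO (le_inf le_rfl hV)) h₁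
    refine Eq.trans ?_ h₂
    refine Eq.trans ?_ (res_appLE (q := diag π) (preimage_inf_le (le_around le_top)) _ _).symm
    refine Eq.trans ?_ (appLE_resO (q := diag π) le_rfl (le_inf le_rfl hW) _)
    rw [Scheme.Hom.appLE_eq_app]
    rfl

theorem pullToDiag_pullSec {p : square π ⟶ C} (hp : diag π ≫ p = 𝟙 C) {A : C.Modules}
    {U : C.Opens} (a : Γ(A, U)) (h : diag π ⁻¹ᵁ p ⁻¹ᵁ U ≤ U) :
    (pullToDiag π hp A).app (p ⁻¹ᵁ U) (pullSec p a) = res A h a :=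
  (homEquiv_symm_pullSec _ a).trans rfl

theorem diag_preimage_preimage {p : square π ⟶ C} (hp : diag π ≫ p = 𝟙 C) (U : C.Opens) :
    diag π ⁻¹ᵁ p ⁻¹ᵁ U = U := by
  rw [← Scheme.Hom.comp_preimage, hp]
  rfl

/-- It suffices to compare on pulled-back sections, where pulling a function back along `p` and then
along the diagonal is mere restriction, as `p` retracts the diagonal. -/
theorem pullCoord_starPull {p : square π ⟶ C} (hp : diag π ≫ p = 𝟙 C) {A : C.Modules}
    {V' : (square π).Opens} (hV : V' ≤ p ⁻¹ᵁ V) (hV' : V ≤ diag π ⁻¹ᵁ V')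
    (α : A ⟶ starRes V (unitMod C)) : pullCoord p hV α ≫ starPull (diag π) hV' =
      pullToDiag π hp A ≫ (diagPush π).map α :=
  pullback_hom_ext fun U a ↦ by
    have hU := (diag_preimage_preimage hp U).le
    refine starFun_injective (V := V) (U := diag π ⁻¹ᵁ p ⁻¹ᵁ U) ?_
    have h₁ : starFun (V := V) (U := diag π ⁻¹ᵁ p ⁻¹ᵁ U)
        ((starPull (diag π) hV').app (p ⁻¹ᵁ U) ((pullCoord p hV α).app (p ⁻¹ᵁ U) (pullSec p a))) =
        starFun (V := V) (U := diag π ⁻¹ᵁ p ⁻¹ᵁ U) (α.app (diag π ⁻¹ᵁ p ⁻¹ᵁ U) (res A hU a)) := by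
      rw [starFun_starPull, starFun_pullCoord, app_res, starFun_res]
      have h₂ : p.appLE (U ⊓ V) (p ⁻¹ᵁ U ⊓ V') (preimage_inf_le hV) ≫
          (diag π).appLE (p ⁻¹ᵁ U ⊓ V') (diag π ⁻¹ᵁ p ⁻¹ᵁ U ⊓ V) (preimage_inf_le hV') =
          C.presheaf.map (homOfLE (inf_le_inf_right V hU)).op := by
        rw [Scheme.Hom.appLE_comp_appLE, appLE_congr_hom hp (g := 𝟙 C) _ (inf_le_inf_right V hU)]
        exact Category.id_comp _
      exact ConcreteCategory.congr_hom h₂ _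
    refine h₁.trans ?_
    rw [← pullToDiag_pullSec hp]
    rfl

/-- The pure tensor of sections of `p₁^* A` and `p₂^* B`, as a section of `A ⊠ B`. -/
def boxPair {A B : C.Modules} {W : (square π).Opens}
    (a : Γ((Scheme.Modules.pullback (p₁ π)).obj A, W))
    (b : Γ((Scheme.Modules.pullback (p₂ π)).obj B, W)) : Γ(box π A B, W) := tmul a b

section

variable {A B : C.Modules} {W : (square π).Opens}
  (a : Γ((Scheme.Modules.pullback (p₁ π)).obj A, W))
  (b : Γ((Scheme.Modules.pullback (p₂ π)).obj B, W))

theorem boxToDiag_boxPair : (boxToDiag π A B).app W (boxPair a b) =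
    diagTmul ((pullToDiag π (Limits.pullback.diagonal_fst π) A).app W a)
      ((pullToDiag π (Limits.pullback.diagonal_snd π) B).app W b) := lift_tmul _ _ a b

theorem smul_boxPair (f : Γ(square π, W)) : boxPair (f • a) b = f • boxPair a b :=
  smul_tmul' f a b

theorem boxPair_smul (f : Γ(square π, W)) : boxPair a (f • b) = f • boxPair a b :=
  tmul_smul f a b

theorem res_boxPair {W' : (square π).Opens} (h : W' ≤ W) :
    res (box π A B) h (boxPair a b) = boxPair (res _ h a) (res _ h b) := res_tmul h a b

theorem sum_boxPair {ι : Type} [Fintype ι] (a : ι → Γ((Scheme.Modules.pullback (p₁ π)).obj A, W)) :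
    boxPair (∑ i, a i) b = ∑ i, boxPair (a i) b := sum_tmul a b

theorem boxPair_sum {ι : Type} [Fintype ι] (b : ι → Γ((Scheme.Modules.pullback (p₂ π)).obj B, W)) :
    boxPair a (∑ i, b i) = ∑ i, boxPair a (b i) := tmul_sum a b

end

/-- The section `a ⊠ b` of `A ⊠ B` on the pairs of points of `V`. -/
def boxTmul {A B : C.Modules} (a : Γ(A, V)) (b : Γ(B, V)) : Γ(box π A B, around ⊤ V) :=
  boxPair (res _ (around_le₁ ⊤ V) (pullSec (p₁ π) a)) (res _ (around_le₂ ⊤ V) (pullSec (p₂ π) b))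

theorem toDiag_boxTmul {A B : C.Modules} (a : Γ(A, V)) (b : Γ(B, V)) :
    toDiag le_top ((boxToDiag π A B).app (around ⊤ V) (boxTmul a b)) = tmul a b := by
  rw [boxTmul, boxToDiag_boxPair, app_res, app_res,
    pullToDiag_pullSec _ _ (diag_preimage_preimage (Limits.pullback.diagonal_fst π) V).le,
    pullToDiag_pullSec _ _ (diag_preimage_preimage (Limits.pullback.diagonal_snd π) V).le]
  refine (res_tmul (A := A) (B := B) (le_around (le_top : V ≤ diag π ⁻¹ᵁ ⊤)) _ _).trans ?_
  congr 1
  · exact (res_res A _ _ _).trans ((res_res A _ _ a).trans (res_self A le_rfl a))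
  · exact (res_res B _ _ _).trans ((res_res B _ _ b).trans (res_self B le_rfl b))

/-- Compatible generators for the restriction to the diagonal of an external tensor product. -/
def DiagGen.box {A B : C.Modules} {ι κ : Type} [Fintype ι] [Fintype κ] (G : LocalGen A V ι)
    (H : LocalGen B V κ) : DiagGen (boxToDiag π A B) V (ι × κ) :=
  DiagGen.ofCoord
    ((G.pullback (p₁ π) (around_le₁ ⊤ V)).tensor (H.pullback (p₂ π) (around_le₂ ⊤ V)))
    (G.tensor H) (fun k ↦ toDiag_boxTmul (G.gen k.1) (H.gen k.2))
    (fun k ↦ tensor_hom_ext fun W a b ↦ by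
      refine starFun_injective (V := V) (U := diag π ⁻¹ᵁ W) ?_
      have hA := fun a ↦ congrArg (fun f ↦ starFun (V := V) (U := diag π ⁻¹ᵁ W) (f.app W a))
        (pullCoord_starPull (Limits.pullback.diagonal_fst π) (around_le₁ ⊤ V)
          (le_around le_top) (G.coord k.1))
      have hB := fun b ↦ congrArg (fun f ↦ starFun (V := V) (U := diag π ⁻¹ᵁ W) (f.app W b))
        (pullCoord_starPull (Limits.pullback.diagonal_snd π) (around_le₂ ⊤ V)
          (le_around le_top) (H.coord k.2))
      refine (starFun_starPull (diag π) (le_around le_top) _).trans ?_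
      refine (congrArg _ (starFun_tensorCoord _ _ W a b)).trans ?_
      rw [map_mul]
      refine (congrArg₂ (· * ·) (hA a) (hB b)).trans ?_
      refine (starFun_tensorCoord (G.coord k.1) (H.coord k.2) _ _ _).symm.trans ?_
      refine congrArg (fun s ↦ starFun (V := V) (U := diag π ⁻¹ᵁ W)
        ((tensorCoord (G.coord k.1) (H.coord k.2)).app (diag π ⁻¹ᵁ W) s)) ?_
      exact (boxToDiag_boxPair a b).symm)

/-- The restriction of functions to the diagonal, as a morphism. -/
def diagUnit (π : C ⟶ S) : unitMod (square π) ⟶ (diagPush π).obj (unitMod C) :=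
  mkHom (M := unitMod (square π)) (N := (diagPush π).obj (unitMod C))
    (fun W ↦ (diagFun (π := π) (W := W) : Γ(square π, W) →+ Γ(C, diag π ⁻¹ᵁ W)))
    (fun W f g ↦ map_mul (diagFun (π := π) (W := W)) f g)
    (fun h f ↦ diagFun_res h f)

/-- Compatible generators for the restriction of functions to the diagonal. -/
def DiagGen.unit : DiagGen (diagUnit π) V Unit :=
  DiagGen.ofCoord (LocalGen.unit _) (LocalGen.unit V)
    (fun _ ↦ (congrArg (resO (le_around (le_top : V ≤ diag π ⁻¹ᵁ ⊤)))
      (map_one (diagFun (π := π) (W := around ⊤ V)))).trans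
        (map_one (resO (X := C) (U := diag π ⁻¹ᵁ around ⊤ V) (V := V) _)))
    (fun _ ↦ hom_ext_sections fun W f ↦ by
      refine starFun_injective (V := V) (U := diag π ⁻¹ᵁ W) ?_
      refine (starFun_starPull (diag π) (le_around le_top) _).trans ?_
      refine (appLE_resO (q := diag π) _ inf_le_left _).trans ?_
      refine (res_appLE (q := diag π) le_rfl inf_le_left _).symm.trans ?_
      rw [Scheme.Hom.appLE_eq_app]
      rfl)

end DiagonalGenerators

/-! ### Frames, matrix units and the trace. -/

section Frames

variable {X : Scheme.{u}} {E : X.Modules} {r : ℕ} {V : X.Opens} {b : Fin r → Γ(E, V)}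

/-- The coordinates with respect to a frame. -/
def IsFrame.coord (hb : IsFrame E b) (j : Fin r) {W : X.Opens} (h : W ≤ V) :
    Γ(E, W) →ₗ[Γ(X, W)] Γ(X, W) := (hb.basis h).coord j

theorem IsFrame.sum_coord (hb : IsFrame E b) {W : X.Opens} (h : W ≤ V) (s : Γ(E, W)) :
    ∑ j, hb.coord j h s • res E h (b j) = s := by
  have := (hb.basis h).sum_repr s
  simp only [hb.basis_apply] at this
  exact this

theorem IsFrame.coord_sum (hb : IsFrame E b) {W : X.Opens} (h : W ≤ V) (c : Fin r → Γ(X, W))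
    (j : Fin r) : hb.coord j h (∑ i, c i • res E h (b i)) = c j := by
  have := (hb.basis h).repr_sum_self c
  simp only [hb.basis_apply] at this
  exact congrFun this j

theorem IsFrame.coord_self (hb : IsFrame E b) {W : X.Opens} (h : W ≤ V) (j : Fin r) :
    hb.coord j h (res E h (b j)) = 1 := by
  rw [← hb.basis_apply]
  exact (congrArg (fun f ↦ f j) ((hb.basis h).repr_self j)).trans Finsupp.single_eq_same

theorem IsFrame.coord_res (hb : IsFrame E b) (j : Fin r) {W W' : X.Opens} (h : W ≤ V) (k : W' ≤ W)
    (s : Γ(E, W)) : hb.coord j (k.trans h) (res E k s) = resO k (hb.coord j h s) := by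
  have := congrArg (res E k) (hb.sum_coord h s)
  rw [map_sum] at this
  simp only [res_smul, res_res] at this
  rw [← this, hb.coord_sum]

/-- The elementary endomorphism sending the `j`-th element of the frame to the `i`-th one. -/
def IsFrame.matUnit (hb : IsFrame E b) (i j : Fin r) : Γ(gl E, V) :=
  mkLin (fun _ h ↦ (hb.coord j h).smulRight (res E h (b i))) (fun h k s ↦ by
    rw [LinearMap.smulRight_apply, LinearMap.smulRight_apply, hb.coord_res, res_smul, res_res])

theorem IsFrame.ev_matUnit (hb : IsFrame E b) (i j : Fin r) {W : X.Opens} (h : W ≤ V)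
    (s : Γ(E, W)) : ev (hb.matUnit i j) h s = hb.coord j h s • res E h (b i) := rfl

variable [IsLocallyFreeOfRank E r]

theorem IsFrame.tr_eq_sum (hb : IsFrame E b) {W : X.Opens} (h : W ≤ V) (φ : Γ(gl E, W)) :
    tr E r φ = ∑ j, hb.coord j h (ev φ le_rfl (res E h (b j))) := by
  have := tr_spec E r φ le_rfl ⟨_, hb.restrict h⟩
  rw [resO_self] at this
  rw [this, LinearMap.trace_eq_matrix_trace _ (hb.basis h), Matrix.trace]
  refine Finset.sum_congr rfl fun j _ ↦ ?_
  rw [Matrix.diag_apply, LinearMap.toMatrix_apply, hb.basis_apply]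
  rfl

theorem ev_sum {M N : X.Modules} {U : X.Opens} {ι : Type} [Fintype ι] (φ : ι → Γ(sheafHom M N, U))
    {W : X.Opens} (h : W ≤ U) (s : Γ(M, W)) : ev (∑ i, φ i) h s = ∑ i, ev (φ i) h s :=
  map_sum (AddMonoidHom.mk' (fun φ : Γ(sheafHom M N, U) ↦ ev φ h s) fun _ _ ↦ ev_add _ _ _ _) φ _

/-- This is tr(eᵢⱼ φ) = φⱼᵢ. After a cyclic exchange the composite φ eᵢⱼ is a rank one endomorphism,
whose trace can be read off. -/
theorem IsFrame.tr_matUnit_mul (hb : IsFrame E b) (i j : Fin r) {W : X.Opens} (h : W ≤ V)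
    (φ : Γ(gl E, W)) : tr E r (glMul (res (gl E) h (hb.matUnit i j)) φ) =
      hb.coord j h (ev φ le_rfl (res E h (b i))) := by
  rw [tr_mul_comm, hb.tr_eq_sum h]
  have : ∀ k, ev (glMul φ (res (gl E) h (hb.matUnit i j))) le_rfl (res E h (b k)) =
      hb.coord j h (res E h (b k)) • ev φ le_rfl (res E h (b i)) := fun k ↦
    (ev φ le_rfl).map_smul _ _
  simp only [this, map_smul, smul_eq_mul]
  conv_rhs => rw [← hb.sum_coord h (ev φ le_rfl (res E h (b i))), map_sum]
  refine Finset.sum_congr rfl fun k _ ↦ ?_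
  rw [map_smul, smul_eq_mul, mul_comm]

/-- The families eᵢⱼ and eⱼᵢ are dual for the trace form on 𝔤𝔩(E): the coefficient of eⱼᵢ in φ is
φⱼᵢ = tr(eᵢⱼ φ). -/
theorem IsFrame.sum_tr_matUnit (hb : IsFrame E b) {W : X.Opens} (h : W ≤ V) (φ : Γ(gl E, W)) :
    ∑ k : Fin r × Fin r, tr E r (glMul (res (gl E) h (hb.matUnit k.1 k.2)) φ) •
      res (gl E) h (hb.matUnit k.2 k.1) = φ := by
  refine lin_ext fun W' k s ↦ ?_
  have h₁ : ∀ i, ev φ k (res E (k.trans h) (b i)) =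
      res E k (ev φ le_rfl (res E h (b i))) := fun i ↦ by
    rw [← ev_nat φ le_rfl k, res_res]
  conv_rhs => rw [← hb.sum_coord (k.trans h) s, map_sum]
  rw [ev_sum, Fintype.sum_prod_type]
  refine Finset.sum_congr rfl fun i _ ↦ ?_
  rw [map_smul, h₁, ← hb.sum_coord h (ev φ le_rfl _), map_sum, Finset.smul_sum]
  refine Finset.sum_congr rfl fun j _ ↦ ?_
  rw [ev_smul, ev_res, hb.ev_matUnit, hb.tr_matUnit_mul, res_smul, res_res, smul_comm]

theorem tr_scalarEnd {U : X.Opens} (f : Γ(X, U)) :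
    tr E r (scalarEnd f : Γ(gl E, U)) = f * r := by
  refine tr_unique E r _ _ fun W h ⟨e, he⟩ ↦ ?_
  have := tr_spec E r (scalarEnd f) h ⟨e, he⟩
  rw [← this, ← tr_res, he.tr_eq_sum le_rfl]
  have h₁ : ∀ j, ev (res (gl E) h (scalarEnd f)) le_rfl (res E le_rfl (e j)) =
    resO h f • res E le_rfl (e j) := fun j ↦ rfl
  simp only [h₁, map_smul, he.coord_self, smul_eq_mul, mul_one]
  rw [Finset.sum_const, Finset.card_univ, Fintype.card_fin, map_mul, map_natCast, nsmul_eq_mul,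
    mul_comm]

/-- Since eᵢⱼ φ eⱼᵢ = φⱼⱼ eᵢᵢ, summing over j gives the trace and summing over i gives the identity.
Both contributions to the Casimir constant come from here. -/
theorem IsFrame.sum_matUnit_mul (hb : IsFrame E b) {W : X.Opens} (h : W ≤ V) (φ : Γ(gl E, W)) :
    ∑ k : Fin r × Fin r, glMul (res (gl E) h (hb.matUnit k.1 k.2))
      (glMul φ (res (gl E) h (hb.matUnit k.2 k.1))) = scalarEnd (tr E r φ) := by
  refine lin_ext fun W' k s ↦ ?_
  have h₁ : ∀ i j, ev (glMul (res (gl E) h (hb.matUnit i j))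
      (glMul φ (res (gl E) h (hb.matUnit j i)))) k s =
      (resO k (hb.coord j h (ev φ le_rfl (res E h (b j)))) * hb.coord i (k.trans h) s) •
        res E (k.trans h) (b i) := fun i j ↦ by
    change hb.coord j (k.trans h) (ev φ k (hb.coord i (k.trans h) s • res E (k.trans h) (b j))) •
      res E (k.trans h) (b i) = _
    rw [map_smul, map_smul, ← hb.coord_res, ← ev_nat φ le_rfl k, res_res, smul_eq_mul, mul_comm]
  rw [ev_sum, Fintype.sum_prod_type, ev_scalarEnd, hb.tr_eq_sum h, map_sum]
  conv_rhs => rw [← hb.sum_coord (k.trans h) s, Finset.smul_sum]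
  refine Finset.sum_congr rfl fun i _ ↦ ?_
  rw [smul_smul, Finset.sum_mul, Finset.sum_smul]
  exact Finset.sum_congr rfl fun j _ ↦ h₁ i j

end Frames

/-! ### The decomposition of endomorphisms into traceless and scalar parts. -/

section Projection

variable {X : Scheme.{u}} {E : X.Modules} {r : ℕ} [IsLocallyFreeOfRank E r]

variable (E r) in
/-- The function `c` is an inverse of the rank of `E` on the sections of `E`. -/
def IsInvRank (c : Γ(X, (⊤ : X.Opens))) : Prop :=
  ∀ (V : X.Opens) (s : Γ(E, V)), (resO le_top c * (r : Γ(X, V))) • s = s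

variable (E r) in
-- In rank 0 the module `E` is zero and any function qualifies; this is why the inverse of the rank
-- is only required to act as such on `E`, which keeps the case `r = 0` uniform with the others.
theorem exists_isInvRank (hX : ∀ n : ℕ, n ≠ 0 → IsUnit (n : Γ(X, (⊤ : X.Opens)))) :
    ∃ c, IsInvRank E r c := by
  rcases Nat.eq_zero_or_pos r with rfl | hr
  · refine ⟨0, fun V s ↦ eq_of_local E _ _ fun x hx ↦ ?_⟩
    obtain ⟨W, hxW, hW, e, he⟩ := exists_frame_le E 0 hx
    refine ⟨W, hxW, hW, ?_⟩
    have h₁ : ∀ t : Γ(E, W), t = 0 := fun t ↦ by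
      rw [← he.sum_coord le_rfl t]
      exact Finset.sum_of_isEmpty _
    rw [h₁ (res E hW _), h₁ (res E hW s)]
  · obtain ⟨c, hc⟩ := (hX r hr.ne').exists_left_inv
    refine ⟨c, fun V s ↦ ?_⟩
    rw [← map_natCast (resO (X := X) (le_top : V ≤ ⊤)) r, ← map_mul, hc, map_one, one_smul]

omit [IsLocallyFreeOfRank E r] in
theorem IsInvRank.smul_gl {c : Γ(X, (⊤ : X.Opens))} (hc : IsInvRank E r c) {V : X.Opens}
    (φ : Γ(gl E, V)) : (resO le_top c * (r : Γ(X, V))) • φ = φ :=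
  lin_ext fun W h s ↦ by
    rw [ev_smul, map_mul, resO_resO, map_natCast, hc W]

/-- The traceless part of an endomorphism. -/
def slPart {c : Γ(X, (⊤ : X.Opens))} (hc : IsInvRank E r c) {V : X.Opens} (φ : Γ(gl E, V)) :
    Γ(sl E r, V) :=
  mkSl (φ - scalarEnd (resO le_top c * tr E r φ)) (by
    rw [tr_sub, tr_scalarEnd, mul_right_comm, ← tr_smul, hc.smul_gl, sub_self])

theorem slVal_slPart {c : Γ(X, (⊤ : X.Opens))} (hc : IsInvRank E r c) {V : X.Opens}
    (φ : Γ(gl E, V)) : slVal (slPart hc φ) = φ - scalarEnd (resO le_top c * tr E r φ) := rfl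

theorem smul_scalarEnd {U : X.Opens} (f g : Γ(X, U)) :
    (f • scalarEnd g : Γ(gl E, U)) = scalarEnd (f * g) :=
  lin_ext fun V h s ↦ by
    rw [ev_smul, ev_scalarEnd, ev_scalarEnd, map_mul, mul_smul]

theorem res_scalarEnd {U V : X.Opens} (h : V ≤ U) (f : Γ(X, U)) :
    res (gl E) h (scalarEnd f) = scalarEnd (resO h f) :=
  lin_ext fun W k s ↦ by
    rw [ev_res, ev_scalarEnd, ev_scalarEnd, resO_resO]

variable (E) in
/-- The morphism `φ ↦ c tr(φ)`. -/
def scaledTrace (r : ℕ) [IsLocallyFreeOfRank E r] (c : Γ(X, (⊤ : X.Opens))) : gl E ⟶ unitMod X :=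
  mkHom (M := gl E) (N := unitMod X)
    (fun V ↦ AddMonoidHom.mk' (fun φ ↦ (resO le_top c * tr E r φ : Γ(X, V))) (fun φ ψ ↦
      have h : resO le_top c * tr E r (φ + ψ) = resO le_top c * tr E r φ + resO le_top c * tr E r ψ :=
        by rw [tr_add, mul_add]
      h))
    (fun V f φ ↦
      have h : resO le_top c * tr E r (f • φ) = f * (resO le_top c * tr E r φ) := by
        rw [tr_smul, mul_left_comm]
      h)
    (fun {U V} h φ ↦ by
      change resO le_top c * tr E r (res (gl E) h φ) = resO h (resO le_top c * tr E r φ)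
      rw [tr_res, map_mul, resO_resO])

/-- The projection `𝔤𝔩(E) → 𝔰𝔩(E)` to the traceless part. -/
def slProj {c : Γ(X, (⊤ : X.Opens))} (hc : IsInvRank E r c) : gl E ⟶ sl E r :=
  mkHom (M := gl E) (N := sl E r)
    (fun V ↦ AddMonoidHom.mk' (fun φ ↦ slPart hc φ) (fun φ ψ ↦ slVal_injective <| by
      rw [map_add, slVal_slPart, slVal_slPart, slVal_slPart, tr_add, mul_add, scalarEnd_add]
      abel))
    (fun V f φ ↦ slVal_injective <| by
      refine Eq.trans ?_ (map_smul slVal f (slPart hc φ)).symm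
      change slVal (slPart hc (f • φ)) = _
      rw [slVal_slPart, slVal_slPart, tr_smul, smul_sub, smul_scalarEnd, mul_left_comm])
    (fun {U V} h φ ↦ slVal_injective <| by
      change slVal (slPart hc (res (gl E) h φ)) = slVal (res (sl E r) h (slPart hc φ))
      rw [slVal_res, slVal_slPart, slVal_slPart, tr_res, map_sub, res_scalarEnd, map_mul, resO_resO])

theorem slProj_app {c : Γ(X, (⊤ : X.Opens))} (hc : IsInvRank E r c) {V : X.Opens}
    (φ : Γ(gl E, V)) : (slProj hc).app V φ = slPart hc φ := rfl

theorem slIncl_slProj {c : Γ(X, (⊤ : X.Opens))} (hc : IsInvRank E r c) :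
    slIncl E r ≫ slProj hc = 𝟙 (sl E r) :=
  hom_ext_sections fun U a ↦ slVal_injective <| by
    change slVal (slPart hc (slVal a)) = slVal a
    rw [slVal_slPart, tr_slVal, mul_zero, sub_eq_self]
    refine lin_ext fun V h s ↦ ?_
    rw [ev_scalarEnd, map_zero, zero_smul]
    rfl

theorem slPart_scalarEnd {c : Γ(X, (⊤ : X.Opens))} (hc : IsInvRank E r c) {V : X.Opens}
    (f : Γ(X, V)) : slPart hc (scalarEnd f) = 0 :=
  slVal_injective <| by
    rw [slVal_slPart, tr_scalarEnd, mul_left_comm, mul_comm f, ← smul_scalarEnd, hc.smul_gl,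
      sub_self, map_zero]

theorem scalars_slProj {c : Γ(X, (⊤ : X.Opens))} (hc : IsInvRank E r c) :
    scalars E ≫ slProj hc = 0 :=
  hom_ext_sections fun _ f ↦ slPart_scalarEnd hc f

/-- With `slIncl_slProj` and `scalars_slProj` this is all of the splitting that the traceless part
needs. The scalars need not embed in 𝔤𝔩(E): for `r = 0` they act as zero. -/
theorem slProj_slIncl_add {c : Γ(X, (⊤ : X.Opens))} (hc : IsInvRank E r c) :
    slProj hc ≫ slIncl E r + scaledTrace E r c ≫ scalars E = 𝟙 (gl E) :=
  hom_ext_sections fun _ φ ↦ sub_add_cancel φ (scalarEnd (resO le_top c * tr E r φ))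

end Projection

/-! ### Commutators and the trace pairing as bilinear maps. -/

section Commutators

variable {X : Scheme.{u}} {E : X.Modules} {r : ℕ}

/-- Left multiplication of endomorphisms. -/
def glMulLeft {U : X.Opens} (φ : Γ(gl E, U)) : Γ(gl E, U) →ₗ[Γ(X, U)] Γ(gl E, U) where
  toFun ψ := glMul φ ψ
  map_add' := glMul_add φ
  map_smul' f ψ := glMul_smul f φ ψ

theorem glMul_sub {U : X.Opens} (φ ψ ψ' : Γ(gl E, U)) :
    glMul φ (ψ - ψ') = glMul φ ψ - glMul φ ψ' := map_sub (glMulLeft φ) ψ ψ'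

theorem glMul_sum {U : X.Opens} {ι : Type} [Fintype ι] (φ : Γ(gl E, U)) (ψ : ι → Γ(gl E, U)) :
    glMul φ (∑ i, ψ i) = ∑ i, glMul φ (ψ i) := map_sum (glMulLeft φ) ψ _

/-- Right multiplication of endomorphisms. -/
def glMulRight {U : X.Opens} (ψ : Γ(gl E, U)) : Γ(gl E, U) →ₗ[Γ(X, U)] Γ(gl E, U) where
  toFun φ := glMul φ ψ
  map_add' _ _ := rfl
  map_smul' _ _ := rfl

theorem sub_glMul {U : X.Opens} (φ φ' ψ : Γ(gl E, U)) :
    glMul (φ - φ') ψ = glMul φ ψ - glMul φ' ψ := map_sub (glMulRight ψ) φ φ'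

theorem sum_glMul {U : X.Opens} {ι : Type} [Fintype ι] (φ : ι → Γ(gl E, U)) (ψ : Γ(gl E, U)) :
    glMul (∑ i, φ i) ψ = ∑ i, glMul (φ i) ψ := map_sum (glMulRight ψ) φ _

theorem scalarEnd_glMul {U : X.Opens} (f : Γ(X, U)) (φ : Γ(gl E, U)) :
    glMul (scalarEnd f) φ = f • φ := rfl

theorem glMul_scalarEnd {U : X.Opens} (f : Γ(X, U)) (φ : Γ(gl E, U)) :
    glMul φ (scalarEnd f) = f • φ :=
  lin_ext fun _ h s ↦ (ev φ h).map_smul (resO h f) s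

variable [IsLocallyFreeOfRank E r]

variable (r) in
/-- The commutator of endomorphisms, as a traceless endomorphism. -/
def slComm {U : X.Opens} (φ ψ : Γ(gl E, U)) : Γ(sl E r, U) :=
  mkSl (glMul φ ψ - glMul ψ φ) (by rw [tr_sub, tr_mul_comm, sub_self])

theorem slVal_slComm {U : X.Opens} (φ ψ : Γ(gl E, U)) :
    slVal (slComm r φ ψ) = glMul φ ψ - glMul ψ φ := rfl

theorem slBracket_eq {U : X.Opens} (a b : Γ(sl E r, U)) :
    slBracket a b = slComm r (slVal a) (slVal b) := rfl

/-- The commutator as a bilinear map. -/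
def slCommHom (r : ℕ) [IsLocallyFreeOfRank E r] (U : X.Opens) :
    Γ(gl E, U) →ₗ[Γ(X, U)] Γ(gl E, U) →ₗ[Γ(X, U)] Γ(sl E r, U) :=
  LinearMap.mk₂ Γ(X, U) (slComm r)
    (fun a a' b ↦ slVal_injective <| by
      simp only [slVal_slComm, map_add, add_glMul, glMul_add]; abel)
    (fun f a b ↦ slVal_injective <| by
      simp only [slVal_slComm, map_smul, smul_glMul, glMul_smul, smul_sub])
    (fun a b b' ↦ slVal_injective <| by
      simp only [slVal_slComm, map_add, add_glMul, glMul_add]; abel)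
    (fun f a b ↦ slVal_injective <| by
      simp only [slVal_slComm, map_smul, smul_glMul, glMul_smul, smul_sub])

theorem slCommHom_apply {U : X.Opens} (φ ψ : Γ(gl E, U)) :
    slCommHom r U φ ψ = slComm r φ ψ := rfl

theorem slCommHom_res {U V : X.Opens} (h : V ≤ U) (φ ψ : Γ(gl E, U)) :
    slCommHom r V (res (gl E) h φ) (res (gl E) h ψ) = res (sl E r) h (slCommHom r U φ ψ) :=
  slVal_injective <| by
    rw [slVal_res, slCommHom_apply, slCommHom_apply, slVal_slComm, slVal_slComm, map_sub,
      glMul_res, glMul_res]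

theorem slCommHom_swap {U : X.Opens} (φ ψ : Γ(gl E, U)) :
    slCommHom r U φ ψ = -slCommHom r U ψ φ :=
  slVal_injective <| by
    rw [map_neg, slCommHom_apply, slCommHom_apply, slVal_slComm, slVal_slComm, neg_sub]

/-- The trace pairing as a bilinear map. -/
def pairing (E : X.Modules) (r : ℕ) [IsLocallyFreeOfRank E r] (U : X.Opens) :
    Γ(sl E r, U) →ₗ[Γ(X, U)] Γ(sl E r, U) →ₗ[Γ(X, U)] Γ(X, U) :=
  LinearMap.mk₂ Γ(X, U) (tracePairing E r)
    (fun a a' b ↦ by rw [tracePairing, map_add, add_glMul, tr_add]; rfl)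
    (fun f a b ↦ by rw [tracePairing, map_smul, smul_glMul, tr_smul]; rfl)
    (fun a b b' ↦ by rw [tracePairing, map_add, glMul_add, tr_add]; rfl)
    (fun f a b ↦ by rw [tracePairing, map_smul, glMul_smul, tr_smul]; rfl)

theorem pairing_apply {U : X.Opens} (a b : Γ(sl E r, U)) :
    pairing E r U a b = tr E r (glMul (slVal a) (slVal b)) := rfl

theorem pairing_comm {U : X.Opens} (a b : Γ(sl E r, U)) : pairing E r U a b = pairing E r U b a :=
  tr_mul_comm E r _ _

theorem pairing_res {U V : X.Opens} (h : V ≤ U) (a b : Γ(sl E r, U)) :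
    pairing E r V (res (sl E r) h a) (res (sl E r) h b) = resO h (pairing E r U a b) := by
  rw [pairing_apply, pairing_apply, slVal_res, slVal_res, ← glMul_res, tr_res]

end Commutators

/-! ### Dual families and the Casimir identity. -/

section DualSystems

variable {X : Scheme.{u}} {E : X.Modules} {r : ℕ} [IsLocallyFreeOfRank E r]

/-- Two families of sections of `𝔰𝔩(E)` over `V` that are dual for the trace pairing. -/
structure DualSystem (E : X.Modules) (r : ℕ) [IsLocallyFreeOfRank E r] (V : X.Opens) (ι : Type)
    [Fintype ι] where
  fst : ι → Γ(sl E r, V)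
  snd : ι → Γ(sl E r, V)
  -- Only this expansion is required, not that the families be bases: the r² traceless parts of the
  -- matrix units serve, without choosing a basis of 𝔰𝔩(E).
  sum_snd : ∀ {W : X.Opens} (h : W ≤ V) (x : Γ(sl E r, W)),
    ∑ i, pairing E r W (res (sl E r) h (fst i)) x • res (sl E r) h (snd i) = x

namespace DualSystem

variable {V : X.Opens} {ι : Type} [Fintype ι] (d : DualSystem E r V ι)

/-- The trace pairing is nondegenerate, since the coefficients in the expansion of `z` are pairings
with `z`. -/
theorem eq_zero_of_pairing (d : DualSystem E r V ι) {W : X.Opens} (h : W ≤ V) (z : Γ(sl E r, W))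
    (hz : ∀ x, pairing E r W z x = 0) : z = 0 := by
  rw [← d.sum_snd h z]
  refine Finset.sum_eq_zero fun i _ ↦ ?_
  rw [pairing_comm, hz, zero_smul]

/-- Duality is symmetric in the two families: both sides pair equally with every y, as expanding y
in the second family shows, and the pairing is nondegenerate. -/
theorem sum_fst {W : X.Opens} (h : W ≤ V) (x : Γ(sl E r, W)) :
    ∑ i, pairing E r W (res (sl E r) h (d.snd i)) x • res (sl E r) h (d.fst i) = x := by
  refine sub_eq_zero.1 (d.eq_zero_of_pairing h _ fun y ↦ ?_)
  rw [map_sub, LinearMap.sub_apply, sub_eq_zero, map_sum, LinearMap.sum_apply]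
  conv_rhs => rw [← d.sum_snd h y, map_sum]
  refine Finset.sum_congr rfl fun i _ ↦ ?_
  rw [map_smul, map_smul, LinearMap.smul_apply, smul_eq_mul, smul_eq_mul, mul_comm,
    pairing_comm x]

theorem sum_snd_self (x : Γ(sl E r, V)) : ∑ i, pairing E r V (d.fst i) x • d.snd i = x := by
  have := d.sum_snd le_rfl x
  simpa only [res_self] using this

theorem sum_fst_self (x : Γ(sl E r, V)) : ∑ i, pairing E r V (d.snd i) x • d.fst i = x := by
  have := d.sum_fst le_rfl x
  simpa only [res_self] using this

/-- The restriction of dual families. -/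
def restrict {W : X.Opens} (h : W ≤ V) : DualSystem E r W ι where
  fst i := res (sl E r) h (d.fst i)
  snd i := res (sl E r) h (d.snd i)
  sum_snd k x := by
    simp only [res_res]
    exact d.sum_snd (k.trans h) x

/-- Dual families generate `𝔰𝔩(E)`. -/
def localGen : LocalGen (sl E r) V ι where
  gen := d.snd
  coord i := mkHom (fun U ↦ AddMonoidHom.mk' (fun x ↦ mkStarFun (pairing E r (U ⊓ V)
      (res (sl E r) inf_le_right (d.fst i)) (res (sl E r) inf_le_left x)))
      (fun x y ↦ by rw [map_add, map_add, map_add]))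
    (fun U f x ↦ starFun_injective <| by
      rw [starFun_smul]
      change pairing E r (U ⊓ V) _ (res (sl E r) inf_le_left (f • x)) =
        resO inf_le_left f * pairing E r (U ⊓ V) _ _
      rw [res_smul, map_smul, smul_eq_mul])
    (fun {U W} h x ↦ starFun_injective <| by
      rw [starFun_res]
      change pairing E r (W ⊓ V) _ (res (sl E r) inf_le_left (res (sl E r) h x)) =
        resO _ (pairing E r (U ⊓ V) _ _)
      rw [← pairing_res, res_res, res_res, res_res])
  sum_coord U x := d.sum_snd inf_le_right (res (sl E r) inf_le_left x)

/-- Expanding aᵢ in the bⱼ turns the sum into ∑ t(aⱼ, aᵢ) [bⱼ, bᵢ], a symmetric coefficient against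
an antisymmetric bracket. The sum equals its own negative, and 2 is invertible. -/
theorem sum_bracket (h₂ : IsUnit (2 : Γ(X, (⊤ : X.Opens)))) :
    ∑ i, slBracket (d.fst i) (d.snd i) = 0 := by
  have h : ∑ i, slBracket (d.fst i) (d.snd i) = -∑ i, slBracket (d.fst i) (d.snd i) := by
    have h₁ : ∑ i, slBracket (d.fst i) (d.snd i) =
        ∑ i, ∑ j, pairing E r V (d.fst j) (d.fst i) •
          slCommHom r V (slVal (d.snd j)) (slVal (d.snd i)) := by
      refine Finset.sum_congr rfl fun i _ ↦ ?_
      rw [slBracket_eq, ← slCommHom_apply]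
      conv_lhs => rw [← d.sum_snd_self (d.fst i), map_sum, map_sum, LinearMap.sum_apply]
      refine Finset.sum_congr rfl fun j _ ↦ ?_
      rw [map_smul, map_smul, LinearMap.smul_apply]
    conv_rhs => rw [h₁, Finset.sum_comm]
    rw [h₁, ← Finset.sum_neg_distrib]
    refine Finset.sum_congr rfl fun i _ ↦ ?_
    rw [← Finset.sum_neg_distrib]
    refine Finset.sum_congr rfl fun j _ ↦ ?_
    rw [slCommHom_swap, smul_neg, pairing_comm]
  have h₃ : (2 : Γ(X, V)) • ∑ i, slBracket (d.fst i) (d.snd i) = 0 := by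
    rw [two_smul]
    exact add_eq_zero_iff_eq_neg.2 h
  have h₄ : IsUnit (2 : Γ(X, V)) := by
    have := h₂.map (resO (X := X) (le_top : V ≤ ⊤))
    rwa [map_ofNat] at this
  exact h₄.smul_eq_zero.1 h₃

end DualSystem

/-- The dual families given by a frame: the traceless parts of the elementary endomorphisms. -/
def IsFrame.dualSystem {V : X.Opens} {b : Fin r → Γ(E, V)} (hb : IsFrame E b)
    {c : Γ(X, (⊤ : X.Opens))} (hc : IsInvRank E r c) : DualSystem E r V (Fin r × Fin r) where
  fst k := slPart hc (hb.matUnit k.1 k.2)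
  snd k := slPart hc (hb.matUnit k.2 k.1)
  sum_snd {W} h x := by
    -- As x is traceless, the scalar part of the matrix unit does not contribute to the pairing.
    have h₁ : ∀ k : Fin r × Fin r, pairing E r W (res (sl E r) h (slPart hc (hb.matUnit k.1 k.2))) x =
        tr E r (glMul (res (gl E) h (hb.matUnit k.1 k.2)) (slVal x)) := fun k ↦ by
      rw [pairing_apply, slVal_res, slVal_slPart, map_sub, sub_glMul, tr_sub, res_scalarEnd,
        scalarEnd_glMul, tr_smul, tr_slVal, mul_zero, sub_zero]
    simp only [h₁]
    -- The expansion of x in matrix units is projected to 𝔰𝔩(E), where x is its own traceless part.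
    have h₂ := congrArg ((slProj hc).app W) (hb.sum_tr_matUnit h (slVal x))
    rw [map_sum] at h₂
    refine Eq.trans (Finset.sum_congr rfl fun k _ ↦ ?_) (h₂.trans ?_)
    · rw [Scheme.Modules.Hom.app_smul, app_res, slProj_app]
    · exact congrArg (fun f ↦ f.app W x) (slIncl_slProj hc)

theorem IsFrame.slVal_dualSystem_fst {U V : X.Opens} {b : Fin r → Γ(E, V)} (hb : IsFrame E b)
    {c : Γ(X, (⊤ : X.Opens))} (hc : IsInvRank E r c) (h : U ≤ V) (k : Fin r × Fin r) :
    slVal (((hb.dualSystem hc).restrict h).fst k) = res (gl E) h (hb.matUnit k.1 k.2) -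
      scalarEnd (resO h (resO le_top c * tr E r (hb.matUnit k.1 k.2))) := by
  rw [← res_scalarEnd, ← map_sub]
  rfl

theorem IsFrame.slVal_dualSystem_snd {U V : X.Opens} {b : Fin r → Γ(E, V)} (hb : IsFrame E b)
    {c : Γ(X, (⊤ : X.Opens))} (hc : IsInvRank E r c) (h : U ≤ V) (k : Fin r × Fin r) :
    slVal (((hb.dualSystem hc).restrict h).snd k) = res (gl E) h (hb.matUnit k.2 k.1) -
      scalarEnd (resO h (resO le_top c * tr E r (hb.matUnit k.2 k.1))) := by
  rw [← res_scalarEnd, ← map_sub]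
  rfl

theorem slComm_scalarEnd_left {U : X.Opens} (φ ψ : Γ(gl E, U)) (f : Γ(X, U)) :
    slComm r (φ - scalarEnd f) ψ = slComm r φ ψ :=
  slVal_injective <| by
    rw [slVal_slComm, slVal_slComm, sub_glMul, glMul_sub, scalarEnd_glMul, glMul_scalarEnd,
      sub_sub_sub_cancel_right]

/-- Scalars are central, so the families may be replaced by matrix units. Then ∑ [eᵢⱼ, [φ, eⱼᵢ]]
consists of two sums of the form ∑ e φ e, each equal to tr(φ), minus r φ twice: the Casimir element
of the trace form acts on 𝔰𝔩(E) by 2r, up to the sign from the order in the inner bracket. -/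
theorem IsFrame.casimir {U V : X.Opens} {b : Fin r → Γ(E, V)} (hb : IsFrame E b)
    {c : Γ(X, (⊤ : X.Opens))} (hc : IsInvRank E r c) (h : U ≤ V) (φ : Γ(gl E, U)) :
    ∑ k, slComm r (slVal (((hb.dualSystem hc).restrict h).fst k))
      (glMul φ (slVal (((hb.dualSystem hc).restrict h).snd k)) - glMul (slVal (((hb.dualSystem hc).restrict h).snd k)) φ) =
        -((2 * r) • slPart hc φ) := by
  -- The factor `scalarEnd 1` is inserted so that ∑ eᵢⱼ eⱼᵢ is a case of `IsFrame.sum_matUnit_mul`,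
  -- with trace r.
  have h₁ : ∀ k : Fin r × Fin r, slVal (slComm r (slVal (((hb.dualSystem hc).restrict h).fst k))
      (glMul φ (slVal (((hb.dualSystem hc).restrict h).snd k)) - glMul (slVal (((hb.dualSystem hc).restrict h).snd k)) φ)) =
      glMul (res (gl E) h (hb.matUnit k.1 k.2)) (glMul φ (res (gl E) h (hb.matUnit k.2 k.1))) -
        glMul (glMul (res (gl E) h (hb.matUnit k.1 k.2)) (glMul (scalarEnd 1) (res (gl E) h (hb.matUnit k.2 k.1)))) φ -
        (glMul φ (glMul (res (gl E) h (hb.matUnit k.2 k.1)) (glMul (scalarEnd 1) (res (gl E) h (hb.matUnit k.1 k.2)))) -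
          glMul (res (gl E) h (hb.matUnit k.2 k.1)) (glMul φ (res (gl E) h (hb.matUnit k.1 k.2)))) := fun k ↦ by
    have h₂ : glMul φ (slVal (((hb.dualSystem hc).restrict h).snd k)) -
        glMul (slVal (((hb.dualSystem hc).restrict h).snd k)) φ =
          glMul φ (res (gl E) h (hb.matUnit k.2 k.1)) - glMul (res (gl E) h (hb.matUnit k.2 k.1)) φ := by
      rw [hb.slVal_dualSystem_snd hc h, sub_glMul, glMul_sub, scalarEnd_glMul, glMul_scalarEnd, sub_sub_sub_cancel_right]
    rw [h₂, hb.slVal_dualSystem_fst hc h, slComm_scalarEnd_left, slVal_slComm, glMul_sub, sub_glMul, scalarEnd_glMul,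
      scalarEnd_glMul, one_smul, one_smul]
    rfl
  have h₃ := hb.sum_matUnit_mul h φ
  have h₄ := hb.sum_matUnit_mul h (scalarEnd 1)
  have h₅ : ∀ ψ : Γ(gl E, U), ∑ k : Fin r × Fin r, glMul (res (gl E) h (hb.matUnit k.2 k.1))
      (glMul ψ (res (gl E) h (hb.matUnit k.1 k.2))) = ∑ k : Fin r × Fin r, glMul (res (gl E) h (hb.matUnit k.1 k.2))
      (glMul ψ (res (gl E) h (hb.matUnit k.2 k.1))) := fun ψ ↦ (Equiv.prodComm _ _).sum_comp
    (fun k : Fin r × Fin r ↦ glMul (res (gl E) h (hb.matUnit k.1 k.2)) (glMul ψ (res (gl E) h (hb.matUnit k.2 k.1))))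
  refine slVal_injective ?_
  rw [map_sum, map_neg, map_nsmul, slVal_slPart]
  simp only [h₁]
  rw [Finset.sum_sub_distrib, Finset.sum_sub_distrib, Finset.sum_sub_distrib, ← sum_glMul,
    ← glMul_sum, h₅, h₅, h₃, h₄, tr_scalarEnd, one_mul, glMul_scalarEnd, scalarEnd_glMul]
  -- Holds for `r = 0` as well, because `c` inverts the rank on the sections of `E`.
  have h₆ : (r : Γ(X, U)) • (scalarEnd (resO le_top c * tr E r φ) : Γ(gl E, U)) =
      scalarEnd (tr E r φ) := by
    rw [smul_scalarEnd, ← mul_assoc, mul_comm (r : Γ(X, U)), ← smul_scalarEnd, hc.smul_gl]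
  rw [mul_comm, mul_nsmul, ← Nat.cast_smul_eq_nsmul Γ(X, U) r, smul_sub, h₆]
  generalize (scalarEnd (tr E r φ) : Γ(gl E, U)) = A
  generalize (r : Γ(X, U)) • φ = B
  rw [two_nsmul]
  abel

end DualSystems

/-! ### Existence and uniqueness of the dual of the trace pairing. -/

section TraceDual

variable {X : Scheme.{u}} {E : X.Modules} {r : ℕ} [IsLocallyFreeOfRank E r]

theorem ev_contraction_tmul {U : X.Opens} (a b : Γ(sl E r, U)) {V : X.Opens} (h : V ≤ U)
    (x : Γ(sl E r, V)) : ev ((contraction E r).app U (tmul a b)) h x =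
      pairing E r V (res (sl E r) h a) x • res (sl E r) h b :=
  congrArg (fun φ : Γ(sheafHom (sl E r) (sl E r), U) ↦ ev φ h x) (lift_tmul _ _ a b)

namespace DualSystem

variable {V : X.Opens} {ι : Type} [Fintype ι] (d : DualSystem E r V ι)

/-- The section of `𝔰𝔩(E) ⊗ 𝔰𝔩(E)` given by dual families. -/
def tensor : Γ(tensor (sl E r) (sl E r), V) := ∑ i, tmul (d.fst i) (d.snd i)

theorem contraction_tensor : (contraction E r).app V d.tensor = idSection (sl E r) V :=
  lin_ext fun W h x ↦ by
    rw [tensor, map_sum, ev_sum]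
    simp only [ev_contraction_tmul]
    exact d.sum_snd h x

/-- The map `χ ↦ ∑ aᵢ ⊗ χ(bᵢ)` inverse to the contraction. -/
def invContraction : sheafHom (sl E r) (sl E r) ⟶
    starRes V (HitchinSymbol.tensor (sl E r) (sl E r)) :=
  mkHom (M := sheafHom (sl E r) (sl E r)) (fun U ↦ AddMonoidHom.mk' (fun χ ↦ mkStar
      (∑ i, tmul (res (sl E r) inf_le_right (d.fst i))
        (ev χ inf_le_left (res (sl E r) inf_le_right (d.snd i)))))
      (fun χ χ' ↦ by
        rw [← map_add, ← Finset.sum_add_distrib]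
        refine congrArg mkStar (Finset.sum_congr rfl fun i _ ↦ ?_)
        rw [ev_add, tmul_add]))
    (fun U f χ ↦ starVal_injective <| by
      rw [starVal_smul]
      change ∑ i, tmul _ (ev (f • χ) inf_le_left _) = resO inf_le_left f • ∑ i, tmul _ _
      rw [Finset.smul_sum]
      exact Finset.sum_congr rfl fun i _ ↦ by rw [ev_smul, tmul_smul])
    (fun {U W} h χ ↦ starVal_injective <| by
      rw [starVal_res]
      change ∑ i, tmul _ (ev (res (sheafHom (sl E r) (sl E r)) h χ) inf_le_left _) =
        res _ (inf_le_inf_right V h) (∑ i, tmul _ _)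
      rw [map_sum]
      refine Finset.sum_congr rfl fun i _ ↦ ?_
      rw [res_tmul, res_res, ev_res, ← ev_nat χ inf_le_left (inf_le_inf_right V h), res_res])

/-- The composite sends a ⊗ b to ∑ aᵢ ⊗ t(a, bᵢ) b. Moving the functions across the tensor sign
leaves the expansion of a in the first family. -/
theorem contraction_invContraction : contraction E r ≫ d.invContraction = toStar V _ :=
  tensor_hom_ext fun U a b ↦ starVal_injective <| by
    change ∑ i, tmul (res (sl E r) inf_le_right (d.fst i))
      (ev ((contraction E r).app U (tmul a b)) inf_le_left
        (res (sl E r) inf_le_right (d.snd i))) = res _ inf_le_left (tmul a b)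
    simp only [ev_contraction_tmul]
    rw [res_tmul]
    conv_rhs => rw [← d.sum_fst inf_le_right (res (sl E r) inf_le_left a), sum_tmul]
    refine Finset.sum_congr rfl fun i _ ↦ ?_
    rw [tmul_smul, smul_tmul', pairing_comm]

theorem contraction_injective (d : DualSystem E r V ι) {U : X.Opens} (h : U ≤ V) :
    Function.Injective ((contraction E r).app U) := by
  intro s t hst
  have h₁ : ∀ s, res _ (inf_le_left : U ⊓ V ≤ U) s =
      starVal (d.invContraction.app U ((contraction E r).app U s)) := fun s ↦
    congrArg (fun f ↦ starVal (f.app U s)) d.contraction_invContraction.symm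
  have h₂ := (h₁ s).trans ((congrArg _ (congrArg _ hst)).trans (h₁ t).symm)
  have h₃ := congrArg (res _ (le_inf le_rfl h : U ≤ U ⊓ V)) h₂
  rwa [res_res, res_res, res_self, res_self] at h₃

end DualSystem

theorem res_idSection (M : X.Modules) {U V : X.Opens} (h : V ≤ U) :
    res (sheafHom M M) h (idSection M U) = idSection M V := rfl

/-- There are dual families around each point. -/
theorem exists_dualSystem (E : X.Modules) (r : ℕ) [IsLocallyFreeOfRank E r]
    (hX : ∀ n : ℕ, n ≠ 0 → IsUnit (n : Γ(X, (⊤ : X.Opens)))) (x : X) :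
    ∃ (V : X.Opens) (_ : DualSystem E r V (Fin r × Fin r)), x ∈ V := by
  obtain ⟨c, hc⟩ := exists_isInvRank E r hX
  obtain ⟨V, hxV, b, hb⟩ := IsLocallyFreeOfRank.exists_frame (E := E) (r := r) x
  exact ⟨V, hb.dualSystem hc, hxV⟩

/-- Both sides contract to the identity, and contraction is injective where dual families exist. -/
theorem IsTraceDual.res_eq {Ω : Γ(tensor (sl E r) (sl E r), (⊤ : X.Opens))}
    (hΩ : IsTraceDual E r Ω) {V : X.Opens} {ι : Type} [Fintype ι] (d : DualSystem E r V ι) :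
    res _ le_top Ω = d.tensor := by
  refine d.contraction_injective le_rfl ?_
  rw [d.contraction_tensor, app_res, hΩ, res_idSection]

/-- The local sections ∑ aᵢ ⊗ bᵢ all contract to the identity, so injectivity of the contraction
makes them agree on overlaps and glue; the same injectivity gives uniqueness. -/
theorem existsUnique_isTraceDual (E : X.Modules) (r : ℕ) [IsLocallyFreeOfRank E r]
    (hX : ∀ n : ℕ, n ≠ 0 → IsUnit (n : Γ(X, (⊤ : X.Opens)))) : ∃! Ω, IsTraceDual E r Ω := by
  choose V d hV using exists_dualSystem E r hX
  obtain ⟨Ω, hΩ, -⟩ := glue (tensor (sl E r) (sl E r)) V (fun _ ↦ le_top)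
    (fun x _ ↦ Opens.mem_iSup.2 ⟨x, hV x⟩) (fun x ↦ (d x).tensor) (fun x y ↦ by
      refine (d x).contraction_injective inf_le_left ?_
      rw [app_res, app_res, (d x).contraction_tensor, (d y).contraction_tensor, res_idSection,
        res_idSection])
  refine ⟨Ω, eq_of_local _ _ _ fun x _ ↦ ⟨V x, hV x, le_top, ?_⟩, fun Ω' hΩ' ↦
    eq_of_local _ _ _ fun x _ ↦ ⟨V x, hV x, le_top, ?_⟩⟩
  · rw [← app_res, hΩ, (d x).contraction_tensor, res_idSection]
  · rw [hΩ, IsTraceDual.res_eq hΩ' (d x)]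

end TraceDual

/-! ### The Atiyah algebroid and its commutators with endomorphisms. -/

section AtiyahAlgebroid

variable {C S : Scheme.{u}} {π : C ⟶ S} {E : C.Modules}

/-- A section of the Atiyah algebroid as a pair. -/
def atVal {U : C.Opens} (D : Γ(atiyah π E, U)) : Γ(prodMod (tangent π) (abHom E E), U) :=
  Subtype.val (p := (· ∈ (atiyahSub π E).carrier U)) D

/-- The vector field of a section of the Atiyah algebroid. -/
def atAnchor {U : C.Opens} (D : Γ(atiyah π E, U)) : Γ(tangent π, U) := anchor (atVal D)

/-- The action of a section of the Atiyah algebroid. -/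
def atAct {U : C.Opens} (D : Γ(atiyah π E, U)) {V : C.Opens} (h : V ≤ U) : Γ(E, V) →+ Γ(E, V) :=
  act (atVal D) h

theorem atAct_smul {U : C.Opens} (D : Γ(atiyah π E, U)) {V : C.Opens} (h : V ≤ U) (f : Γ(C, V))
    (e : Γ(E, V)) : atAct D h (f • e) = f • atAct D h e + vf (atAnchor D) h f • e :=
  Subtype.prop (p := (· ∈ (atiyahSub π E).carrier U)) D V h f e

theorem atAct_nat {U : C.Opens} (D : Γ(atiyah π E, U)) {V W : C.Opens} (h : V ≤ U) (k : W ≤ V)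
    (e : Γ(E, V)) : atAct D (k.trans h) (res E k e) = res E k (atAct D h e) := act_nat _ h k e

theorem at_ext {U : C.Opens} {D D' : Γ(atiyah π E, U)} (h : atAnchor D = atAnchor D')
    (h' : ∀ (V : C.Opens) (k : V ≤ U) (e : Γ(E, V)), atAct D k e = atAct D' k e) : D = D' :=
  Subtype.ext (p := (· ∈ (atiyahSub π E).carrier U)) (Prod.ext h (AbHom.ext_apply h'))

/-- A section of the Atiyah algebroid from its vector field and its action. -/
def mkAt {U : C.Opens} (v : Γ(tangent π, U)) (F : ∀ V : C.Opens, V ≤ U → (Γ(E, V) →+ Γ(E, V)))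
    (hF : ∀ {V W : C.Opens} (h : V ≤ U) (k : W ≤ V) (e : Γ(E, V)),
      F W (k.trans h) (res E k e) = res E k (F V h e))
    (hv : ∀ (V : C.Opens) (h : V ≤ U) (f : Γ(C, V)) (e : Γ(E, V)),
      F V h (f • e) = f • F V h e + vf v h f • e) : Γ(atiyah π E, U) :=
  Subtype.mk (p := (· ∈ (atiyahSub π E).carrier U))
    (Prod.mk v (AbHom.mk F (fun h k e ↦ hF h k e) : AbHom E E U)) hv

/-- The commutator of a section of the Atiyah algebroid with an endomorphism. -/
def atComm {U : C.Opens} (D : Γ(atiyah π E, U)) (φ : Γ(gl E, U)) : Γ(gl E, U) :=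
  mkLin (fun V h ↦
    { toFun := fun e ↦ atAct D h (ev φ h e) - ev φ h (atAct D h e)
      map_add' := fun e e' ↦ by
        rw [map_add, map_add, map_add, map_add]
        abel
      map_smul' := fun f e ↦ by
        rw [map_smul, atAct_smul, atAct_smul, map_add, map_smul, map_smul, RingHom.id_apply,
          smul_sub, add_sub_add_right_eq_sub] })
    (fun h k e ↦ by
      change atAct D _ (ev φ _ _) - ev φ _ (atAct D _ _) = res E k (atAct D _ _ - ev φ _ _)
      rw [ev_nat, atAct_nat, atAct_nat, ev_nat, map_sub])

theorem ev_atComm {U : C.Opens} (D : Γ(atiyah π E, U)) (φ : Γ(gl E, U)) {V : C.Opens} (h : V ≤ U)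
    (e : Γ(E, V)) : ev (atComm D φ) h e = atAct D h (ev φ h e) - ev φ h (atAct D h e) := rfl

theorem atComm_add {U : C.Opens} (D : Γ(atiyah π E, U)) (φ ψ : Γ(gl E, U)) :
    atComm D (φ + ψ) = atComm D φ + atComm D ψ :=
  lin_ext fun V h e ↦ by
    rw [ev_add, ev_atComm, ev_atComm, ev_atComm, ev_add, ev_add, map_add]
    abel

theorem atComm_sum {U : C.Opens} {ι : Type} [Fintype ι] (D : Γ(atiyah π E, U))
    (φ : ι → Γ(gl E, U)) : atComm D (∑ i, φ i) = ∑ i, atComm D (φ i) :=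
  map_sum (AddMonoidHom.mk' (atComm D) (atComm_add D)) φ _

/-- The operator [D, ·] on endomorphisms is again a first-order operator over the vector field of D.
The extra term is what compensates a change of dual families. -/
theorem atComm_smul {U : C.Opens} (D : Γ(atiyah π E, U)) (f : Γ(C, U)) (φ : Γ(gl E, U)) :
    atComm D (f • φ) = f • atComm D φ + vf (atAnchor D) le_rfl f • φ :=
  lin_ext fun V h e ↦ by
    have h₁ : resO h (vf (atAnchor D) le_rfl f) = vf (atAnchor D) h (resO h f) :=
      (derApp_nat (atAnchor D) le_rfl h f).symm
    rw [ev_add, ev_smul, ev_smul, ev_atComm, ev_atComm, ev_smul, ev_smul, atAct_smul, smul_sub, h₁]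
    abel

theorem add_atComm {U : C.Opens} (D D' : Γ(atiyah π E, U)) (φ : Γ(gl E, U)) :
    atComm (D + D') φ = atComm D φ + atComm D' φ :=
  lin_ext fun V h e ↦ by
    have h₁ : ∀ e : Γ(E, V), atAct (D + D') h e = atAct D h e + atAct D' h e := fun _ ↦ rfl
    rw [ev_add, ev_atComm, ev_atComm, ev_atComm, h₁, h₁, map_add]
    abel

theorem smul_atComm {U : C.Opens} (f : Γ(C, U)) (D : Γ(atiyah π E, U)) (φ : Γ(gl E, U)) :
    atComm (f • D) φ = f • atComm D φ :=
  lin_ext fun V h e ↦ by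
    have h₁ : ∀ e : Γ(E, V), atAct (f • D) h e = resO h f • atAct D h e := fun _ ↦ rfl
    rw [ev_smul, ev_atComm, ev_atComm, h₁, h₁, map_smul, smul_sub]

theorem atComm_gl {U : C.Opens} (φ ψ : Γ(gl E, U)) :
    atComm ((glToAtiyah π E).app U φ) ψ = glMul φ ψ - glMul ψ φ :=
  lin_ext fun V h e ↦ by
    rw [ev_sub]
    rfl

theorem glToAtiyah_injective (U : C.Opens) : Function.Injective ((glToAtiyah π E).app U) := by
  intro φ ψ h
  exact lin_ext fun V k e ↦ congrArg (fun D : Γ(atiyah π E, U) ↦ atAct D k e) h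

theorem exists_glToAtiyah_eq {U : C.Opens} (D : Γ(atiyah π E, U)) (hD : atAnchor D = 0) :
    ∃ φ : Γ(gl E, U), (glToAtiyah π E).app U φ = D := by
  refine ⟨mkLin (fun V h ↦
    { toFun := atAct D h
      map_add' := map_add _
      map_smul' := fun f e ↦ by
        have h₁ : vf (atAnchor D) h f = 0 := by rw [hD]; rfl
        rw [atAct_smul, h₁, zero_smul, add_zero, RingHom.id_apply] })
    (fun h k e ↦ atAct_nat D h k e), at_ext hD.symm fun V k e ↦ rfl⟩

/-- A frame gives a connection for which the frame is flat: differentiate the coordinates. -/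
theorem IsFrame.exists_atAnchor_eq {r : ℕ} {V : C.Opens} {b : Fin r → Γ(E, V)} (hb : IsFrame E b)
    (v : Γ(tangent π, V)) : ∃ D : Γ(atiyah π E, V), atAnchor D = v := by
  refine ⟨mkAt v (fun W h ↦ AddMonoidHom.mk'
    (fun e ↦ ∑ j, vf v h (hb.coord j h e) • res E h (b j)) (fun e e' ↦ by
      rw [← Finset.sum_add_distrib]
      exact Finset.sum_congr rfl fun j _ ↦ by rw [map_add, map_add, add_smul]))
    (fun {W W'} h k e ↦ ?_) (fun W h f e ↦ ?_), rfl⟩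
  · change ∑ j, vf v (k.trans h) (hb.coord j (k.trans h) (res E k e)) • res E (k.trans h) (b j) =
      res E k (∑ j, vf v h (hb.coord j h e) • res E h (b j))
    rw [map_sum]
    refine Finset.sum_congr rfl fun j _ ↦ ?_
    rw [res_smul, res_res, hb.coord_res j h k]
    exact congrArg (· • _) (derApp_nat v h k _)
  · change ∑ j, vf v h (hb.coord j h (f • e)) • res E h (b j) =
      f • ∑ j, vf v h (hb.coord j h e) • res E h (b j) + vf v h f • e
    conv_rhs => rw [← hb.sum_coord h e]
    simp only [hb.coord_sum]
    rw [Finset.smul_sum, Finset.smul_sum, ← Finset.sum_add_distrib]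
    refine Finset.sum_congr rfl fun j _ ↦ ?_
    have h₁ : vf v h (f * hb.coord j h e) = f * vf v h (hb.coord j h e) + hb.coord j h e * vf v h f :=
      derApp_mul v h f _
    rw [map_smul, smul_eq_mul, h₁, add_smul, mul_smul, mul_smul, smul_comm (vf v h f)]

/-- Surjectivity survives the direct image because the diagonal is closed: away from it the target
vanishes, and near it a lift exists over the trace on the curve of a small open set. -/
theorem exists_local_atAnchor [IsSeparated π] (r : ℕ) [IsLocallyFreeOfRank E r]
    {U : (square π).Opens} (v : Γ((diagPush π).obj (tangent π), U)) {z : square π} (hz : z ∈ U) :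
    ∃ W : (square π).Opens, z ∈ W ∧ ∃ (h : W ≤ U) (D : Γ((diagPush π).obj (atiyah π E), W)),
      ((diagPush π).map (atiyahToTangent π E)).app W D =
        res ((diagPush π).obj (tangent π)) h v := by
  by_cases hd : ∃ y : C, diag π y = z
  · obtain ⟨y, rfl⟩ := hd
    have hy : y ∈ diag π ⁻¹ᵁ U := hz
    obtain ⟨V, hyV, hVU, e, he⟩ := exists_frame_le E r hy
    obtain ⟨D, hD⟩ := he.exists_atAnchor_eq (res (tangent π) hVU v)
    refine ⟨around U V, le_around hVU hyV, around_le U V,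
      res (atiyah π E) (diag_around_le U V) D, ?_⟩
    refine (app_res (atiyahToTangent π E) (diag_around_le U V) D).trans ?_
    refine (congrArg (res (tangent π) (diag_around_le U V)) hD).trans ?_
    exact res_res (tangent π) hVU (diag_around_le U V) _
  · obtain ⟨W, hzW, hWU, hW⟩ := exists_disjoint (fun y hy ↦ hd ⟨y, hy⟩) hz
    exact ⟨W, hzW, hWU, 0, subsingleton_of_disjoint (tangent π) hW
      (((diagPush π).map (atiyahToTangent π E)).app W 0)
      (res ((diagPush π).obj (tangent π)) hWU v)⟩

theorem atiyahSequence_locallyExact [IsSeparated π] (E : C.Modules) (r : ℕ)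
    [IsLocallyFreeOfRank E r] : LocallyExact ((atiyahSequence π E).map (diagPush π)) where
  injective U φ ψ h := glToAtiyah_injective (π := π) (E := E) (diag π ⁻¹ᵁ U) h
  exact U D hD z hz := by
    obtain ⟨φ, hφ⟩ := exists_glToAtiyah_eq (U := diag π ⁻¹ᵁ U) D hD
    refine ⟨U, hz, le_rfl, φ, ?_⟩
    refine Eq.trans hφ ?_
    exact (res_self (atiyah π E) (U := diag π ⁻¹ᵁ U) le_rfl D).symm
  surjective U v z hz := exists_local_atAnchor r v hz

end AtiyahAlgebroid

/-! ### The fibre product of two extensions. -/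

section FibreProduct

variable {X : Scheme.{u}}

/-- The fibre product of two `𝒪_X`-modules, as a subsheaf of the product. -/
def fibreProd {A B T : X.Modules} (f : A ⟶ T) (g : B ⟶ T) : LocalSub (prodMod A B) where
  carrier U :=
    { carrier := {p : Γ(A, U) × Γ(B, U) | f.app U p.1 = g.app U p.2}
      zero_mem' := (map_zero (f.app U).hom).trans (map_zero (g.app U).hom).symm
      add_mem' := fun {p q} hp hq ↦ (map_add (f.app U).hom p.1 q.1).trans
        ((congrArg₂ (· + ·) hp hq).trans (map_add (g.app U).hom p.2 q.2).symm)
      smul_mem' := fun c p hp ↦ (Scheme.Modules.Hom.app_smul f c p.1).trans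
        ((congrArg (c • ·) hp).trans (Scheme.Modules.Hom.app_smul g c p.2).symm) }
  res_mem h p hp := (app_res f h p.1).trans ((congrArg _ hp).trans (app_res g h p.2).symm)
  of_local p H := eq_of_local T _ _ fun x hx ↦ by
    obtain ⟨V, hxV, h, hV⟩ := H x hx
    exact ⟨V, hxV, h, (app_res f h p.1).symm.trans (hV.trans (app_res g h p.2))⟩

section

variable {A B T : X.Modules} {f : A ⟶ T} {g : B ⟶ T}

/-- The first projection of a fibre product. -/
def fibFst (f : A ⟶ T) (g : B ⟶ T) : (fibreProd f g).toModules ⟶ A :=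
  mkHom (M := (fibreProd f g).toModules) (N := A)
    (fun U ↦ AddMonoidHom.mk' (fun p ↦ Prod.fst (α := Γ(A, U)) (β := Γ(B, U))
      (Subtype.val (p := (· ∈ (fibreProd f g).carrier U)) p)) (fun _ _ ↦ rfl))
    (fun _ _ _ ↦ rfl) (fun _ _ ↦ rfl)

/-- The second projection of a fibre product. -/
def fibSnd (f : A ⟶ T) (g : B ⟶ T) : (fibreProd f g).toModules ⟶ B :=
  mkHom (M := (fibreProd f g).toModules) (N := B)
    (fun U ↦ AddMonoidHom.mk' (fun p ↦ Prod.snd (α := Γ(A, U)) (β := Γ(B, U))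
      (Subtype.val (p := (· ∈ (fibreProd f g).carrier U)) p)) (fun _ _ ↦ rfl))
    (fun _ _ _ ↦ rfl) (fun _ _ ↦ rfl)

/-- A section of a fibre product from its components. -/
def mkFib {U : X.Opens} (a : Γ(A, U)) (b : Γ(B, U)) (h : f.app U a = g.app U b) :
    Γ((fibreProd f g).toModules, U) :=
  Subtype.mk (p := (· ∈ (fibreProd f g).carrier U)) (Prod.mk a b) h

theorem fib_condition {U : X.Opens} (p : Γ((fibreProd f g).toModules, U)) :
    f.app U ((fibFst f g).app U p) = g.app U ((fibSnd f g).app U p) :=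
  Subtype.prop (p := (· ∈ (fibreProd f g).carrier U)) p

theorem fib_ext {U : X.Opens} {p q : Γ((fibreProd f g).toModules, U)}
    (h₁ : (fibFst f g).app U p = (fibFst f g).app U q)
    (h₂ : (fibSnd f g).app U p = (fibSnd f g).app U q) : p = q :=
  Subtype.ext (p := (· ∈ (fibreProd f g).carrier U)) (Prod.ext h₁ h₂)

/-- The morphism to a fibre product given by its components. -/
def fibLift {Z : X.Modules} (a : Z ⟶ A) (b : Z ⟶ B) (h : a ≫ f = b ≫ g) :
    Z ⟶ (fibreProd f g).toModules :=
  mkHom (M := Z) (N := (fibreProd f g).toModules)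
    (fun U ↦ AddMonoidHom.mk' (fun z ↦ mkFib (a.app U z) (b.app U z)
        (congrArg (fun k ↦ k.app U z) h))
      (fun z z' ↦ fib_ext (map_add (a.app U).hom z z') (map_add (b.app U).hom z z')))
    (fun _ c z ↦ fib_ext (Scheme.Modules.Hom.app_smul a c z) (Scheme.Modules.Hom.app_smul b c z))
    (fun k z ↦ fib_ext (app_res a k z) (app_res b k z))

end

/-- The first projection of a product. -/
def prodFst (A B : X.Modules) : prodMod A B ⟶ A :=
  mkHom (M := prodMod A B) (N := A)
    (fun U ↦ AddMonoidHom.mk' (fun p ↦ Prod.fst (α := Γ(A, U)) (β := Γ(B, U)) p) (fun _ _ ↦ rfl))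
    (fun _ _ _ ↦ rfl) (fun _ _ ↦ rfl)

/-- The second projection of a product. -/
def prodSnd (A B : X.Modules) : prodMod A B ⟶ B :=
  mkHom (M := prodMod A B) (N := B)
    (fun U ↦ AddMonoidHom.mk' (fun p ↦ Prod.snd (α := Γ(A, U)) (β := Γ(B, U)) p) (fun _ _ ↦ rfl))
    (fun _ _ _ ↦ rfl) (fun _ _ ↦ rfl)

theorem prod_ext {A B : X.Modules} {U : X.Opens} {p q : Γ(prodMod A B, U)}
    (h₁ : (prodFst A B).app U p = (prodFst A B).app U q)
    (h₂ : (prodSnd A B).app U p = (prodSnd A B).app U q) : p = q := Prod.ext h₁ h₂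

theorem exists_prod {A B : X.Modules} {U : X.Opens} (a : Γ(A, U)) (b : Γ(B, U)) :
    ∃ p : Γ(prodMod A B, U), (prodFst A B).app U p = a ∧ (prodSnd A B).app U p = b :=
  ⟨(Prod.mk a b : Γ(A, U) × Γ(B, U)), rfl, rfl⟩

variable (P Q : ShortComplex X.Modules) (t : Q.X₃ ⟶ P.X₃)

/-- The extension of `Q.X₃` by `P.X₁ × Q.X₁` given by the pullback of `P` along `t` and by `Q`. -/
def fibreSequence : ShortComplex X.Modules where
  X₁ := prodMod P.X₁ Q.X₁
  X₂ := (fibreProd P.g (Q.g ≫ t)).toModules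
  X₃ := Q.X₃
  f := fibLift (prodFst P.X₁ Q.X₁ ≫ P.f) (prodSnd P.X₁ Q.X₁ ≫ Q.f) (by
    rw [Category.assoc, P.zero, Category.assoc, ← Category.assoc Q.f, Q.zero, Limits.zero_comp,
      Limits.comp_zero, Limits.comp_zero])
  g := fibSnd _ _ ≫ Q.g
  zero := hom_ext_sections fun U p ↦
    congrArg (fun k ↦ k.app U ((prodSnd P.X₁ Q.X₁).app U p)) Q.zero

/-- The projection to `P`. -/
def fibreSequenceFst : fibreSequence P Q t ⟶ P where
  τ₁ := prodFst P.X₁ Q.X₁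
  τ₂ := fibFst _ _
  τ₃ := t
  comm₁₂ := rfl
  comm₂₃ := hom_ext_sections fun _ p ↦ fib_condition p

/-- The projection to `Q`. -/
def fibreSequenceSnd : fibreSequence P Q t ⟶ Q where
  τ₁ := prodSnd P.X₁ Q.X₁
  τ₂ := fibSnd _ _
  τ₃ := 𝟙 _
  comm₁₂ := rfl
  comm₂₃ := rfl

variable {P Q} in
theorem fibreSequence_locallyExact (hP : LocallyExact P) (hQ : LocallyExact Q) :
    LocallyExact (fibreSequence P Q t) where
  injective U p q h := prod_ext
    (hP.injective U (congrArg (fun s ↦ (fibFst P.g (Q.g ≫ t)).app U s) h))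
    (hQ.injective U (congrArg (fun s ↦ (fibSnd P.g (Q.g ≫ t)).app U s) h))
  exact U p hp x hx := by
    obtain ⟨b, hb⟩ := hQ.exists_eq U ((fibSnd P.g (Q.g ≫ t)).app U p) hp
    -- The second component maps to zero in `Q.X₃`, so by the fibre product condition the first
    -- component maps to zero in `P.X₃`.
    obtain ⟨a, ha⟩ := hP.exists_eq U ((fibFst P.g (Q.g ≫ t)).app U p) (by
      refine (fib_condition (f := P.g) (g := Q.g ≫ t) p).trans ?_
      exact (congrArg (t.app U) hp).trans (map_zero (t.app U).hom))
    obtain ⟨n, hn₁, hn₂⟩ := exists_prod a b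
    refine ⟨U, hx, le_rfl, n, ?_⟩
    rw [res_self]
    refine fib_ext ((congrArg (P.f.app U) hn₁).trans ha) ((congrArg (Q.f.app U) hn₂).trans hb)
  surjective U v x hx := by
    obtain ⟨V, hxV, h, b, hb⟩ := hQ.surjective U v x hx
    obtain ⟨W, hxW, k, a, ha⟩ := hP.surjective V (t.app V (res Q.X₃ h v)) x hxV
    refine ⟨W, hxW, k.trans h, mkFib a (res Q.X₂ k b) ?_, ?_⟩
    · rw [ha, comp_app_apply, app_res, app_res, hb]
    · refine (app_res Q.g k b).trans ?_
      rw [hb]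
      exact res_res Q.X₃ h k v

end FibreProduct

/-! ### Classes of extensions. -/

section ExtClasses

variable {𝒜 : Type*} [Category 𝒜] [Abelian 𝒜] [HasExt.{w} 𝒜]

/-- The relation between the classes of two extensions given by a morphism from an extension that
maps to both. -/
theorem extClass_add_eq_zero {R P Q : ShortComplex 𝒜} (hR : R.ShortExact) (hP : P.ShortExact)
    (hQ : Q.ShortExact) (p : R ⟶ P) (q : R ⟶ Q) {Y : 𝒜} (θ : R.X₂ ⟶ Y) (β : P.X₁ ⟶ Y)
    (γ : Q.X₁ ⟶ Y) (h : R.f ≫ θ = p.τ₁ ≫ β + q.τ₁ ≫ γ) :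
    ((Abelian.Ext.mk₀ p.τ₃).comp hP.extClass (zero_add 1)).comp (Abelian.Ext.mk₀ β) (add_zero 1) +
      ((Abelian.Ext.mk₀ q.τ₃).comp hQ.extClass (zero_add 1)).comp (Abelian.Ext.mk₀ γ)
        (add_zero 1) = 0 := by
  -- By naturality both terms are pushouts of the class of `R`, and their sum is its pushout along
  -- `R.f ≫ θ`; the class of an extension composed with its own inclusion is zero.
  rw [← ShortComplex.ShortExact.extClass_naturality hR hP p,
    ← ShortComplex.ShortExact.extClass_naturality hR hQ q,
    Abelian.Ext.comp_assoc_of_second_deg_zero, Abelian.Ext.comp_assoc_of_second_deg_zero,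
    Abelian.Ext.mk₀_comp_mk₀, Abelian.Ext.mk₀_comp_mk₀, ← Abelian.Ext.comp_add,
    ← Abelian.Ext.mk₀_add, ← h, ← Abelian.Ext.mk₀_comp_mk₀,
    ← Abelian.Ext.comp_assoc_of_second_deg_zero, hR.extClass_comp, Abelian.Ext.zero_comp]

end ExtClasses

/-! ### Multiplication by functions with a pole along the diagonal. -/

section TwistProduct

variable {C S : Scheme.{u}} {π : C ⟶ S} {N : (square π).Modules} {W : (square π).Opens}

/-- The value of a section of `𝒪(Δ)` on a section of the ideal, as a function. -/
def evFun (ψ : Γ(twist π (unitMod (square π)), W)) {V : (square π).Opens} (h : V ≤ W) :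
    Γ(ideal π, V) →ₗ[Γ(square π, V)] Γ(square π, V) := ev ψ h

theorem evFun_res (ψ : Γ(twist π (unitMod (square π)), W)) {V V' : (square π).Opens} (h : V ≤ W)
    (k : V' ≤ V) (i : Γ(ideal π, V)) :
    evFun ψ (k.trans h) (res (ideal π) k i) = resO k (evFun ψ h i) := ev_nat ψ h k i

/-- The product of a section of `𝒪(Δ)` and a section of `N`. -/
def twistMul (ψ : Γ(twist π (unitMod (square π)), W)) (n : Γ(N, W)) : Γ(twist π N, W) :=
  mkLin (fun _ h ↦ (evFun ψ h).smulRight (res N h n))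
    (fun h k i ↦ by
      rw [LinearMap.smulRight_apply, LinearMap.smulRight_apply, evFun_res, res_smul, res_res])

theorem ev_twistMul (ψ : Γ(twist π (unitMod (square π)), W)) (n : Γ(N, W)) {V : (square π).Opens}
    (h : V ≤ W) (i : Γ(ideal π, V)) : ev (twistMul ψ n) h i = evFun ψ h i • res N h n := rfl

theorem twistMul_add (ψ : Γ(twist π (unitMod (square π)), W)) (n n' : Γ(N, W)) :
    twistMul ψ (n + n') = twistMul ψ n + twistMul ψ n' :=
  lin_ext fun V h i ↦ by
    rw [ev_add, ev_twistMul, ev_twistMul, ev_twistMul, map_add, smul_add]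

theorem add_twistMul (ψ ψ' : Γ(twist π (unitMod (square π)), W)) (n : Γ(N, W)) :
    twistMul (ψ + ψ') n = twistMul ψ n + twistMul ψ' n :=
  lin_ext fun V h i ↦ by
    have h₁ : evFun (ψ + ψ') h i = evFun ψ h i + evFun ψ' h i := rfl
    rw [ev_add, ev_twistMul, ev_twistMul, ev_twistMul, h₁, add_smul]

theorem smul_twistMul (f : Γ(square π, W)) (ψ : Γ(twist π (unitMod (square π)), W)) (n : Γ(N, W)) :
    twistMul (f • ψ) n = f • twistMul ψ n :=
  lin_ext fun V h i ↦ by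
    have h₁ : evFun (f • ψ) h i = resO h f * evFun ψ h i := rfl
    rw [ev_smul, ev_twistMul, ev_twistMul, h₁, mul_smul]

theorem zero_twistMul (n : Γ(N, W)) :
    twistMul (0 : Γ(twist π (unitMod (square π)), W)) n = 0 :=
  lin_ext fun V h _ ↦ zero_smul Γ(square π, V) (res N h n)

theorem twistMul_res (ψ : Γ(twist π (unitMod (square π)), W)) (n : Γ(N, W))
    {V : (square π).Opens} (h : V ≤ W) : res (twist π N) h (twistMul ψ n) =
      twistMul (res (twist π (unitMod (square π))) h ψ) (res N h n) :=
  lin_ext fun V' k i ↦ by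
    rw [ev_res, ev_twistMul, ev_twistMul, res_res]
    rfl

/-- A function as a section of `𝒪(Δ)`. -/
def funTwist (g : Γ(square π, W)) : Γ(twist π (unitMod (square π)), W) :=
  mulSection (N := unitMod (square π)) g

theorem evFun_funTwist (g : Γ(square π, W)) {V : (square π).Opens} (h : V ≤ W)
    (i : Γ(ideal π, V)) : evFun (funTwist g) h i = idealVal i * resO h g := rfl

theorem funTwist_twistMul (g : Γ(square π, W)) (n : Γ(N, W)) :
    twistMul (funTwist g) n = mulSection (g • n) :=
  lin_ext fun V h i ↦ by
    rw [ev_twistMul, evFun_funTwist, ev_mulSection, res_smul, mul_smul]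

/-- Both sides are ψ evaluated at the product of `i` and `j`. -/
theorem idealVal_mul_evFun (ψ : Γ(twist π (unitMod (square π)), W)) {V : (square π).Opens}
    (h : V ≤ W) (i j : Γ(ideal π, V)) : idealVal i * evFun ψ h j = idealVal j * evFun ψ h i := by
  rw [← smul_eq_mul, ← smul_eq_mul, ← map_smul, ← map_smul]
  refine congrArg (evFun ψ h) (idealVal_injective ?_)
  rw [map_smul, map_smul, smul_eq_mul, smul_eq_mul, mul_comm]

/-- The pole of ψ cancels against the zero of `x`: the product is regular, with coefficient ψ(x). -/
theorem twistMul_idealVal_smul (ψ : Γ(twist π (unitMod (square π)), W)) (x : Γ(ideal π, W))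
    (n : Γ(N, W)) : twistMul ψ (idealVal x • n) = mulSection (evFun ψ le_rfl x • n) :=
  lin_ext fun V h i ↦ by
    rw [ev_twistMul, ev_mulSection, res_smul, res_smul, smul_smul, smul_smul,
      ← evFun_res ψ le_rfl h, ← idealVal_res, mul_comm, idealVal_mul_evFun]

theorem mulSection_add (n n' : Γ(N, W)) : mulSection (n + n') = mulSection n + mulSection n' :=
  map_add ((toTwist N).app W).hom n n'

theorem mulSection_smul (f : Γ(square π, W)) (n : Γ(N, W)) :
    mulSection (f • n) = f • mulSection n := Scheme.Modules.Hom.app_smul (toTwist N) f n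

theorem mulSection_res {V : (square π).Opens} (h : V ≤ W) (n : Γ(N, W)) :
    mulSection (res N h n) = res (twist π N) h (mulSection n) := app_res (toTwist N) h n

theorem mulSection_sum {ι : Type} [Fintype ι] (n : ι → Γ(N, W)) :
    mulSection (∑ i, n i) = ∑ i, mulSection (n i) := map_sum ((toTwist N).app W).hom n _

theorem twistMul_sum {ι : Type} [Fintype ι] (ψ : Γ(twist π (unitMod (square π)), W))
    (n : ι → Γ(N, W)) : twistMul ψ (∑ i, n i) = ∑ i, twistMul ψ (n i) :=
  map_sum (AddMonoidHom.mk' (twistMul ψ) (twistMul_add ψ)) n _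

variable (π) in
theorem unitSequence_locallyExact [IsSeparated π] [SmoothOfRelativeDimension 1 π] :
    LocallyExact (principalSequence (diagUnit π)) :=
  principalSequence_locallyExact fun y ↦
    ⟨⊤, Unit, inferInstance, Opens.mem_top y, ⟨DiagGen.unit⟩⟩

/-- Exactness of 0 → 𝒪 → 𝒪(Δ) → Δ_*T → 0, applied to the difference. -/
theorem exists_eq_add_funTwist [IsSeparated π] [SmoothOfRelativeDimension 1 π]
    (ψ ψ' : Γ(twist π (unitMod (square π)), W))
    (h : principalDer (diagUnit π) ψ = principalDer (diagUnit π) ψ') :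
    ∃ g, ψ' = ψ + funTwist g := by
  obtain ⟨g, hg⟩ := (unitSequence_locallyExact π).exists_eq W (ψ' - ψ)
    ((map_sub ((principalPart (diagUnit π)).app W).hom ψ' ψ).trans (sub_eq_zero.2 h.symm))
  exact ⟨g, sub_eq_iff_eq_add'.1 hg.symm⟩

/-- The value on the diagonal of ψ · (p₂^*f - p₁^*f) is v(f), where v is the principal part of ψ.
This is the definition of the principal part, up to the open sets over which things are evaluated.
-/
theorem diagFun_evFun_diff (ψ : Γ(twist π (unitMod (square π)), W)) {V : C.Opens}
    (h : W ≤ around ⊤ V) (hV : diag π ⁻¹ᵁ W ≤ V) (f : Γ(C, V)) :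
    diagFun (evFun ψ le_rfl (res (ideal π) h (diff ⊤ f))) =
      vf (principalDer (diagUnit π) ψ) le_rfl (resO hV f) := by
  have hle := around_le W (diag π ⁻¹ᵁ W)
  have h₁ : vf (principalDer (diagUnit π) ψ) le_rfl (resO hV f) =
    resO (le_around le_rfl) (diagFun (evFun ψ hle (diff W (resO hV f)))) := rfl
  rw [h₁, diff_mono (le_top : W ≤ ⊤), diff_res, res_res, ← res_res (ideal π) h hle,
    evFun_res ψ le_rfl hle, diagFun_res, resO_resO, resO_self]

end TwistProduct

/-! ### Dual families on the square: change of families, bracket and Atiyah term. -/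

section BoxBracket

variable {C S : Scheme.{u}} {π : C ⟶ S} {E : C.Modules} {r : ℕ} [IsLocallyFreeOfRank E r]

/-- The bracket of the restriction to the diagonal of a section of `𝔤 ⊠ 𝔤`. -/
def boxBracket {W : (square π).Opens} : Γ(box π (sl E r) (sl E r), W) →+ Γ(sl E r, diag π ⁻¹ᵁ W) :=
  ((boxToDiag π (sl E r) (sl E r) ≫ (diagPush π).map (bracket E r)).app W).hom

theorem boxBracket_smul {W : (square π).Opens} (f : Γ(square π, W))
    (n : Γ(box π (sl E r) (sl E r), W)) : boxBracket (f • n) = diagFun f • boxBracket n :=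
  Scheme.Modules.Hom.app_smul
    (boxToDiag π (sl E r) (sl E r) ≫ (diagPush π).map (bracket E r)) f n

theorem boxBracket_res {W W' : (square π).Opens} (h : W' ≤ W)
    (n : Γ(box π (sl E r) (sl E r), W)) : boxBracket (res _ h n) =
      res (sl E r) (Scheme.Hom.preimage_mono _ h) (boxBracket n) :=
  app_res (boxToDiag π (sl E r) (sl E r) ≫ (diagPush π).map (bracket E r)) h n

theorem boxToDiag_res_boxTmul {A B : C.Modules} {W : (square π).Opens} {V : C.Opens}
    (h : W ≤ around ⊤ V) (hV : diag π ⁻¹ᵁ W ≤ V) (a : Γ(A, V)) (b : Γ(B, V)) :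
    (boxToDiag π A B).app W (res _ h (boxTmul a b)) =
      (res (tensor A B) hV (tmul a b) : Γ(tensor A B, diag π ⁻¹ᵁ W)) := by
  rw [← toDiag_boxTmul (π := π), app_res]
  exact (res_res (tensor A B) (le_around (W := ⊤) le_top) hV
    (show Γ(tensor A B, diag π ⁻¹ᵁ around ⊤ V) from
      (boxToDiag π A B).app (around ⊤ V) (boxTmul a b))).symm

theorem bracket_tmul {U : C.Opens} (a b : Γ(sl E r, U)) :
    (bracket E r).app U (tmul a b) = slBracket a b := lift_tmul _ _ a b

theorem boxBracket_res_boxTmul {W : (square π).Opens} {V : C.Opens}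
    (h : W ≤ around ⊤ V) (hV : diag π ⁻¹ᵁ W ≤ V) (a b : Γ(sl E r, V)) :
    boxBracket (res _ h (boxTmul a b)) = slBracket (res (sl E r) hV a) (res (sl E r) hV b) := by
  have h₁ : ∀ n : Γ(box π (sl E r) (sl E r), W), ∀ t : Γ(tensor (sl E r) (sl E r), diag π ⁻¹ᵁ W),
      (boxToDiag π (sl E r) (sl E r)).app W n = t →
        boxBracket n = (bracket E r).app (diag π ⁻¹ᵁ W) t := by
    rintro n _ rfl
    rfl
  rw [h₁ _ _ (boxToDiag_res_boxTmul h hV a b), res_tmul, bracket_tmul]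

theorem boxTmul_sum {A B : C.Modules} {V : C.Opens} {ι : Type} [Fintype ι] (a : Γ(A, V))
    (b : ι → Γ(B, V)) : boxTmul (π := π) a (∑ i, b i) = ∑ i, boxTmul a (b i) := by
  simp only [boxTmul, pullSec_sum, map_sum, boxPair_sum]

theorem sum_boxTmul {A B : C.Modules} {V : C.Opens} {ι : Type} [Fintype ι] (a : ι → Γ(A, V))
    (b : Γ(B, V)) : boxTmul (π := π) (∑ i, a i) b = ∑ i, boxTmul (a i) b := by
  simp only [boxTmul, pullSec_sum, map_sum, sum_boxPair]

theorem smul_boxTmul {A B : C.Modules} {V : C.Opens} (f : Γ(C, V)) (a : Γ(A, V))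
    (b : Γ(B, V)) : boxTmul (π := π) (f • a) b = pull₁ (π := π) ⊤ f • boxTmul (π := π) a b := by
  rw [boxTmul, pullSec_smul, res_smul, smul_boxPair, ← Scheme.Hom.appLE_eq_app,
    res_appLE (q := p₁ π) le_rfl]
  rfl

theorem boxTmul_smul {A B : C.Modules} {V : C.Opens} (f : Γ(C, V)) (a : Γ(A, V))
    (b : Γ(B, V)) : boxTmul (π := π) a (f • b) = pull₂ (π := π) ⊤ f • boxTmul (π := π) a b := by
  rw [boxTmul, pullSec_smul, res_smul, boxPair_smul, ← Scheme.Hom.appLE_eq_app,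
    res_appLE (q := p₂ π) le_rfl]
  rfl

theorem res_boxTmul {A B : C.Modules} {V V' : C.Opens} (h : V' ≤ V) (a : Γ(A, V)) (b : Γ(B, V)) :
    boxTmul (π := π) (res A h a) (res B h b) = res _ (around_mono ⊤ h) (boxTmul a b) := by
  rw [boxTmul, boxTmul, pullSec_res, pullSec_res, res_boxPair, res_res, res_res, res_res, res_res]

namespace DualSystem

variable {V : C.Opens} {ι : Type} [Fintype ι]

/-- The section of `𝔤 ⊠ 𝔤` given by dual families. -/
def boxTensor (π : C ⟶ S) (d : DualSystem E r V ι) : Γ(box π (sl E r) (sl E r), around ⊤ V) :=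
  ∑ i, boxTmul (d.fst i) (d.snd i)

theorem res_boxTensor (d : DualSystem E r V ι) {V' : C.Opens} (h : V' ≤ V) :
    (d.restrict h).boxTensor π = res _ (around_mono ⊤ h) (d.boxTensor π) := by
  rw [boxTensor, boxTensor, map_sum]
  exact Finset.sum_congr rfl fun i _ ↦ res_boxTmul h _ _

/-- Expand aᵢ in the a'ⱼ and b'ⱼ in the bᵢ. Both tensors become combinations of a'ⱼ ⊠ bᵢ with the
same functions t(aᵢ, b'ⱼ), pulled back along p₁ in one case and along p₂ in the other. -/
theorem boxTensor_eq_add (d d' : DualSystem E r V ι) : d'.boxTensor π = d.boxTensor π +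
    ∑ j, ∑ i, idealVal (diff (π := π) ⊤ (pairing E r V (d.fst i) (d'.snd j))) •
      boxTmul (d'.fst j) (d.snd i) := by
  have h₁ : d.boxTensor π = ∑ j, ∑ i, pull₁ (π := π) ⊤ (pairing E r V (d.fst i) (d'.snd j)) •
      boxTmul (d'.fst j) (d.snd i) := by
    rw [Finset.sum_comm, boxTensor]
    refine Finset.sum_congr rfl fun i _ ↦ ?_
    conv_lhs => rw [← d'.sum_fst_self (d.fst i), sum_boxTmul]
    refine Finset.sum_congr rfl fun j _ ↦ ?_
    rw [smul_boxTmul, pairing_comm]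
  have h₂ : d'.boxTensor π = ∑ j, ∑ i, pull₂ (π := π) ⊤ (pairing E r V (d.fst i) (d'.snd j)) •
      boxTmul (d'.fst j) (d.snd i) := by
    rw [boxTensor]
    refine Finset.sum_congr rfl fun j _ ↦ ?_
    conv_lhs => rw [← d.sum_snd_self (d'.snd j), boxTmul_sum]
    refine Finset.sum_congr rfl fun i _ ↦ ?_
    rw [boxTmul_smul]
  rw [h₁, h₂, ← Finset.sum_add_distrib]
  refine Finset.sum_congr rfl fun j _ ↦ ?_
  rw [← Finset.sum_add_distrib]
  refine Finset.sum_congr rfl fun i _ ↦ ?_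
  rw [idealVal_diff, sub_smul, add_sub_cancel]

/-- On the diagonal this is ∑ [aᵢ, bᵢ] = 0. -/
theorem boxBracket_boxTensor (d : DualSystem E r V ι) (h₂ : IsUnit (2 : Γ(C, (⊤ : C.Opens))))
    {W : (square π).Opens} (h : W ≤ around ⊤ V) : boxBracket (res _ h (d.boxTensor π)) = 0 := by
  have hV : diag π ⁻¹ᵁ W ≤ V := (Scheme.Hom.preimage_mono _ h).trans (diag_around_le ⊤ V)
  rw [boxTensor, map_sum, map_sum]
  simp only [boxBracket_res_boxTmul h hV]
  exact (d.restrict hV).sum_bracket h₂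

/-- The section `∑ [aᵢ, [D, bᵢ]]`. -/
def atiyahTerm (d : DualSystem E r V ι) (D : Γ(atiyah π E, V)) : Γ(sl E r, V) :=
  ∑ i, slComm r (slVal (d.fst i)) (atComm D (slVal (d.snd i)))

theorem atiyahTerm_add (d : DualSystem E r V ι) (D D' : Γ(atiyah π E, V)) :
    d.atiyahTerm (D + D') = d.atiyahTerm D + d.atiyahTerm D' := by
  rw [atiyahTerm, atiyahTerm, atiyahTerm, ← Finset.sum_add_distrib]
  refine Finset.sum_congr rfl fun i _ ↦ ?_
  rw [add_atComm, ← slCommHom_apply, map_add]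
  rfl

theorem atiyahTerm_smul (d : DualSystem E r V ι) (f : Γ(C, V)) (D : Γ(atiyah π E, V)) :
    d.atiyahTerm (f • D) = f • d.atiyahTerm D := by
  rw [atiyahTerm, atiyahTerm, Finset.smul_sum]
  refine Finset.sum_congr rfl fun i _ ↦ ?_
  rw [smul_atComm, ← slCommHom_apply, map_smul]
  rfl

theorem atiyahTerm_res (d : DualSystem E r V ι) {V' : C.Opens} (h : V' ≤ V)
    (D : Γ(atiyah π E, V)) :
    (d.restrict h).atiyahTerm (res (atiyah π E) h D) = res (sl E r) h (d.atiyahTerm D) := by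
  rw [atiyahTerm, atiyahTerm, map_sum]
  refine Finset.sum_congr rfl fun i _ ↦ ?_
  exact slCommHom_res h (slVal (d.fst i)) (atComm D (slVal (d.snd i)))

/-- The same expansions as in `boxTensor_eq_add`. The coefficient t(aᵢ, b'ⱼ) can be moved freely on
the first factor, but on the second it sits inside [D, ·], and the Leibniz rule produces its
derivative. -/
theorem atiyahTerm_eq_add (d d' : DualSystem E r V ι) (D : Γ(atiyah π E, V)) :
    d'.atiyahTerm D = d.atiyahTerm D +
      ∑ j, ∑ i, vf (atAnchor D) le_rfl (pairing E r V (d.fst i) (d'.snd j)) •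
        slBracket (d'.fst j) (d.snd i) := by
  have h₁ : d.atiyahTerm D = ∑ j, ∑ i, pairing E r V (d.fst i) (d'.snd j) •
      slCommHom r V (slVal (d'.fst j)) (atComm D (slVal (d.snd i))) := by
    rw [Finset.sum_comm, atiyahTerm]
    refine Finset.sum_congr rfl fun i _ ↦ ?_
    conv_lhs => rw [← slCommHom_apply, ← d'.sum_fst_self (d.fst i), map_sum, map_sum,
      LinearMap.sum_apply]
    refine Finset.sum_congr rfl fun j _ ↦ ?_
    rw [map_smul, map_smul, LinearMap.smul_apply, pairing_comm]
  rw [h₁, ← Finset.sum_add_distrib, atiyahTerm]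
  refine Finset.sum_congr rfl fun j _ ↦ ?_
  rw [← Finset.sum_add_distrib]
  conv_lhs => rw [← slCommHom_apply, ← d.sum_snd_self (d'.snd j), map_sum, atComm_sum, map_sum]
  refine Finset.sum_congr rfl fun i _ ↦ ?_
  rw [map_smul, atComm_smul, map_add, map_smul, map_smul]
  rfl

end DualSystem

end BoxBracket

/-! ### Local values of the splitting and their independence of choices. -/

section LocalValues

variable {C S : Scheme.{u}} {π : C ⟶ S} {E : C.Modules} {r : ℕ} [IsLocallyFreeOfRank E r]
  {V : C.Opens} {ι : Type} [Fintype ι]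

theorem diag_preimage_le {W : (square π).Opens} (h : W ≤ around ⊤ V) : diag π ⁻¹ᵁ W ≤ V :=
  (Scheme.Hom.preimage_mono _ h).trans (diag_around_le ⊤ V)

/-- The heart of the matter. A change of ψ by a function g alters n by a multiple of the dual
tensor, whose bracket vanishes on the diagonal. A change of families alters n by regular terms,
whose bracket on the diagonal is the change of the Atiyah term with the opposite sign. -/
theorem DualSystem.exists_transfer [IsSeparated π] [SmoothOfRelativeDimension 1 π]
    (d d' : DualSystem E r V ι) (h₂ : IsUnit (2 : Γ(C, (⊤ : C.Opens)))) {W : (square π).Opens}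
    (h : W ≤ around ⊤ V) (D : Γ(atiyah π E, diag π ⁻¹ᵁ W))
    (ψ ψ' : Γ(twist π (unitMod (square π)), W)) (hψ : principalDer (diagUnit π) ψ = atAnchor D)
    (hψ' : principalDer (diagUnit π) ψ' = atAnchor D) (n : Γ(box π (sl E r) (sl E r), W)) :
    ∃ n', twistMul ψ (res _ h (d.boxTensor π)) + mulSection n =
        twistMul ψ' (res _ h (d'.boxTensor π)) + mulSection n' ∧
      boxBracket n + (d.restrict (diag_preimage_le h)).atiyahTerm D =
        boxBracket n' + (d'.restrict (diag_preimage_le h)).atiyahTerm D := by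
  obtain ⟨g, rfl⟩ := exists_eq_add_funTwist ψ ψ' (hψ.trans hψ'.symm)
  -- The regular functions left when ψ is multiplied by the differences of pulled-back coefficients.
  let e (j i : ι) : Γ(square π, W) :=
    evFun ψ le_rfl (res (ideal π) h (diff ⊤ (pairing E r V (d.fst i) (d'.snd j))))
  let w (j i : ι) : Γ(box π (sl E r) (sl E r), W) := res _ h (boxTmul (d'.fst j) (d.snd i))
  have h₃ : twistMul ψ (res _ h (d'.boxTensor π)) = twistMul ψ (res _ h (d.boxTensor π)) +
      mulSection (∑ j, ∑ i, e j i • w j i) := by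
    rw [d.boxTensor_eq_add d', map_add, twistMul_add, map_sum, twistMul_sum, mulSection_sum]
    refine congrArg _ (Finset.sum_congr rfl fun j _ ↦ ?_)
    rw [map_sum, twistMul_sum, mulSection_sum]
    refine Finset.sum_congr rfl fun i _ ↦ ?_
    rw [res_smul, ← idealVal_res, twistMul_idealVal_smul]
  -- The section n' is forced by the decomposition: subtract from n the effect of the new families
  -- and the effect of g.
  refine ⟨n - ∑ j, ∑ i, e j i • w j i - g • res _ h (d'.boxTensor π), ?_, ?_⟩
  · rw [add_twistMul, funTwist_twistMul, h₃, add_assoc, add_assoc, ← mulSection_add,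
      ← mulSection_add]
    congr 2
    abel
  · have h₄ : ∀ j i, boxBracket (e j i • w j i) =
        vf (atAnchor D) le_rfl (pairing E r _ ((d.restrict (diag_preimage_le h)).fst i)
          ((d'.restrict (diag_preimage_le h)).snd j)) •
          slBracket ((d'.restrict (diag_preimage_le h)).fst j)
            ((d.restrict (diag_preimage_le h)).snd i) := fun j i ↦ by
      rw [boxBracket_smul, boxBracket_res_boxTmul h (diag_preimage_le h),
        diagFun_evFun_diff ψ h (diag_preimage_le h), hψ, ← pairing_res]
      rfl
    have h₅ : boxBracket (∑ j, ∑ i, e j i • w j i) =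
        ∑ j, ∑ i, vf (atAnchor D) le_rfl (pairing E r _
          ((d.restrict (diag_preimage_le h)).fst i) ((d'.restrict (diag_preimage_le h)).snd j)) •
          slBracket ((d'.restrict (diag_preimage_le h)).fst j)
            ((d.restrict (diag_preimage_le h)).snd i) := by
      rw [map_sum]
      refine Finset.sum_congr rfl fun j _ ↦ ?_
      rw [map_sum]
      exact Finset.sum_congr rfl fun i _ ↦ h₄ j i
    rw [(d.restrict (diag_preimage_le h)).atiyahTerm_eq_add (d'.restrict (diag_preimage_le h)),
      map_sub, map_sub, boxBracket_smul, d'.boxBracket_boxTensor h₂, smul_zero, sub_zero, h₅]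
    abel

/-- The section `m` is the value at `(φ, D)`, computed with the dual families `d`, of the
splitting of the sum of the bracket of the diagonal extension and the Atiyah extension. -/
def IsLocalValue (d : DualSystem E r V ι) {W : (square π).Opens} (h : W ≤ around ⊤ V)
    (φ : Γ(twist π (box π (sl E r) (sl E r)), W)) (D : Γ(atiyah π E, diag π ⁻¹ᵁ W))
    (m : Γ(sl E r, diag π ⁻¹ᵁ W)) : Prop :=
  ∃ (ψ : Γ(twist π (unitMod (square π)), W)) (n : Γ(box π (sl E r) (sl E r), W)),
    principalDer (diagUnit π) ψ = atAnchor D ∧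
    φ = twistMul ψ (res _ h (d.boxTensor π)) + mulSection n ∧
    m = boxBracket n + (d.restrict (diag_preimage_le h)).atiyahTerm D

namespace IsLocalValue

variable {d d' : DualSystem E r V ι} {W : (square π).Opens} {h : W ≤ around ⊤ V}
  {φ φ' : Γ(twist π (box π (sl E r) (sl E r)), W)} {D D' : Γ(atiyah π E, diag π ⁻¹ᵁ W)}
  {m m' : Γ(sl E r, diag π ⁻¹ᵁ W)}

theorem res (H : IsLocalValue d h φ D m) {W' : (square π).Opens} (k : W' ≤ W) :
    IsLocalValue d (k.trans h) (HitchinSymbol.res _ k φ)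
      (HitchinSymbol.res _ (Scheme.Hom.preimage_mono _ k) D)
      (HitchinSymbol.res _ (Scheme.Hom.preimage_mono _ k) m) := by
  obtain ⟨ψ, n, hψ, rfl, rfl⟩ := H
  refine ⟨HitchinSymbol.res _ k ψ, HitchinSymbol.res _ k n, ?_, ?_, ?_⟩
  · refine (app_res (principalPart (diagUnit π)) k ψ).trans ?_
    exact congrArg (HitchinSymbol.res (tangent π) (Scheme.Hom.preimage_mono _ k)) hψ
  · rw [map_add, twistMul_res, mulSection_res, res_res]
  · rw [map_add, boxBracket_res, ← DualSystem.atiyahTerm_res]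
    refine congrArg _ ?_
    simp only [DualSystem.restrict, res_res]

theorem restrict (H : IsLocalValue d h φ D m) {V' : C.Opens} (k : V' ≤ V)
    (h' : W ≤ around ⊤ V') : IsLocalValue (d.restrict k) h' φ D m := by
  obtain ⟨ψ, n, hψ, rfl, rfl⟩ := H
  refine ⟨ψ, n, hψ, ?_, ?_⟩
  · rw [d.res_boxTensor k, res_res]
  · refine congrArg _ ?_
    simp only [DualSystem.restrict, res_res]

theorem smul (H : IsLocalValue d h φ D m) (f : Γ(square π, W)) :
    IsLocalValue d h (f • φ) (diagFun f • D) (diagFun f • m) := by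
  obtain ⟨ψ, n, hψ, rfl, rfl⟩ := H
  refine ⟨f • ψ, f • n, ?_, ?_, ?_⟩
  · exact (Scheme.Modules.Hom.app_smul (principalPart (diagUnit π)) f ψ).trans
      (congrArg (diagFun f • ·) hψ)
  · rw [smul_add, smul_twistMul, mulSection_smul]
  · rw [smul_add, boxBracket_smul, DualSystem.atiyahTerm_smul]

variable [IsSeparated π] [SmoothOfRelativeDimension 1 π]

theorem transfer (H : IsLocalValue d h φ D m) (h₂ : IsUnit (2 : Γ(C, (⊤ : C.Opens))))
    {ψ' : Γ(twist π (unitMod (square π)), W)} (hψ' : principalDer (diagUnit π) ψ' = atAnchor D)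
    (d' : DualSystem E r V ι) : ∃ n, φ = twistMul ψ' (HitchinSymbol.res _ h (d'.boxTensor π)) +
      mulSection n ∧ m = boxBracket n + (d'.restrict (diag_preimage_le h)).atiyahTerm D := by
  obtain ⟨ψ, n, hψ, rfl, rfl⟩ := H
  exact d.exists_transfer d' h₂ h D ψ ψ' hψ hψ' n

theorem add (H : IsLocalValue d h φ D m) (H' : IsLocalValue d' h φ' D' m')
    (h₂ : IsUnit (2 : Γ(C, (⊤ : C.Opens)))) :
    IsLocalValue d h (φ + φ') (D + D') (m + m') := by
  obtain ⟨ψ, n, hψ, rfl, rfl⟩ := H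
  obtain ⟨ψ', -, hψ', -, -⟩ := id H'
  -- The second value is recomputed with the dual families of the first; only then can the two
  -- decompositions be added.
  obtain ⟨n', rfl, rfl⟩ := H'.transfer h₂ hψ' d
  refine ⟨ψ + ψ', n + n', ?_, ?_, ?_⟩
  · exact (map_add ((principalPart (diagUnit π)).app W).hom ψ ψ').trans
      (congrArg₂ (· + ·) hψ hψ')
  · rw [add_twistMul, mulSection_add]
    abel
  · rw [map_add, DualSystem.atiyahTerm_add]
    abel

end IsLocalValue

/-- The tensor ∑ aᵢ ⊠ bᵢ restricts to Ω on the diagonal, so multiplying it by ψ gives principal part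
Ω ⊗ v. Hence φ and ψ ∑ aᵢ ⊠ bᵢ can differ only by a regular section. -/
theorem principalDer_twistMul {Ω : Γ(tensor (sl E r) (sl E r), (⊤ : C.Opens))}
    (hΩ : IsTraceDual E r Ω) (d : DualSystem E r V ι) {W : (square π).Opens}
    (h : W ≤ around ⊤ V) (ψ : Γ(twist π (unitMod (square π)), W)) :
    principalDer (boxToDiag π (sl E r) (sl E r)) (twistMul ψ (res _ h (d.boxTensor π))) =
      (tensorSection π Ω).app (diag π ⁻¹ᵁ W) (principalDer (diagUnit π) ψ) := by
  have h₁ : (boxToDiag π (sl E r) (sl E r)).app W (res _ h (d.boxTensor π)) =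
      (res _ le_top Ω : Γ(tensor (sl E r) (sl E r), diag π ⁻¹ᵁ W)) := by
    rw [← res_res _ le_top (diag_preimage_le h), hΩ.res_eq d, DualSystem.boxTensor,
      DualSystem.tensor, map_sum, map_sum, map_sum]
    exact Finset.sum_congr rfl fun i _ ↦ boxToDiag_res_boxTmul h _ _ _
  refine der_ext fun V' k f ↦ ?_
  rw [derApp_principalDer, ev_twistMul, Scheme.Modules.Hom.app_smul, toDiag_smul,
    derApp_tensorSection, app_res, h₁]
  refine congrArg₂ (· • ·) rfl ?_
  exact (res_res (tensor (sl E r) (sl E r)) _ _ _).trans (res_res _ _ _ _)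

variable [IsSeparated π] [SmoothOfRelativeDimension 1 π]

/-- Dual families generate 𝔰𝔩(E) with coordinates, hence provide compatible generators of the
external and of the internal tensor product. -/
theorem diagonalSequence_locallyExact (π : C ⟶ S) [IsSeparated π] [SmoothOfRelativeDimension 1 π]
    (E : C.Modules) (r : ℕ) [IsLocallyFreeOfRank E r]
    (hX : ∀ n : ℕ, n ≠ 0 → IsUnit (n : Γ(C, (⊤ : C.Opens)))) :
    LocallyExact (diagonalSequence π (sl E r) (sl E r)) :=
  principalSequence_locallyExact (ρ := boxToDiag π (sl E r) (sl E r)) fun y ↦ by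
    obtain ⟨V, d, hy⟩ := exists_dualSystem E r hX y
    exact ⟨V, _, inferInstance, hy, ⟨DiagGen.box d.localGen d.localGen⟩⟩

/-- Once both values are computed with the same ψ and the same families, n is determined, because 𝔤
⊠ 𝔤 injects into its twist. -/
theorem IsLocalValue.eq {d d' : DualSystem E r V ι} {W : (square π).Opens} {h : W ≤ around ⊤ V}
    {φ : Γ(twist π (box π (sl E r) (sl E r)), W)} {D : Γ(atiyah π E, diag π ⁻¹ᵁ W)}
    {m m' : Γ(sl E r, diag π ⁻¹ᵁ W)} (hX : ∀ n : ℕ, n ≠ 0 → IsUnit (n : Γ(C, (⊤ : C.Opens))))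
    (H : IsLocalValue d h φ D m) (H' : IsLocalValue d' h φ D m') : m = m' := by
  obtain ⟨ψ, n, hψ, hφ, rfl⟩ := H
  obtain ⟨n', hφ', rfl⟩ := H'.transfer (by exact_mod_cast hX 2 two_ne_zero) hψ d
  have h₁ : mulSection n = mulSection n' := add_left_cancel (hφ.symm.trans hφ')
  rw [(diagonalSequence_locallyExact π E r hX).injective W h₁]

end LocalValues

/-! ### The splitting of the combined extension. -/

section Splitting

variable {C S : Scheme.{u}} {π : C ⟶ S} {E : C.Modules} {r : ℕ} [IsLocallyFreeOfRank E r]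

/-- The section `m` is locally around the diagonal the value at `(φ, D)` computed with some dual
families. -/
def IsValue {U : (square π).Opens} (φ : Γ(twist π (box π (sl E r) (sl E r)), U))
    (D : Γ(atiyah π E, diag π ⁻¹ᵁ U)) (m : Γ(sl E r, diag π ⁻¹ᵁ U)) : Prop :=
  -- Nothing is asked away from the diagonal, where the direct image of 𝔰𝔩(E) vanishes.
  ∀ y : C, diag π y ∈ U → ∃ (W : (square π).Opens) (k : W ≤ U), diag π y ∈ W ∧
    ∃ (V : C.Opens) (d : DualSystem E r V (Fin r × Fin r)) (h : W ≤ around ⊤ V),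
      IsLocalValue d h (res _ k φ) (res _ (Scheme.Hom.preimage_mono _ k) D)
        (res _ (Scheme.Hom.preimage_mono _ k) m)

namespace IsValue

variable {U : (square π).Opens} {φ φ' : Γ(twist π (box π (sl E r) (sl E r)), U)}
  {D D' : Γ(atiyah π E, diag π ⁻¹ᵁ U)} {m m' : Γ(sl E r, diag π ⁻¹ᵁ U)}

theorem res (H : IsValue φ D m) {U' : (square π).Opens} (k : U' ≤ U) :
    IsValue (HitchinSymbol.res _ k φ) (HitchinSymbol.res _ (Scheme.Hom.preimage_mono _ k) D)
      (HitchinSymbol.res _ (Scheme.Hom.preimage_mono _ k) m) := by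
  intro y hy
  obtain ⟨W, l, hyW, V, d, h, hd⟩ := H y (k hy)
  refine ⟨W ⊓ U', inf_le_right, ⟨hyW, hy⟩, V, d, inf_le_left.trans h, ?_⟩
  have := hd.res (W' := W ⊓ U') inf_le_left
  rw [res_res, res_res, res_res] at this
  rw [res_res, res_res, res_res]
  exact this

theorem smul (H : IsValue φ D m) (f : Γ(square π, U)) :
    IsValue (f • φ) (diagFun f • D) (diagFun f • m) := by
  intro y hy
  obtain ⟨W, l, hyW, V, d, h, hd⟩ := H y hy
  refine ⟨W, l, hyW, V, d, h, ?_⟩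
  rw [res_smul, res_smul, res_smul, ← diagFun_res]
  exact hd.smul _

/-- Two values around the same point can be computed on the same open sets. -/
theorem common (H : IsValue φ D m) (H' : IsValue φ' D' m') {y : C} (hy : diag π y ∈ U) :
    ∃ (W : (square π).Opens) (k : W ≤ U), diag π y ∈ W ∧
      ∃ (V : C.Opens) (d d' : DualSystem E r V (Fin r × Fin r)) (h : W ≤ around ⊤ V),
        IsLocalValue d h (HitchinSymbol.res _ k φ)
          (HitchinSymbol.res _ (Scheme.Hom.preimage_mono _ k) D)
          (HitchinSymbol.res _ (Scheme.Hom.preimage_mono _ k) m) ∧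
        IsLocalValue d' h (HitchinSymbol.res _ k φ')
          (HitchinSymbol.res _ (Scheme.Hom.preimage_mono _ k) D')
          (HitchinSymbol.res _ (Scheme.Hom.preimage_mono _ k) m') := by
  obtain ⟨W, k, hyW, V, d, h, hd⟩ := H y hy
  obtain ⟨W', k', hyW', V', d', h', hd'⟩ := H' y hy
  have hle : W ⊓ W' ≤ around ⊤ (V ⊓ V') := le_inf le_top (le_inf
    (le_inf (inf_le_left.trans (h.trans (around_le₁ ⊤ V)))
      (inf_le_right.trans (h'.trans (around_le₁ ⊤ V'))))
    (le_inf (inf_le_left.trans (h.trans (around_le₂ ⊤ V)))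
      (inf_le_right.trans (h'.trans (around_le₂ ⊤ V')))))
  have h₁ := (hd.res (W' := W ⊓ W') inf_le_left).restrict (V' := V ⊓ V') inf_le_left hle
  have h₂ := (hd'.res (W' := W ⊓ W') inf_le_right).restrict (V' := V ⊓ V') inf_le_right hle
  rw [res_res, res_res, res_res] at h₁ h₂
  exact ⟨W ⊓ W', inf_le_left.trans k, ⟨hyW, hyW'⟩, V ⊓ V', _, _, hle, h₁, h₂⟩

variable [IsSeparated π] [SmoothOfRelativeDimension 1 π]

theorem eq (hX : ∀ n : ℕ, n ≠ 0 → IsUnit (n : Γ(C, (⊤ : C.Opens)))) (H : IsValue φ D m)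
    (H' : IsValue φ D m') : m = m' := by
  refine eq_of_local (sl E r) _ _ fun y hy ↦ ?_
  obtain ⟨W, k, hyW, V, d, d', h, hd, hd'⟩ := H.common H' (y := y) hy
  exact ⟨diag π ⁻¹ᵁ W, hyW, Scheme.Hom.preimage_mono _ k, hd.eq hX hd'⟩

theorem add (h₂ : IsUnit (2 : Γ(C, (⊤ : C.Opens)))) (H : IsValue φ D m) (H' : IsValue φ' D' m') :
    IsValue (φ + φ') (D + D') (m + m') := by
  intro y hy
  obtain ⟨W, k, hyW, V, d, d', h, hd, hd'⟩ := H.common H' (y := y) hy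
  refine ⟨W, k, hyW, V, d, h, ?_⟩
  rw [map_add, map_add, map_add]
  exact hd.add hd' h₂

end IsValue

/-- An endomorphism has zero vector field, so ψ = 0 may be used. The regular part is then n itself,
and the Atiyah term is the Casimir sum. -/
theorem isValue_mulSection {c : Γ(C, (⊤ : C.Opens))} (hc : IsInvRank E r c)
    {U : (square π).Opens} (n : Γ(box π (sl E r) (sl E r), U)) (a : Γ(gl E, diag π ⁻¹ᵁ U)) :
    IsValue (mulSection n) ((glToAtiyah π E).app _ a)
      (boxBracket n - (2 * r) • slPart hc a) := by
  intro y hy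
  obtain ⟨V, hyV, b, hb⟩ := IsLocallyFreeOfRank.exists_frame (E := E) (r := r) y
  have hyW : diag π y ∈ around U V :=
    ⟨hy, (le_around (W := ⊤) (V := V) (π := π) le_top hyV).2⟩
  have h : around U V ≤ around ⊤ V := around_mono_left le_top V
  refine ⟨around U V, around_le U V, hyW, V, hb.dualSystem hc, h, 0, res _ (around_le U V) n,
    ?_, ?_, ?_⟩
  · refine (map_zero ((principalPart (diagUnit π)).app (around U V)).hom).trans ?_
    exact (map_zero (res (tangent π) (Scheme.Hom.preimage_mono (diag π) (around_le U V)))).symm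
  · rw [zero_twistMul, zero_add, mulSection_res]
  · rw [map_sub, map_nsmul, boxBracket_res, sub_eq_add_neg]
    refine congrArg _ ?_
    have h₁ : res (sl E r) (Scheme.Hom.preimage_mono (diag π) (around_le U V)) (slPart hc a) =
        slPart hc (res (gl E) (Scheme.Hom.preimage_mono (diag π) (around_le U V)) a) :=
      (app_res (slProj hc) _ a).symm
    rw [h₁, ← hb.casimir hc (diag_preimage_le h), DualSystem.atiyahTerm, ← app_res]
    refine Finset.sum_congr rfl fun k _ ↦ ?_
    rw [atComm_gl]

variable [IsSeparated π] [SmoothOfRelativeDimension 1 π]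

/-- Lift the vector field of D to a local section ψ of 𝒪(Δ). Then φ - ψ ∑ aᵢ ⊠ bᵢ has zero principal
part and is regular by exactness of the diagonal sequence. -/
theorem exists_isValue (hX : ∀ n : ℕ, n ≠ 0 → IsUnit (n : Γ(C, (⊤ : C.Opens))))
    {Ω : Γ(tensor (sl E r) (sl E r), (⊤ : C.Opens))} (hΩ : IsTraceDual E r Ω)
    {U : (square π).Opens} (φ : Γ(twist π (box π (sl E r) (sl E r)), U))
    (D : Γ(atiyah π E, diag π ⁻¹ᵁ U))
    (h : principalDer (boxToDiag π (sl E r) (sl E r)) φ =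
      (tensorSection π Ω).app (diag π ⁻¹ᵁ U) (atAnchor D)) {z : square π} (hz : z ∈ U) :
    ∃ (W : (square π).Opens), z ∈ W ∧ ∃ (k : W ≤ U) (m : Γ(sl E r, diag π ⁻¹ᵁ W)),
      IsValue (res _ k φ) (res _ (Scheme.Hom.preimage_mono _ k) D) m := by
  by_cases hd : ∃ y : C, diag π y = z
  · obtain ⟨y, rfl⟩ := hd
    obtain ⟨V, d, hyV⟩ := exists_dualSystem E r hX y
    obtain ⟨W, hyW, k, ψ, hψ⟩ := (unitSequence_locallyExact π).surjective U (atAnchor D) _ hz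
    have hle : around W V ≤ around ⊤ V := around_mono_left le_top V
    have hWU : around W V ≤ U := (around_le W V).trans k
    have hyW' : diag π y ∈ around W V :=
      ⟨hyW, (le_around (W := ⊤) (V := V) (π := π) le_top hyV).2⟩
    let ψ' : Γ(twist π (unitMod (square π)), around W V) := res _ (around_le W V) ψ
    let D' : Γ(atiyah π E, diag π ⁻¹ᵁ around W V) := res _ (Scheme.Hom.preimage_mono _ hWU) D
    have hψ' : principalDer (diagUnit π) ψ' = atAnchor D' := by
      refine (app_res (principalPart (diagUnit π)) (around_le W V) ψ).trans ?_
      refine (congrArg (res ((diagPush π).obj (tangent π)) (around_le W V)) hψ).trans ?_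
      exact res_res (tangent π) (Scheme.Hom.preimage_mono _ k)
        (Scheme.Hom.preimage_mono _ (around_le W V)) (atAnchor D)
    have h₁ : principalDer (boxToDiag π (sl E r) (sl E r)) (res _ hWU φ) =
        (tensorSection π Ω).app _ (atAnchor D') := by
      refine (app_res (principalPart (boxToDiag π (sl E r) (sl E r))) hWU φ).trans ?_
      refine (congrArg (res (derSheaf π (tensor (sl E r) (sl E r)))
        (Scheme.Hom.preimage_mono _ hWU)) h).trans ?_
      exact (app_res (tensorSection π Ω) (Scheme.Hom.preimage_mono _ hWU) (atAnchor D)).symm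
    obtain ⟨n, hn⟩ := (diagonalSequence_locallyExact π E r hX).exists_eq (around W V)
      (res _ hWU φ - twistMul ψ' (res _ hle (d.boxTensor π)))
      ((map_sub ((principalPart (boxToDiag π (sl E r) (sl E r))).app (around W V)).hom _ _).trans
        (sub_eq_zero.2 (h₁.trans (by rw [← hψ', ← principalDer_twistMul hΩ d]; rfl))))
    refine ⟨around W V, hyW', hWU,
      boxBracket n + (d.restrict (diag_preimage_le hle)).atiyahTerm D', fun y' hy' ↦
        ⟨around W V, le_rfl, hy', V, d, hle, ?_⟩⟩
    rw [res_self, res_self, res_self]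
    exact ⟨ψ', n, hψ', (sub_eq_iff_eq_add'.1 hn.symm), rfl⟩
  · obtain ⟨W, hzW, hWU, hW⟩ := exists_disjoint (fun y hy ↦ hd ⟨y, hy⟩) hz
    exact ⟨W, hzW, hWU, 0, fun y hy ↦ (hW y hy).elim⟩

theorem neg_nsmul_app {X : Scheme.{u}} {M N : X.Modules} (f : M ⟶ N) (n : ℕ) (U : X.Opens)
    (s : Γ(M, U)) : (-(n • f)).app U s = -(n • f.app U s) := by
  let g : (M ⟶ N) →+ Γ(N, U) := AddMonoidHom.mk' (fun f ↦ f.app U s) (fun _ _ ↦ rfl)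
  exact (map_neg g (n • f)).trans (congrArg Neg.neg (map_nsmul g n f))

/-- The sum of the bracket of the diagonal extension, pulled back by `Ω`, and of the traceless
part of `2r` times the Atiyah extension splits. -/
theorem exists_splitting (hX : ∀ n : ℕ, n ≠ 0 → IsUnit (n : Γ(C, (⊤ : C.Opens))))
    {Ω : Γ(tensor (sl E r) (sl E r), (⊤ : C.Opens))} (hΩ : IsTraceDual E r Ω)
    {c : Γ(C, (⊤ : C.Opens))} (hc : IsInvRank E r c) :
    ∃ θ : (fibreSequence (diagonalSequence π (sl E r) (sl E r))
        ((atiyahSequence π E).map (diagPush π)) ((diagPush π).map (tensorSection π Ω))).X₂ ⟶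
          (diagPush π).obj (sl E r),
      (fibreSequence (diagonalSequence π (sl E r) (sl E r))
        ((atiyahSequence π E).map (diagPush π)) ((diagPush π).map (tensorSection π Ω))).f ≫ θ =
      prodFst _ _ ≫ (boxToDiag π (sl E r) (sl E r) ≫ (diagPush π).map (bracket E r)) +
        prodSnd _ _ ≫ (-((2 * r) • (diagPush π).map (slProj hc))) := by
  have h₂ : IsUnit (2 : Γ(C, (⊤ : C.Opens))) := by exact_mod_cast hX 2 two_ne_zero
  let P := diagonalSequence π (sl E r) (sl E r)
  let Q := (atiyahSequence π E).map (diagPush π)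
  let t : Q.X₃ ⟶ P.X₃ := (diagPush π).map (tensorSection π Ω)
  -- Being the value of a pair is a local, functional and linear relation that is locally solvable,
  -- so it is the graph of a morphism on the fibre product.
  obtain ⟨θ, hθ⟩ := exists_hom_of_local (M := (fibreProd P.g (Q.g ≫ t)).toModules)
    (N := (diagPush π).obj (sl E r))
    (fun U p m ↦ IsValue (U := U) ((fibFst P.g (Q.g ≫ t)).app U p)
      ((fibSnd P.g (Q.g ≫ t)).app U p) m)
    (fun k p m H ↦ by
      rw [app_res, app_res]
      exact IsValue.res H k)
    (fun U p m m' H H' ↦ IsValue.eq hX H H')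
    (fun U p z hz ↦ by
      obtain ⟨W, hzW, k, m, hm⟩ := exists_isValue hX hΩ ((fibFst P.g (Q.g ≫ t)).app U p)
        ((fibSnd P.g (Q.g ≫ t)).app U p) (fib_condition p) hz
      refine ⟨W, hzW, k, m, ?_⟩
      rw [app_res, app_res]
      exact hm)
    (fun U p p' m m' H H' ↦ by
      rw [map_add, map_add]
      exact IsValue.add h₂ H H')
    (fun U f p m H ↦ by
      rw [Scheme.Modules.Hom.app_smul, Scheme.Modules.Hom.app_smul]
      exact IsValue.smul H f)
  refine ⟨θ, hom_ext_sections fun U p ↦ ?_⟩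
  refine (hθ U ((fibreSequence P Q t).f.app U p)
    (boxBracket ((prodFst P.X₁ Q.X₁).app U p) -
      (2 * r) • slPart hc ((prodSnd P.X₁ Q.X₁).app U p : Γ(gl E, diag π ⁻¹ᵁ U)))
    (isValue_mulSection hc _ _)).trans ?_
  let n : Γ(P.X₁, U) := (prodFst P.X₁ Q.X₁).app U p
  let a : Γ((diagPush π).obj (gl E), U) := (prodSnd P.X₁ Q.X₁).app U p
  exact (sub_eq_add_neg _ _).trans (congrArg (boxBracket n + ·)
    (neg_nsmul_app ((diagPush π).map (slProj hc)) (2 * r) U a).symm)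

end Splitting

/-! ### Comparison of the classes. -/

section Classes

/-- The projection of the fibre product to Q is the identity on the quotient, so the relation
between the two pushed-out classes involves the class of Q itself; the sign in `-(n • γ)` puts it on
the other side. -/
theorem fibre_extClass {X : Scheme.{u}} [HasExt.{w} X.Modules] {P Q : ShortComplex X.Modules}
    (t : Q.X₃ ⟶ P.X₃) (hP : LocallyExact P) (hQ : LocallyExact Q) (h₁ : P.ShortExact)
    (h₂ : Q.ShortExact) {Y : X.Modules} (θ : (fibreSequence P Q t).X₂ ⟶ Y) (β : P.X₁ ⟶ Y)
    (γ : Q.X₁ ⟶ Y) (n : ℕ)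
    (hθ : (fibreSequence P Q t).f ≫ θ = prodFst _ _ ≫ β + prodSnd _ _ ≫ (-(n • γ))) :
    ((Abelian.Ext.mk₀ t).comp h₁.extClass (zero_add 1)).comp (Abelian.Ext.mk₀ β) (add_zero 1) =
      n • h₂.extClass.comp (Abelian.Ext.mk₀ γ) (add_zero 1) := by
  have h := extClass_add_eq_zero (fibreSequence_locallyExact t hP hQ).shortExact h₁ h₂
    (fibreSequenceFst _ _ _) (fibreSequenceSnd _ _ _) θ β (-(n • γ)) hθ
  refine (eq_neg_of_add_eq_zero_left h).trans ?_
  have h₃ : (Abelian.Ext.mk₀ (fibreSequenceSnd P Q t).τ₃).comp h₂.extClass (zero_add 1) =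
      h₂.extClass := Abelian.Ext.mk₀_id_comp _
  let f : (Q.X₁ ⟶ Y) →+ Abelian.Ext Q.X₃ Y 1 :=
    AddMonoidHom.mk' (fun g ↦ h₂.extClass.comp (Abelian.Ext.mk₀ g) (add_zero 1))
      (fun g g' ↦ by rw [Abelian.Ext.mk₀_add, Abelian.Ext.comp_add])
  have h₄ : f (-(n • γ)) = -(n • f γ) := by rw [map_neg, map_nsmul]
  refine (congrArg (fun e : Abelian.Ext Q.X₃ Q.X₁ 1 ↦
    -(e.comp (Abelian.Ext.mk₀ (-(n • γ))) (add_zero 1))) h₃).trans ?_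
  exact (congrArg Neg.neg h₄).trans (neg_neg _)

/-- Applying p to a decomposition of e removes the part along σ and returns ℓ. Conversely the
identity of G splits e as its images along p and τ. So the component ℓ exists and is unique,
although the class a need not be. -/
theorem exists_eq_add_iff {𝒜 : Type*} [Category 𝒜] [Abelian 𝒜] [HasExt.{w} 𝒜] {T G L U : 𝒜}
    {ι : L ⟶ G} {σ : U ⟶ G} {p : G ⟶ L} {τ : G ⟶ U} (hι : ι ≫ p = 𝟙 L) (hσ : σ ≫ p = 0)
    (h : p ≫ ι + τ ≫ σ = 𝟙 G) (e : Abelian.Ext T G 1) (ℓ : Abelian.Ext T L 1) :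
    (∃ a : Abelian.Ext T U 1, e = ℓ.comp (Abelian.Ext.mk₀ ι) (add_zero 1) +
      a.comp (Abelian.Ext.mk₀ σ) (add_zero 1)) ↔
      ℓ = e.comp (Abelian.Ext.mk₀ p) (add_zero 1) := by
  constructor
  · rintro ⟨a, rfl⟩
    rw [Abelian.Ext.add_comp, Abelian.Ext.comp_assoc_of_second_deg_zero,
      Abelian.Ext.comp_assoc_of_second_deg_zero, Abelian.Ext.mk₀_comp_mk₀,
      Abelian.Ext.mk₀_comp_mk₀, hι, hσ, Abelian.Ext.mk₀_zero,
      Abelian.Ext.comp_zero, Abelian.Ext.comp_mk₀_id, add_zero]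
  · rintro rfl
    refine ⟨e.comp (Abelian.Ext.mk₀ τ) (add_zero 1), ?_⟩
    rw [Abelian.Ext.comp_assoc_of_second_deg_zero, Abelian.Ext.comp_assoc_of_second_deg_zero,
      Abelian.Ext.mk₀_comp_mk₀, Abelian.Ext.mk₀_comp_mk₀,
      ← Abelian.Ext.comp_add, ← Abelian.Ext.mk₀_add, h, Abelian.Ext.comp_mk₀_id]

variable {C S : Scheme.{u}} {π : C ⟶ S} {E : C.Modules} {r : ℕ} [IsLocallyFreeOfRank E r]
  [HasExt.{w} (square π).Modules]

theorem bracketSymbol_eq [IsSeparated π] [SmoothOfRelativeDimension 1 π]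
    (hX : ∀ n : ℕ, n ≠ 0 → IsUnit (n : Γ(C, (⊤ : C.Opens))))
    {Ω : Γ(tensor (sl E r) (sl E r), (⊤ : C.Opens))} (hΩ : IsTraceDual E r Ω)
    {c : Γ(C, (⊤ : C.Opens))} (hc : IsInvRank E r c)
    (h₁ : (diagonalSequence π (sl E r) (sl E r)).ShortExact)
    (h₂ : ((atiyahSequence π E).map (diagPush π)).ShortExact) :
    bracketSymbol Ω h₁ = (2 * r) • h₂.extClass.comp
      (Abelian.Ext.mk₀ ((diagPush π).map (slProj hc))) (add_zero 1) := by
  obtain ⟨θ, hθ⟩ := exists_splitting (π := π) hX hΩ hc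
  exact fibre_extClass (P := diagonalSequence π (sl E r) (sl E r))
    (Q := (atiyahSequence π E).map (diagPush π)) ((diagPush π).map (tensorSection π Ω))
    (diagonalSequence_locallyExact π E r hX) (atiyahSequence_locallyExact E r) h₁ h₂ θ
    (boxToDiag π (sl E r) (sl E r) ≫ (diagPush π).map (bracket E r))
    ((diagPush π).map (slProj hc)) (2 * r) hθ

theorem isTracelessAtiyahClass_iff {c : Γ(C, (⊤ : C.Opens))} (hc : IsInvRank E r c)
    (h₂ : ((atiyahSequence π E).map (diagPush π)).ShortExact)
    (ℓ : Abelian.Ext ((diagPush π).obj (tangent π)) ((diagPush π).obj (sl E r)) 1) :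
    IsTracelessAtiyahClass h₂ ℓ ↔
      ℓ = h₂.extClass.comp (Abelian.Ext.mk₀ ((diagPush π).map (slProj hc))) (add_zero 1) := by
  have hι : (diagPush π).map (slIncl E r) ≫ (diagPush π).map (slProj hc) = 𝟙 _ := by
    rw [← Functor.map_comp, slIncl_slProj, CategoryTheory.Functor.map_id]
  have hσ : (diagPush π).map (scalars E) ≫ (diagPush π).map (slProj hc) = 0 := by
    rw [← Functor.map_comp, scalars_slProj, Functor.map_zero]
  have h : (diagPush π).map (slProj hc) ≫ (diagPush π).map (slIncl E r) +
      (diagPush π).map (scaledTrace E r c) ≫ (diagPush π).map (scalars E) = 𝟙 _ := by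
    rw [← Functor.map_comp, ← Functor.map_comp, ← Functor.map_add, slProj_slIncl_add,
      CategoryTheory.Functor.map_id]
  exact exists_eq_add_iff hι hσ h h₂.extClass ℓ

/-- The integer is already invertible in the ground field, which maps to the ring of global
functions. -/
theorem isUnit_natCast {k : Type u} [Field k] [CharZero k] {X : Scheme.{u}}
    (f : X ⟶ Spec (CommRingCat.of k)) (n : ℕ) (hn : n ≠ 0) : IsUnit (n : Γ(X, (⊤ : X.Opens))) := by
  let g : k →+* Γ(X, (⊤ : X.Opens)) :=
    ((Scheme.ΓSpecIso (CommRingCat.of k)).inv ≫ f.appTop).hom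
  have h : IsUnit (n : k) := (Nat.cast_ne_zero.2 hn).isUnit
  have := h.map g
  rwa [map_natCast] at this

end Classes

end HitchinSymbol

end

open HitchinSymbol in
theorem proposition4p8 {k : Type u} [Field k] [CharZero k] {C S : Scheme.{u}}
    (s : S ⟶ Spec (CommRingCat.of k)) (π : C ⟶ S) [SmoothOfRelativeDimension 1 π]
    [IsSeparated π] [HasExt.{w} (square π).Modules]
    (E : C.Modules) (r : ℕ) [IsLocallyFreeOfRank E r] :
    ∃ (h₁ : (diagonalSequence π (sl E r) (sl E r)).ShortExact)
      (h₂ : ((atiyahSequence π E).map (diagPush π)).ShortExact),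
      (∃! Ω, IsTraceDual E r Ω) ∧ (∃! ℓ, IsTracelessAtiyahClass (r := r) h₂ ℓ) ∧
        ∀ Ω, IsTraceDual E r Ω → ∀ ℓ, IsTracelessAtiyahClass h₂ ℓ →
          bracketSymbol Ω h₁ = (2 * r) • ℓ := by
  have hX := isUnit_natCast (π ≫ s)
  -- A choice of `c` fixes the projection to the traceless part, and with it the formula that makes
  -- ℓ unique.
  obtain ⟨c, hc⟩ := exists_isInvRank E r hX
  refine ⟨(diagonalSequence_locallyExact π E r hX).shortExact,
    (atiyahSequence_locallyExact E r).shortExact, existsUnique_isTraceDual E r hX,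
    ⟨_, (isTracelessAtiyahClass_iff hc _ _).2 rfl, fun ℓ hℓ ↦
      (isTracelessAtiyahClass_iff hc _ ℓ).1 hℓ⟩, fun Ω hΩ ℓ hℓ ↦ ?_⟩
  rw [(isTracelessAtiyahClass_iff hc _ ℓ).1 hℓ]
  exact bracketSymbol_eq hX hΩ hc _ _
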